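/- **Conventions.** Let $P$ be a finite graded bounded poset with rank function $\operatorname{rk}$, least element $\hat 0$ and greatest element $\hat 1$; write $s\lessdot t$ if $t$ covers $s$. For $s<t$ the reduced characteristic polynomial is $\overline\chi_{s,t}(x)=\frac{1}{x-1}\sum_{s\le w\le t}\mu(s,w)\,x^{\operatorname{rk}t-\operatorname{rk}w}$, where $\mu$ is the Möbius function. Define $\underline{\mathrm H}_{\hat 1,\hat 1}(x)=1$ and $\underline{\mathrm H}_{s,\hat 1}(x)=\sum_{t>s}\overline\chi_{s,t}(x)\,\underline{\mathrm H}_{t,\hat 1}(x)$ for $s\neq\hat 1$. The *Chow polynomial* of $P$ is $\underline{\mathrm H}_P=\underline{\mathrm H}_{\hat 0,\hat 1}$ and the *augmented Chow polynomial* is $\mathrm H_P(x)=\sum_{s\in P}x^{\operatorname{rk}s}\,\underline{\mathrm H}_{s,\hat 1}(x)$. The order complex $\Delta(P)$ is the simplicial complex of chains of $P$. The $h$-polynomial of a simplicial complex $\Delta$ of dimension $d-1$ with $f_i$ simplices of cardinality $i$ is $h(\Delta;y)=\sum_{i=0}^d f_i\,y^i(1-y)^{d-i}$. $P^*$ denotes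 the dual poset. If $P$ has rank $r$ and $S\subseteq\{1,\dots,r-1\}$, the *rank-selected* poset $P_S$ is the induced subposet on $\{x\in P:\operatorname{rk}x\in S\cup\{0,r\}\}$. An edge labeling $\lambda$ of $P$, i.e. a map from the covering relations of $P$ to a totally ordered set, is an *EL-labeling* if for all $s\le t$ there is a unique maximal chain of $[s,t]$ whose labels increase weakly, and this chain is lexicographically minimal among all maximal chains of $[s,t]$. For $s\in P$ let $\lambda_1<\dots<\lambda_\ell$ be the distinct labels of the covering relations above $s$. The *width* $\omega_s(i)$ is the number of covers $t$ of $s$ with $\lambda(s,t)=\lambda_i$ (and $0$ for $i>\ell$). For $s\lessdot t$, $\mathrm{Ind}(s,t)$ is the $i$ with $\lambda(s,t)=\lambda_i$, and $\mathrm{des}_s(t)$ is the number of distinct labels of covering relations above $t$ that are smaller than $\lambda(s,t)$. The poset $P$ is *UMEL-shellable* if it has an EL-labeling such that * for all $s,s'$ of the same rank, $\omega_s=\omega_{s'}$; * for all $s,s'$ of the same rank and all $s\lessdot t$, $s'\lessdot t'$ with $\mathrm{Ind}(s,t)=\mathrm{Ind}(s',t')$, $\mathrm{des}_s(t)=\mathrm{des}_{s'}(t')$;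 * for each rank $k$, the number $\mathrm{des}_k(i)$, which is the common value of $\mathrm{des}_s(t)$ over all $s\lessdot t$ with $\operatorname{rk}s=k$ and $\mathrm{Ind}(s,t)=i$, is weakly increasing in $i$. The roots of two nonzero real-rooted polynomials $f,g$ *interlace* if, for $(f,g)$ or for $(g,f)$ in place of $(f,g)$, $\deg g\in\{\deg f,\deg f+1\}$ and the roots $\alpha_1\ge\alpha_2\ge\cdots$ of $f$ and $\beta_1\ge\beta_2\ge\cdots$ of $g$, with multiplicity, satisfy $\beta_1\ge\alpha_1\ge\beta_2\ge\alpha_2\ge\cdots$. **Theorem.** Let $P$ be a UMEL-shellable finite graded bounded poset of rank $r$, let $S\subseteq\{1,\dots,r-1\}$, and let $P_S$ be the rank-selected subposet. Then: 1. the Chow polynomials $\underline{\mathrm H}_{P_S}(x)$ and $\underline{\mathrm H}_{P_S^*}(x)$ have only real nonpositive roots; 2. the augmented Chow polynomial $\mathrm H_{P_S}(x)$ has only real nonpositive roots; 3. the roots of $\underline{\mathrm H}_{P_S}(x)$ and $\mathrm H_{P_S}(x)$ interlace; 4. the $h$-polynomial of the order complex $\Delta(P_S)$ has only real nonpositive roots.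 -/

import Mathlib

open Polynomial

universe u v

/-! ### Finite graded bounded posets -/

section Rank

variable {P : Type u} [PartialOrder P]

/-- The rank of `x`: the maximal length of a chain `x₀ < x₁ < ⋯ < x_k = x`. -/
noncomputable def posetRank (x : P) : ℕ := (Order.height x).toNat

/-- A finite poset with a least element is graded if every covering relation raises the rank
by one (equivalently, for each `x` all maximal chains from the least element to `x` have the
same length, namely the rank of `x`). -/
def IsGradedPoset (P : Type u) [PartialOrder P] : Prop :=
  ∀ s t : P, s ⋖ t → posetRank t = posetRank s + 1

end Rank

/-! ### Rank selection -/

/-- The rank-selected subposet `P_S`, with the order induced from `P`. -/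
def RankSelected (P : Type u) [PartialOrder P] [BoundedOrder P] (S : Finset ℕ) : Type u :=
  {x : P // posetRank x ∈ S ∨ posetRank x = 0 ∨ posetRank x = posetRank (⊤ : P)}

instance RankSelected.instPartialOrder (P : Type u) [PartialOrder P] [BoundedOrder P]
    (S : Finset ℕ) : PartialOrder (RankSelected P S) :=
  Subtype.partialOrder _

instance RankSelected.instBoundedOrder (P : Type u) [PartialOrder P] [BoundedOrder P]
    (S : Finset ℕ) : BoundedOrder (RankSelected P S) where
  top := ⟨⊤, Or.inr (Or.inr rfl)⟩
  le_top x := (le_top : x.1 ≤ ⊤)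
  bot := ⟨⊥, Or.inr (Or.inl (by simp [posetRank]))⟩
  bot_le x := (bot_le : ⊥ ≤ x.1)

open Classical in
noncomputable instance RankSelected.instFintype (P : Type u) [PartialOrder P] [BoundedOrder P]
    [Fintype P] (S : Finset ℕ) : Fintype (RankSelected P S) :=
  Subtype.fintype _

/-! ### Chow polynomials -/

section Chow

variable {P : Type u} [PartialOrder P] [Fintype P]

open Classical in
/-- The Möbius function `μ(s, t)` of a finite poset. -/
noncomputable def mobiusFun (s t : P) : ℤ :=
  letI : LocallyFiniteOrder P := Fintype.toLocallyFiniteOrder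
  IncidenceAlgebra.mu ℤ s t

open Classical in
/-- The characteristic polynomial of the interval `[s, t]`:
`∑_{s ≤ w ≤ t} μ(s, w) x^(rk t - rk w)`. -/
noncomputable def intervalCharPoly (s t : P) : ℝ[X] :=
  ∑ w : P with s ≤ w ∧ w ≤ t, C (mobiusFun s w : ℝ) * X ^ (posetRank t - posetRank w)

/-- The reduced characteristic polynomial of `[s, t]` for `s < t`: the (exact) quotient of the
characteristic polynomial by `x - 1`. -/
noncomputable def reducedCharPoly (s t : P) : ℝ[X] :=
  intervalCharPoly s t /ₘ (X - C 1)

open Classical in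
/-- The Chow polynomial of the upper interval `[s, ⊤]`, by the recursion
`H_{s,⊤} = ∑_{s < t} χ̄_{s,t} H_{t,⊤}` for `s ≠ ⊤` and `H_{⊤,⊤} = 1`. -/
noncomputable def chowUpper [OrderTop P] (s : P) : ℝ[X] :=
  if s = ⊤ then 1
  else ∑ t : {t : P // s < t}, reducedCharPoly s t.1 * chowUpper t.1
termination_by wellFounded_gt.wrap s
decreasing_by exact t.2

end Chow

/-- The Chow polynomial of a finite graded bounded poset. -/
noncomputable def chowPoly (P : Type u) [PartialOrder P] [BoundedOrder P] [Fintype P] : ℝ[X] :=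
  chowUpper (⊥ : P)

/-- The augmented Chow polynomial of a finite graded bounded poset. -/
noncomputable def augChowPoly (P : Type u) [PartialOrder P] [BoundedOrder P] [Fintype P] :
    ℝ[X] :=
  ∑ s : P, X ^ posetRank s * chowUpper s

/-! ### Order complex and `h`-polynomial -/

/-- The order complex of a poset: its faces are the nonempty finite chains. -/
def orderComplex (P : Type u) [PartialOrder P] : AbstractSimplicialComplex P where
  faces := {c | c.Nonempty ∧ IsChain (· ≤ ·) (c : Set P)}
  isRelLowerSet_faces := fun _ hc =>
    ⟨hc.1, fun _ hb hne => ⟨hne, hc.2.mono (Finset.coe_subset.mpr hb)⟩⟩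
  singleton_mem x := ⟨Finset.singleton_nonempty x, by simp⟩

section HPoly

variable {ι : Type u} [Fintype ι]

open Classical in
/-- The number of simplices of cardinality `i`; the empty simplex is counted. -/
noncomputable def faceNumber (Δ : AbstractSimplicialComplex ι) (i : ℕ) : ℕ :=
  Finset.card {c : Finset ι | (c = ∅ ∨ c ∈ Δ) ∧ c.card = i}

open Classical in
/-- `dim Δ + 1`, the maximal cardinality of a simplex. -/
noncomputable def maxFaceCard (Δ : AbstractSimplicialComplex ι) : ℕ :=
  Finset.sup {c : Finset ι | c ∈ Δ} Finset.card

/-- The `h`-polynomial of a simplicial complex of dimension `d - 1`: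
`h(y) = (1 - y)^d f(y / (1 - y)) = ∑_{i ≤ d} f_i y^i (1 - y)^(d - i)`. -/
noncomputable def hPoly (Δ : AbstractSimplicialComplex ι) : ℝ[X] :=
  ∑ i ∈ Finset.range (maxFaceCard Δ + 1),
    C (faceNumber Δ i : ℝ) * X ^ i * (1 - X) ^ (maxFaceCard Δ - i)

end HPoly

/-! ### Edge labelings -/

/-- `c` is a saturated chain `s = u₀ ⋖ u₁ ⋖ ⋯ ⋖ u_k = t`. -/
def IsSaturatedChain {P : Type u} [PartialOrder P] (s t : P) (c : List P) : Prop :=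
  c.head? = some s ∧ c.getLast? = some t ∧ c.IsChain (· ⋖ ·)

/-- The list of labels `lam u₀ u₁, lam u₁ u₂, …` of a chain `u₀, u₁, u₂, …`. -/
def chainLabels {P : Type u} {L : Type v} (lam : P → P → L) (c : List P) : List L :=
  List.zipWith lam c c.tail

section Labeling

variable {P : Type u} [PartialOrder P] {L : Type v} [LinearOrder L]

/-- An edge labeling is a function `lam` of which only the values `lam s t` with `s ⋖ t` matter.
It is edge-lexicographical (EL) if every interval `[s, t]` has a unique maximal chain with weakly
increasing labels, and that chain is lexicographically minimal among the maximal chains of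
`[s, t]`. -/
def IsELLabeling (lam : P → P → L) : Prop :=
  ∀ s t : P, s ≤ t → ∃ c : List P,
    (IsSaturatedChain s t c ∧ (chainLabels lam c).IsChain (· ≤ ·)) ∧
    (∀ c' : List P, IsSaturatedChain s t c' → (chainLabels lam c').IsChain (· ≤ ·) → c' = c) ∧
    (∀ c' : List P, IsSaturatedChain s t c' → chainLabels lam c ≤ chainLabels lam c')

variable [Fintype P]

open Classical in
/-- The set of labels of the covering relations above `s`. -/
noncomputable def labelsAbove (lam : P → P → L) (s : P) : Finset L :=
  Finset.image (lam s) {t : P | s ⋖ t}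

/-- The index of the label of `s ⋖ t`: the `i` such that `lam s t` is the `i`-th smallest label
above `s` (counting from `1`). -/
noncomputable def labelIndex (lam : P → P → L) (s t : P) : ℕ :=
  Finset.card {a ∈ labelsAbove lam s | a ≤ lam s t}

open Classical in
/-- The width above `s` at `i`: the number of covers of `s` labeled by the `i`-th label
above `s`. -/
noncomputable def labelWidth (lam : P → P → L) (s : P) (i : ℕ) : ℕ :=
  Finset.card {t : P | s ⋖ t ∧ labelIndex lam s t = i}

/-- The descent count of `s ⋖ t`: the number of labels above `t` smaller than `lam s t`. -/
noncomputable def descentCount (lam : P → P → L) (s t : P) : ℕ :=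
  Finset.card {a ∈ labelsAbove lam t | a < lam s t}

/-- Rank-uniformity of a labeled poset: uniform widths and uniform descents. -/
def IsRankUniformLabeling (lam : P → P → L) : Prop :=
  (∀ s s' : P, posetRank s = posetRank s' →
    ∀ i : ℕ, 1 ≤ i → labelWidth lam s i = labelWidth lam s' i) ∧
  (∀ s s' t t' : P, posetRank s = posetRank s' → s ⋖ t → s' ⋖ t' →
    labelIndex lam s t = labelIndex lam s' t' → descentCount lam s t = descentCount lam s' t')

/-- Monotonicity of a rank-uniform labeled poset: at each rank the descent count is a weakly
increasing function of the label index. -/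
def IsMonotonicLabeling (lam : P → P → L) : Prop :=
  ∀ s s' t t' : P, posetRank s = posetRank s' → s ⋖ t → s' ⋖ t' →
    labelIndex lam s t ≤ labelIndex lam s' t' → descentCount lam s t ≤ descentCount lam s' t'

end Labeling

/-- A finite graded bounded poset is UMEL-shellable if it has an EL-labeling, with labels in some
totally ordered set, that is rank-uniform and monotonic. -/
def UMELShellable (P : Type u) [PartialOrder P] [BoundedOrder P] [Fintype P] : Prop :=
  IsGradedPoset P ∧
    ∃ (L : Type v) (_ : LinearOrder L) (lam : P → P → L),
      IsELLabeling lam ∧ IsRankUniformLabeling lam ∧ IsMonotonicLabeling lam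

/-! ### Roots of polynomials -/

/-- All complex roots of the polynomial are real and nonpositive (this fails for the zero
polynomial). -/
def HasOnlyNonposRealRoots (f : ℝ[X]) : Prop :=
  ∀ z : ℂ, aeval z f = 0 → ∃ x : ℝ, x ≤ 0 ∧ z = (x : ℂ)

/-- `f ≼ g` for nonzero polynomials: `f` and `g` are real-rooted of degrees `n` and
`m ∈ {n, n + 1}`, with roots `α₀ ≥ α₁ ≥ ⋯` and `β₀ ≥ β₁ ≥ ⋯` (counted with multiplicity) such
that `β₀ ≥ α₀ ≥ β₁ ≥ α₁ ≥ ⋯`. -/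
def Interlaces (f g : ℝ[X]) : Prop :=
  f ≠ 0 ∧ g ≠ 0 ∧ ∃ (n m : ℕ) (α β : ℕ → ℝ), (m = n ∨ m = n + 1) ∧
    f = C f.leadingCoeff * ∏ i ∈ Finset.range n, (X - C (α i)) ∧
    g = C g.leadingCoeff * ∏ i ∈ Finset.range m, (X - C (β i)) ∧
    (∀ i, i < n → α i ≤ β i) ∧
    (∀ i, i + 1 < m → β (i + 1) ≤ α i)

/-- The roots of `f` and `g` interlace. -/
def RootsInterlace (f g : ℝ[X]) : Prop :=
  Interlaces f g ∨ Interlaces g f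

/-! ### A bilinear form of interlacing -/

/-! Read f ≼ g (`Prec`) as: for z in the upper half plane, g(z)/f(z) lies in the closed sector
between the positive real axis and the ray through z. Between polynomials with nonpositive zeros
that are positive on the positive half line, this forces the zeros to interlace (`Prec.interlaces`).
Being given by two inequalities that are bilinear over the reals, it passes to sums in either
argument, so interlacing of whole families can be carried through recursions.

The recursions come from the labeling. In an EL-labeled poset every t > s ends exactly one rising
chain from s, so a sum over t > s splits according to the first edge of that chain. A rising chain
continues after an edge exactly through the edges whose label index exceeds the descent count of
that edge. By uniformity the contribution of an edge depends only on its rank k and label index i,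
and a sum weighted by ranks is computed by repeated weighted suffix sums over j > desc_k(i), where
desc_k is weakly increasing. Rank selection only changes the weights of the ranks
(`IsRankData.sum_selected_eq`).

Möbius inversion turns the definition of the Chow polynomials into a linear system
(`sum_ge_pow_mul_chowUpper`). For s ≠ 1̂ it says that (x - 1) H_s is the difference of two sums over
t > s which are reversals of each other. In terms of edges, a family g_i with reversals g'_i at one
rank yields H = (∑ g' - ∑ g)/(x - 1), and at the next lower rank, if the present one is selected,
the family xH + ∑_{j > d} g_j. The heart of the proof is that this step preserves the chain g_1 ≼ ⋯
≼ g_m ≼ g'_m ≼ ⋯ ≼ g'_1 (`SymInterlacing.quotient_suffix_sums`). The division by x - 1 is handled in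
`Prec.of_sub_one_mul_eq`: partial fractions with respect to G reduce it to single poles, where the
quotient is explicit up to a multiple of G, and the sign of that multiple is read off at 0.

At rank 0 the Chow polynomial is H and the augmented one is xH + ∑ g; the relation xH + ∑ g ≼ xH
gives their interlacing. The dual Chow polynomial solves the transposed system; it is again xH + ∑
g, for the family that starts with the pair (1, 1) instead of (1, x). For the h-polynomial the
weight of a selected rank is 1 - x, and the step becomes ∑_{j > d} g_j + x ∑_{j ≤ d} g_j, a
classical interlacing-preserving operation. -/

open ComplexConjugate in
/-- The relation `f ≼ g` between real polynomials, phrased in the upper half plane: for every `z`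
there, the values `f z`, `g z`, `z * f z` occur in this angular order. Unlike interlacing of
zeros, this is visibly additive in each argument. -/
def Prec (f g : ℝ[X]) : Prop :=
  ∀ z : ℂ, 0 < z.im → 0 ≤ (aeval z g * conj (aeval z f)).im ∧
    0 ≤ (z * aeval z f * conj (aeval z g)).im

namespace Prec

variable {f g h : ℝ[X]}

theorem refl (f : ℝ[X]) : Prec f f := by
  intro z hz
  refine ⟨by rw [Complex.mul_conj]; simp, ?_⟩
  rw [mul_assoc, Complex.mul_conj]
  simp only [Complex.im_mul_ofReal]
  exact mul_nonneg hz.le (Complex.normSq_nonneg _)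

theorem zero_left (f : ℝ[X]) : Prec 0 f := fun z _ => by simp

theorem zero_right (f : ℝ[X]) : Prec f 0 := fun z _ => by simp

theorem add_left (h₁ : Prec f h) (h₂ : Prec g h) : Prec (f + g) h := by
  intro z hz
  have a := h₁ z hz
  have b := h₂ z hz
  simp only [map_add, mul_add, add_mul, Complex.add_im]
  exact ⟨add_nonneg a.1 b.1, add_nonneg a.2 b.2⟩

theorem add_right (h₁ : Prec f g) (h₂ : Prec f h) : Prec f (g + h) := by
  intro z hz
  have a := h₁ z hz
  have b := h₂ z hz
  simp only [map_add, mul_add, add_mul, Complex.add_im]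
  exact ⟨add_nonneg a.1 b.1, add_nonneg a.2 b.2⟩

theorem C_mul_left {c : ℝ} (hc : 0 ≤ c) (h₁ : Prec f g) : Prec (C c * f) g := by
  intro z hz
  have a := h₁ z hz
  simp only [map_mul, aeval_C, Complex.coe_algebraMap, Complex.conj_ofReal]
  constructor
  · rw [mul_left_comm, Complex.im_ofReal_mul]; exact mul_nonneg hc a.1
  · rw [mul_left_comm, mul_assoc, Complex.im_ofReal_mul]; exact mul_nonneg hc a.2

theorem C_mul_right {c : ℝ} (hc : 0 ≤ c) (h₁ : Prec f g) : Prec f (C c * g) := by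
  intro z hz
  have a := h₁ z hz
  simp only [map_mul, aeval_C, Complex.coe_algebraMap, Complex.conj_ofReal]
  constructor
  · rw [mul_assoc, Complex.im_ofReal_mul]; exact mul_nonneg hc a.1
  · rw [mul_left_comm, Complex.im_ofReal_mul]; exact mul_nonneg hc a.2

theorem sum_left {ι : Type*} {s : Finset ι} {F : ι → ℝ[X]} (hF : ∀ i ∈ s, Prec (F i) g) :
    Prec (∑ i ∈ s, F i) g :=
  Finset.sum_induction F (Prec · g) (fun _ _ => add_left) (zero_left g) hF

theorem sum_right {ι : Type*} {s : Finset ι} {F : ι → ℝ[X]} (hF : ∀ i ∈ s, Prec g (F i)) :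
    Prec g (∑ i ∈ s, F i) :=
  Finset.sum_induction F (Prec g ·) (fun _ _ => add_right) (zero_right g) hF

theorem X_mul (h₁ : Prec f g) : Prec g (X * f) := by
  intro z hz
  have a := h₁ z hz
  simp only [map_mul, aeval_X]
  refine ⟨a.2, ?_⟩
  rw [show z * aeval z g * (starRingEnd ℂ z * starRingEnd ℂ (aeval z f))
    = (z * starRingEnd ℂ z) * (aeval z g * starRingEnd ℂ (aeval z f)) by ring,
    Complex.mul_conj, Complex.im_ofReal_mul]
  exact mul_nonneg (Complex.normSq_nonneg _) a.1

theorem linear_mul {θ : ℝ} (hθ : θ ≤ 0) (q : ℝ[X]) : Prec q ((X - C θ) * q) := by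
  intro z hz
  simp only [map_mul, map_sub, aeval_X, aeval_C, Complex.coe_algebraMap, Complex.conj_ofReal]
  constructor
  · rw [mul_assoc, Complex.mul_conj, Complex.im_mul_ofReal]
    exact mul_nonneg (by simpa using hz.le) (Complex.normSq_nonneg _)
  · rw [show z * aeval z q * ((starRingEnd ℂ z - θ) * starRingEnd ℂ (aeval z q))
      = (z * starRingEnd ℂ z - θ * z) * (aeval z q * starRingEnd ℂ (aeval z q)) by ring,
      Complex.mul_conj, Complex.mul_conj, Complex.im_mul_ofReal]
    refine mul_nonneg ?_ (Complex.normSq_nonneg _)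
    simp only [Complex.sub_im, Complex.ofReal_im, Complex.im_ofReal_mul]
    nlinarith

theorem of_mul_left {q : ℝ[X]} (hq : ∀ z : ℂ, 0 < z.im → aeval z q ≠ 0)
    (h₁ : Prec (q * f) (q * g)) : Prec f g := by
  intro z hz
  have a := h₁ z hz
  have hp : 0 < Complex.normSq (aeval z q) := Complex.normSq_pos.2 (hq z hz)
  simp only [map_mul] at a
  rw [show aeval z q * aeval z g * (starRingEnd ℂ (aeval z q) * starRingEnd ℂ (aeval z f))
      = (aeval z q * starRingEnd ℂ (aeval z q)) * (aeval z g * starRingEnd ℂ (aeval z f)) by ring,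
    show z * (aeval z q * aeval z f) * (starRingEnd ℂ (aeval z q) * starRingEnd ℂ (aeval z g))
      = (aeval z q * starRingEnd ℂ (aeval z q)) *
        (z * aeval z f * starRingEnd ℂ (aeval z g)) by ring,
    Complex.mul_conj, Complex.im_ofReal_mul, Complex.im_ofReal_mul] at a
  exact ⟨nonneg_of_mul_nonneg_right a.1 hp, nonneg_of_mul_nonneg_right a.2 hp⟩

theorem of_linear_mul {θ : ℝ} (h₁ : Prec ((X - C θ) * f) ((X - C θ) * g)) : Prec f g := by
  refine of_mul_left (fun z hz h0 => ?_) h₁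
  simp only [map_sub, aeval_X, aeval_C, Complex.coe_algebraMap] at h0
  have := congrArg Complex.im h0
  simp at this
  exact hz.ne' this

theorem of_X_mul (h₁ : Prec (X * f) (X * g)) : Prec f g :=
  of_linear_mul (θ := 0) (by simpa using h₁)

theorem of_prec_X_mul (h₁ : Prec g (X * f)) : Prec f g := of_X_mul h₁.X_mul

/-- Transitivity holds among polynomials that are all dominated from the left by a common
reference polynomial. -/
theorem trans_of_reference {a b c d : ℝ[X]} (ha : ∀ z : ℂ, 0 < z.im → aeval z a ≠ 0)
    (hc : ∀ z : ℂ, 0 < z.im → aeval z c ≠ 0) (hab : Prec a b) (hac : Prec a c) (had : Prec a d)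
    (hbc : Prec b c) (hcd : Prec c d) : Prec b d := by
  intro z hz
  have hA := ha z hz
  -- The numbers 1 and z form a real basis of ℂ, and the sector between them is the cone of
  -- nonnegative coordinates. In these coordinates the first inequality of a relation is the sign of
  -- a 2 × 2 determinant.
  have key : ∀ p : ℝ[X], Prec a p → ∃ s t : ℝ, 0 ≤ s ∧ 0 ≤ t ∧
      aeval z p = aeval z a * (s + t * z) := by
    intro p hp
    obtain ⟨h1, h2⟩ := hp z hz
    set w := aeval z p / aeval z a with hw
    have hpw : aeval z p = aeval z a * w := by rw [hw]; field_simp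
    have hn : 0 < Complex.normSq (aeval z a) := Complex.normSq_pos.2 hA
    have e1 : 0 ≤ w.im := by
      rw [hpw, show aeval z a * w * starRingEnd ℂ (aeval z a)
        = (aeval z a * starRingEnd ℂ (aeval z a)) * w by ring, Complex.mul_conj,
        Complex.im_ofReal_mul] at h1
      exact nonneg_of_mul_nonneg_right h1 hn
    have e2 : 0 ≤ (z * starRingEnd ℂ w).im := by
      rw [hpw, map_mul, show z * aeval z a * (starRingEnd ℂ (aeval z a) * starRingEnd ℂ w)
        = (aeval z a * starRingEnd ℂ (aeval z a)) * (z * starRingEnd ℂ w) by ring,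
        Complex.mul_conj, Complex.im_ofReal_mul] at h2
      exact nonneg_of_mul_nonneg_right h2 hn
    simp only [Complex.mul_im, Complex.conj_re, Complex.conj_im] at e2
    refine ⟨w.re - w.im / z.im * z.re, w.im / z.im, ?_, by positivity, ?_⟩
    · rw [div_mul_eq_mul_div, sub_nonneg, div_le_iff₀ hz]; nlinarith
    · rw [hpw]
      congr 1
      apply Complex.ext
      · simp
      · simp; field_simp
  obtain ⟨s₁, t₁, hs₁, ht₁, e₁⟩ := key b hab
  obtain ⟨s₂, t₂, hs₂, ht₂, e₂⟩ := key c hac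
  obtain ⟨s₃, t₃, hs₃, ht₃, e₃⟩ := key d had
  have im_eq : ∀ s t s' t' : ℝ, (aeval z a * (s' + t' * z) *
      starRingEnd ℂ (aeval z a * (s + t * z))).im
      = Complex.normSq (aeval z a) * z.im * (s * t' - s' * t) := by
    intro s t s' t'
    rw [map_mul, show aeval z a * (s' + t' * z) *
        (starRingEnd ℂ (aeval z a) * starRingEnd ℂ (s + t * z : ℂ)) =
        (aeval z a * starRingEnd ℂ (aeval z a)) * ((s' + t' * z) * starRingEnd ℂ (s + t * z : ℂ))
        by ring, Complex.mul_conj, Complex.im_ofReal_mul]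
    simp [Complex.mul_im]
    ring
  have hn : 0 < Complex.normSq (aeval z a) * z.im :=
    mul_pos (Complex.normSq_pos.2 hA) hz
  have q₁ := (hbc z hz).1
  have q₂ := (hcd z hz).1
  rw [e₁, e₂, im_eq] at q₁
  rw [e₂, e₃, im_eq] at q₂
  replace q₁ := nonneg_of_mul_nonneg_right q₁ hn
  replace q₂ := nonneg_of_mul_nonneg_right q₂ hn
  -- Transitivity of the slope order fails only through the zero vector, which c(z) ≠ 0 excludes.
  have hc0 : 0 < s₂ ∨ 0 < t₂ := by
    by_contra! hcon
    have h1 : s₂ = 0 := le_antisymm hcon.1 hs₂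
    have h2 : t₂ = 0 := le_antisymm hcon.2 ht₂
    exact hc z hz (by rw [e₂, h1, h2]; simp)
  have q₃ : 0 ≤ s₁ * t₃ - s₃ * t₁ := by
    rcases hc0 with h | h
    · have : 0 ≤ s₂ * (s₁ * t₃ - s₃ * t₁) := by
        nlinarith [mul_nonneg hs₁ q₂, mul_nonneg hs₃ q₁]
      exact nonneg_of_mul_nonneg_right this h
    · have : 0 ≤ t₂ * (s₁ * t₃ - s₃ * t₁) := by
        nlinarith [mul_nonneg ht₁ q₂, mul_nonneg ht₃ q₁]
      exact nonneg_of_mul_nonneg_right this h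
  constructor
  · rw [e₁, e₃, im_eq]; exact mul_nonneg hn.le q₃
  · rw [e₁, e₃, map_mul, show z * (aeval z a * (s₁ + t₁ * z)) *
        (starRingEnd ℂ (aeval z a) * starRingEnd ℂ (s₃ + t₃ * z : ℂ)) =
        (aeval z a * starRingEnd ℂ (aeval z a)) *
          (z * (s₁ + t₁ * z) * starRingEnd ℂ (s₃ + t₃ * z : ℂ))
        by ring, Complex.mul_conj, Complex.im_ofReal_mul]
    refine mul_nonneg (Complex.normSq_nonneg _) ?_
    have : (z * (s₁ + t₁ * z) * starRingEnd ℂ (s₃ + t₃ * z : ℂ)).im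
        = z.im * (s₁ * s₃ + 2 * z.re * (t₁ * s₃) + t₁ * t₃ * (z.re ^ 2 + z.im ^ 2)) := by
      simp [Complex.mul_im, Complex.mul_re]
      ring
    rw [this]
    refine mul_nonneg hz.le ?_
    by_cases h0 : s₁ * s₃ = 0
    · have h1 : t₁ * s₃ = 0 := by
        rcases mul_eq_zero.1 h0 with h | h
        · rw [h] at q₃; nlinarith [mul_nonneg ht₁ hs₃]
        · rw [h, mul_zero]
      rw [h0, h1]
      have := mul_nonneg (mul_nonneg ht₁ ht₃) (add_nonneg (sq_nonneg z.re) (sq_nonneg z.im))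
      linarith
    · have hpos : 0 < s₁ * s₃ := lt_of_le_of_ne (mul_nonneg hs₁ hs₃) (Ne.symm h0)
      -- Completing the square in s₁s₃ + Re(z) t₁s₃ leaves nonnegative terms, since t₁s₃ ≤ s₁t₃.
      have h4 : 0 ≤ s₁ * s₃ * (s₁ * s₃ + 2 * z.re * (t₁ * s₃) + t₁ * t₃ * (z.re ^ 2 + z.im ^ 2)) := by
        have h5 : (t₁ * s₃) * (t₁ * s₃) ≤ (t₁ * s₃) * (s₁ * t₃) :=
          mul_le_mul_of_nonneg_left (by linarith) (mul_nonneg ht₁ hs₃)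
        nlinarith [sq_nonneg (s₁ * s₃ + z.re * (t₁ * s₃)), mul_nonneg (sq_nonneg z.re) (sub_nonneg.2 h5),
          mul_nonneg (sq_nonneg z.im) (mul_nonneg (mul_nonneg hs₁ hs₃) (mul_nonneg ht₁ ht₃))]
      exact nonneg_of_mul_nonneg_right h4 hpos

end Prec

/-! ### Polynomials with nonpositive zeros -/

/-- Nonzero polynomials with only real nonpositive zeros and positive leading coefficient. -/
def NonposRooted (f : ℝ[X]) : Prop :=
  HasOnlyNonposRealRoots f ∧ ∀ x : ℝ, 0 < x → 0 < f.eval x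

/-- Nonnegativity on the positive half line. -/
def NonnegOnPos (f : ℝ[X]) : Prop := ∀ x : ℝ, 0 < x → 0 ≤ f.eval x

theorem NonposRooted.ne_zero {f : ℝ[X]} (hf : NonposRooted f) : f ≠ 0 := by
  rintro rfl
  simpa using hf.2 1 one_pos

theorem NonposRooted.nonnegOnPos {f : ℝ[X]} (hf : NonposRooted f) : NonnegOnPos f :=
  fun x hx => (hf.2 x hx).le

theorem aeval_ofReal_complex (f : ℝ[X]) (x : ℝ) :
    aeval (x : ℂ) f = ((f.eval x : ℝ) : ℂ) := by
  simpa using (aeval_algebraMap_apply ℂ x f)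

theorem NonposRooted.aeval_ne_zero {f : ℝ[X]} (hf : NonposRooted f) {z : ℂ} (hz : 0 < z.im) :
    aeval z f ≠ 0 := by
  intro h
  obtain ⟨x, -, rfl⟩ := hf.1 z h
  simp at hz

theorem NonposRooted.root_nonpos {f : ℝ[X]} (hf : NonposRooted f) {x : ℝ} (hx : f.eval x = 0) :
    x ≤ 0 := by
  by_contra! h
  exact (hf.2 x h).ne' hx

theorem HasOnlyNonposRealRoots.splits {f : ℝ[X]} (hf : HasOnlyNonposRealRoots f) : f.Splits := by
  induction hn : f.natDegree generalizing f with
  | zero => exact Splits.of_natDegree_eq_zero hn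
  | succ n ih =>
    have hd : (f.map (algebraMap ℝ ℂ)).degree ≠ 0 := by
      rw [degree_map]
      exact degree_ne_of_natDegree_ne (n := 0) (by omega)
    obtain ⟨z, hz⟩ := IsAlgClosed.exists_root _ hd
    have hz' : aeval z f = 0 := by rwa [IsRoot, eval_map_algebraMap] at hz
    obtain ⟨x, hx, rfl⟩ := hf z hz'
    have hx0 : f.IsRoot x := by
      rw [aeval_ofReal_complex] at hz'; exact_mod_cast hz'
    obtain ⟨q, rfl⟩ := dvd_iff_isRoot.2 hx0
    have hq : q ≠ 0 := by rintro rfl; simp at hn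
    refine (Splits.X_sub_C x).mul (ih (fun z hz => hf z (by simp [hz])) ?_)
    rw [natDegree_mul (X_sub_C_ne_zero x) hq, natDegree_X_sub_C] at hn
    omega

theorem NonposRooted.of_linear_mul {θ : ℝ} {q : ℝ[X]} (h : NonposRooted ((X - C θ) * q)) :
    NonposRooted q := by
  have hθ : θ ≤ 0 := h.root_nonpos (x := θ) (by simp)
  refine ⟨fun z hz => h.1 z (by simp [hz]), fun x hx => ?_⟩
  have := h.2 x hx
  simp only [eval_mul, eval_sub, eval_X, eval_C] at this
  exact pos_of_mul_pos_right this (by linarith)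

theorem NonposRooted.X_mul {f : ℝ[X]} (h : NonposRooted f) : NonposRooted (X * f) := by
  refine ⟨fun z hz => ?_, fun x hx => by simpa using mul_pos hx (h.2 x hx)⟩
  rw [map_mul, aeval_X, mul_eq_zero] at hz
  rcases hz with rfl | hz
  · exact ⟨0, le_rfl, by simp⟩
  · exact h.1 z hz

open Filter Topology in
theorem nonneg_eval_zero {f : ℝ[X]} (hf : NonnegOnPos f) : 0 ≤ f.eval 0 := by
  have h : Tendsto (fun x => f.eval x) (𝓝[>] 0) (𝓝 (f.eval 0)) :=
    (f.continuous.tendsto 0).mono_left nhdsWithin_le_nhds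
  exact ge_of_tendsto h (eventually_nhdsWithin_of_forall fun x hx => hf x hx)

/-! ### Reversal -/

/-- `g` is `x ^ n * f (1 / x)`. -/
def IsRev (n : ℕ) (f g : ℝ[X]) : Prop := ∀ z : ℂ, z ≠ 0 → aeval z g = z ^ n * aeval z⁻¹ f

namespace IsRev

variable {n : ℕ} {f f' g g' : ℝ[X]}

theorem add (h₁ : IsRev n f f') (h₂ : IsRev n g g') : IsRev n (f + g) (f' + g') := fun z hz => by
  simp [h₁ z hz, h₂ z hz, mul_add]

theorem C_mul (c : ℝ) (h₁ : IsRev n f f') : IsRev n (C c * f) (C c * f') := fun z hz => by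
  simp [h₁ z hz, mul_left_comm]

theorem sum {ι : Type*} {s : Finset ι} {F F' : ι → ℝ[X]} (h : ∀ i ∈ s, IsRev n (F i) (F' i)) :
    IsRev n (∑ i ∈ s, F i) (∑ i ∈ s, F' i) := fun z hz => by
  simp only [map_sum, Finset.mul_sum]
  exact Finset.sum_congr rfl fun i hi => h i hi z hz

theorem X_mul_right (h : IsRev n f f') : IsRev (n + 1) f (X * f') := fun z hz => by
  simp [h z hz, pow_succ]; ring

theorem X_pow_mul_right (k : ℕ) (h : IsRev n f f') : IsRev (n + k) f (X ^ k * f') := fun z hz => by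
  simp [h z hz, pow_add]; ring

theorem reverse (f : ℝ[X]) : IsRev f.natDegree f f.reverse := fun z hz => by
  have hz' : z⁻¹ ≠ 0 := inv_ne_zero hz
  let _ : Invertible z⁻¹ := invertibleOfNonzero hz'
  have := eval₂_reverse_mul_pow (algebraMap ℝ ℂ) z⁻¹ f
  rw [invOf_eq_inv, inv_inv] at this
  rw [aeval_def, aeval_def, ← this, mul_left_comm, ← mul_pow, mul_inv_cancel₀ hz, one_pow, mul_one]

theorem eval_real (h : IsRev n f g) {x : ℝ} (hx : x ≠ 0) : g.eval x = x ^ n * f.eval x⁻¹ := by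
  have := h x (by exact_mod_cast hx)
  rw [← Complex.ofReal_inv, aeval_ofReal_complex, aeval_ofReal_complex] at this
  exact_mod_cast this

theorem eval_one (h : IsRev n f g) : g.eval 1 = f.eval 1 := by
  simpa using h.eval_real one_ne_zero

theorem nonnegOnPos (h : IsRev n f g) (hf : NonnegOnPos f) : NonnegOnPos g := fun x hx => by
  rw [h.eval_real hx.ne']
  exact mul_nonneg (pow_nonneg hx.le _) (hf _ (inv_pos.2 hx))

theorem symm (h : IsRev n f g) : IsRev n g f := fun z hz => by
  rw [h z⁻¹ (inv_ne_zero hz), inv_inv, ← mul_assoc, ← mul_pow, mul_inv_cancel₀ hz, one_pow, one_mul]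

theorem eq_zero (h : IsRev n 0 g) : g = 0 := by
  have : g * X = 0 := by
    apply Polynomial.funext
    intro x
    by_cases hx : x = 0
    · simp [hx]
    · rw [eval_mul, h.eval_real hx]; simp
  simpa using this

/-- The point w = 1 / conj z is again in the upper half plane, on the same ray as z, and the
reversal at z is zⁿ times the conjugate of the value at w. Conjugation reverses the angular order.
-/
theorem prec (h₁ : IsRev n f f') (h₂ : IsRev n g g') (h : Prec f g) : Prec g' f' := by
  intro z hz
  have hz0 : z ≠ 0 := by rintro rfl; simp at hz
  set w := (starRingEnd ℂ z)⁻¹ with hw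
  have hn : 0 < Complex.normSq z := Complex.normSq_pos.2 hz0
  have hw' : starRingEnd ℂ w = z⁻¹ := by rw [hw, map_inv₀, Complex.conj_conj]
  have hwim : 0 < w.im := by
    rw [hw, Complex.inv_im, Complex.normSq_conj, Complex.conj_im, neg_neg]
    exact div_pos hz hn
  have conj_aeval : ∀ p : ℝ[X], aeval z⁻¹ p = starRingEnd ℂ (aeval w p) := by
    intro p
    rw [← hw']
    exact aeval_conj p w
  have a := h w hwim
  rw [h₁ z hz0, h₂ z hz0, conj_aeval, conj_aeval]
  simp only [map_mul, map_pow, Complex.conj_conj]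
  have hzz : z ^ n * starRingEnd ℂ z ^ n = ((Complex.normSq z ^ n : ℝ) : ℂ) := by
    rw [← mul_pow, Complex.mul_conj]; simp
  have hzw : z = (Complex.normSq z : ℂ) * w := by
    rw [hw, ← Complex.mul_conj, mul_assoc, mul_inv_cancel₀, mul_one]
    simpa using hz0
  constructor
  · rw [show z ^ n * starRingEnd ℂ (aeval w f) * (starRingEnd ℂ z ^ n * aeval w g)
      = (z ^ n * starRingEnd ℂ z ^ n) * (aeval w g * starRingEnd ℂ (aeval w f)) by ring, hzz,
      Complex.im_ofReal_mul]
    exact mul_nonneg (by positivity) a.1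
  · rw [show z * (z ^ n * starRingEnd ℂ (aeval w g)) * (starRingEnd ℂ z ^ n * aeval w f)
      = (z ^ n * starRingEnd ℂ z ^ n) * (z * aeval w f * starRingEnd ℂ (aeval w g)) by ring, hzz,
      Complex.im_ofReal_mul]
    refine mul_nonneg (by positivity) ?_
    conv_rhs => rw [hzw, mul_assoc, mul_assoc, Complex.im_ofReal_mul, ← mul_assoc]
    exact mul_nonneg hn.le a.2

end IsRev

theorem NonnegOnPos.leadingCoeff_nonneg {f : ℝ[X]} (hf : NonnegOnPos f) : 0 ≤ f.leadingCoeff := by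
  have := nonneg_eval_zero ((IsRev.reverse f).nonnegOnPos hf)
  rwa [← coeff_zero_eq_eval_zero, coeff_zero_reverse] at this

/-! ### Local analysis at a real point -/

open Filter Topology in
-- Approach θ along the ray of angle τ and divide by the m-th power of the distance: the limit is
-- Im(e^{imτ} c). The direction mτ = π/2 will give c ≥ 0; the direction mτ = 3π/2, which lies in the
-- half plane only for m ≥ 2, will give c ≤ 0.
theorem sin_mul_nonneg_of_im_nonneg {θ c : ℝ} {m : ℕ} {A : ℂ → ℂ} (hA : Continuous A)
    (hc : A θ = c) (h : ∀ z : ℂ, 0 < z.im → 0 ≤ ((z - θ) ^ m * A z).im) {τ : ℝ} (h0 : 0 < τ)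
    (hπ : τ < Real.pi) : 0 ≤ Real.sin (m * τ) * c := by
  set e : ℂ := Complex.exp (τ * Complex.I) with he
  have heim : 0 < e.im := by
    rw [he, Complex.exp_ofReal_mul_I_im]; exact Real.sin_pos_of_pos_of_lt_pi h0 hπ
  have hlim : Tendsto (fun ε : ℝ => (e ^ m * A (θ + ε * e)).im) (𝓝[>] 0)
      (𝓝 (e ^ m * A (θ + (0 : ℝ) * e)).im) := by
    refine Tendsto.mono_left (Continuous.tendsto ?_ 0) nhdsWithin_le_nhds
    exact Complex.continuous_im.comp (continuous_const.mul (hA.comp (by fun_prop)))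
  have hval : (e ^ m * A (θ + (0 : ℝ) * e)).im = Real.sin (m * τ) * c := by
    rw [Complex.ofReal_zero, zero_mul, add_zero, hc, Complex.im_mul_ofReal, he, ← Complex.exp_nat_mul]
    rw [show (m : ℂ) * (τ * Complex.I) = ((m * τ : ℝ) : ℂ) * Complex.I by push_cast; ring,
      Complex.exp_ofReal_mul_I_im]
  rw [← hval]
  refine ge_of_tendsto hlim (eventually_nhdsWithin_of_forall fun ε hε => ?_)
  have hε' : (0 : ℝ) < ε := hε
  have := h (θ + ε * e) (by simpa using mul_pos hε' heim)
  rw [add_sub_cancel_left, mul_pow, mul_assoc, ← Complex.ofReal_pow, Complex.im_ofReal_mul] at this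
  exact nonneg_of_mul_nonneg_right this (pow_pos hε' m)

theorem nonneg_of_im_nonneg {θ c : ℝ} {m : ℕ} (hm : 1 ≤ m) {A : ℂ → ℂ} (hA : Continuous A)
    (hc : A θ = c) (h : ∀ z : ℂ, 0 < z.im → 0 ≤ ((z - θ) ^ m * A z).im) : 0 ≤ c := by
  have hm' : (1 : ℝ) ≤ m := by exact_mod_cast hm
  have := sin_mul_nonneg_of_im_nonneg hA hc h (τ := Real.pi / (2 * m)) (by positivity)
    (by rw [div_lt_iff₀ (by positivity)]; nlinarith [Real.pi_pos])
  rwa [show (m : ℝ) * (Real.pi / (2 * m)) = Real.pi / 2 by field_simp, Real.sin_pi_div_two,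
    one_mul] at this

theorem nonpos_of_im_nonneg {θ c : ℝ} {m : ℕ} (hm : 2 ≤ m) {A : ℂ → ℂ} (hA : Continuous A)
    (hc : A θ = c) (h : ∀ z : ℂ, 0 < z.im → 0 ≤ ((z - θ) ^ m * A z).im) : c ≤ 0 := by
  have hm' : (2 : ℝ) ≤ m := by exact_mod_cast hm
  have := sin_mul_nonneg_of_im_nonneg hA hc h (τ := 3 * Real.pi / (2 * m)) (by positivity)
    (by rw [div_lt_iff₀ (by positivity)]; nlinarith [Real.pi_pos])
  rw [show (m : ℝ) * (3 * Real.pi / (2 * m)) = Real.pi / 2 + Real.pi by field_simp; ring,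
    Real.sin_add_pi, Real.sin_pi_div_two] at this
  linarith

theorem continuous_aeval_mul_conj (p q : ℝ[X]) :
    Continuous fun z : ℂ => aeval z p * starRingEnd ℂ (aeval z q) :=
  (p.continuous_aeval).mul (Complex.continuous_conj.comp q.continuous_aeval)

/-- If f had the larger degree, reversing both in degree deg f would make the reversal of g vanish
at 0. The local analysis there would then give the product of the two positive leading coefficients
the wrong sign. -/
theorem Prec.natDegree_le {f g : ℝ[X]} (h : Prec f g) (hf : NonnegOnPos f) (hg : NonnegOnPos g)
    (hg0 : g ≠ 0) : f.natDegree ≤ g.natDegree := by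
  by_contra! hlt
  have hf0 : f ≠ 0 := by rintro rfl; simp at hlt
  obtain ⟨k, hk⟩ := Nat.exists_eq_add_of_lt hlt
  have hrg := (IsRev.reverse g).X_pow_mul_right (k + 1)
  rw [show g.natDegree + (k + 1) = f.natDegree by omega] at hrg
  have hp := (IsRev.reverse f).prec hrg h
  have hc : 0 ≤ -(f.leadingCoeff * g.leadingCoeff) := by
    refine nonneg_of_im_nonneg (θ := 0) (m := k + 1) (by omega)
      (A := fun z => -(aeval z g.reverse * starRingEnd ℂ (aeval z f.reverse)))
      (continuous_aeval_mul_conj _ _).neg ?_ ?_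
    · simp only [Complex.ofReal_zero]
      rw [← Complex.ofReal_zero, aeval_ofReal_complex, aeval_ofReal_complex,
        ← coeff_zero_eq_eval_zero, ← coeff_zero_eq_eval_zero, coeff_zero_reverse,
        coeff_zero_reverse, Complex.conj_ofReal]
      push_cast; ring
    · intro z hz
      have := (hp z hz).1
      rw [← neg_neg (Complex.im _), ← Complex.conj_im] at this
      simpa [mul_assoc, mul_comm, mul_left_comm] using this
  have := mul_pos (lt_of_le_of_ne hf.leadingCoeff_nonneg (leadingCoeff_ne_zero.2 hf0).symm)
    (lt_of_le_of_ne hg.leadingCoeff_nonneg (leadingCoeff_ne_zero.2 hg0).symm)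
  linarith

/-! ### Partial fractions -/

/-- The cone generated by `g` and the quotients `g / (x - θ)`. -/
inductive PoleCone (g : ℝ[X]) : ℝ[X] → Prop
  | base (a : ℝ) (ha : 0 ≤ a) : PoleCone g (C a * g)
  | pole (c θ : ℝ) (q : ℝ[X]) (hc : 0 ≤ c) (hq : g = (X - C θ) * q) : PoleCone g (C c * q)
  | add {f₁ f₂ : ℝ[X]} (h₁ : PoleCone g f₁) (h₂ : PoleCone g f₂) : PoleCone g (f₁ + f₂)

namespace PoleCone

variable {f g : ℝ[X]}

theorem zero (g : ℝ[X]) : PoleCone g 0 := by simpa using base (g := g) 0 le_rfl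

theorem sum {ι : Type*} {s : Finset ι} {F : ι → ℝ[X]} (h : ∀ i ∈ s, PoleCone g (F i)) :
    PoleCone g (∑ i ∈ s, F i) :=
  Finset.sum_induction F (PoleCone g) (fun _ _ => add) (zero g) h

theorem linear_mul (θ : ℝ) (h : PoleCone g f) : PoleCone ((X - C θ) * g) ((X - C θ) * f) := by
  induction h with
  | base a ha => rw [mul_left_comm]; exact base a ha
  | pole c η q hc hq => rw [mul_left_comm]; exact pole c η _ hc (by rw [hq]; ring)
  | add _ _ h₁ h₂ => rw [mul_add]; exact add h₁ h₂

/-- For real θ the function 1/(z - θ) maps the upper half plane into the open lower one, so a single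
genuine pole makes Im(f/g) strictly negative. Hence elements of the cone have no nonreal zeros. -/
theorem eq_C_mul_or_im_neg (hg : NonposRooted g) (h : PoleCone g f) :
    (∃ a, f = C a * g) ∨
      ∀ z : ℂ, 0 < z.im → (aeval z f * starRingEnd ℂ (aeval z g)).im < 0 := by
  induction h with
  | base a ha => exact Or.inl ⟨a, rfl⟩
  | pole c θ q hc hq =>
    rcases hc.eq_or_lt with rfl | hc
    · exact Or.inl ⟨0, by simp⟩
    · refine Or.inr fun z hz => ?_
      have hq0 : aeval z q ≠ 0 := by
        intro h0
        exact hg.aeval_ne_zero hz (by rw [hq, map_mul, h0, mul_zero])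
      rw [hq]
      simp only [map_mul, map_sub, aeval_X, aeval_C, Complex.coe_algebraMap, Complex.conj_ofReal]
      rw [show (c : ℂ) * aeval z q * ((starRingEnd ℂ z - θ) * starRingEnd ℂ (aeval z q))
        = (c : ℂ) * ((aeval z q * starRingEnd ℂ (aeval z q)) * (starRingEnd ℂ z - θ)) by ring,
        Complex.mul_conj, Complex.im_ofReal_mul, Complex.im_ofReal_mul]
      simp only [Complex.sub_im, Complex.conj_im, Complex.ofReal_im, sub_zero, mul_neg,
        Left.neg_neg_iff]
      exact mul_pos hc (mul_pos (Complex.normSq_pos.2 hq0) hz)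
  | @add f₁ f₂ _ _ h₁ h₂ =>
    have im0 : ∀ (a : ℝ) (z : ℂ), (aeval z (C a * g) * starRingEnd ℂ (aeval z g)).im = 0 := by
      intro a z
      rw [map_mul, mul_assoc, Complex.mul_conj]; simp
    rcases h₁ with ⟨a, rfl⟩ | h₁ <;> rcases h₂ with ⟨b, rfl⟩ | h₂
    · exact Or.inl ⟨a + b, by rw [C_add, add_mul]⟩
    · refine Or.inr fun z hz => ?_
      rw [map_add, add_mul, Complex.add_im, im0, zero_add]; exact h₂ z hz
    · refine Or.inr fun z hz => ?_
      rw [map_add, add_mul, Complex.add_im, im0, add_zero]; exact h₁ z hz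
    · refine Or.inr fun z hz => ?_
      rw [map_add, add_mul, Complex.add_im]; exact add_neg (h₁ z hz) (h₂ z hz)

theorem eq_zero_or_pos (hg : NonposRooted g) (h : PoleCone g f) :
    f = 0 ∨ ∀ x : ℝ, 0 < x → 0 < f.eval x := by
  induction h with
  | base a ha =>
    rcases ha.eq_or_lt with rfl | ha
    · simp
    · exact Or.inr fun x hx => by simpa using mul_pos ha (hg.2 x hx)
  | pole c θ q hc hq =>
    rcases hc.eq_or_lt with rfl | hc
    · simp
    · subst hq
      exact Or.inr fun x hx => by simpa using mul_pos hc (hg.of_linear_mul.2 x hx)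
  | @add f₁ f₂ _ _ h₁ h₂ =>
    rcases h₁ with rfl | h₁ <;> rcases h₂ with rfl | h₂
    · simp
    · exact Or.inr (by simpa using h₂)
    · exact Or.inr (by simpa using h₁)
    · exact Or.inr fun x hx => by simpa using add_pos (h₁ x hx) (h₂ x hx)

theorem nonposRooted (hg : NonposRooted g) (h : PoleCone g f) (hf : f ≠ 0) : NonposRooted f := by
  have hpos := (h.eq_zero_or_pos hg).resolve_left hf
  refine ⟨?_, hpos⟩
  rcases h.eq_C_mul_or_im_neg hg with ⟨a, rfl⟩ | hneg
  · have ha : a ≠ 0 := by rintro rfl; simp at hf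
    intro z hz
    exact hg.1 z (by simpa [ha] using hz)
  · intro z hz
    rcases lt_trichotomy z.im 0 with him | him | him
    · have := hneg (starRingEnd ℂ z) (by simpa using him)
      rw [aeval_conj, hz] at this
      simp at this
    · have hzr : z = (z.re : ℂ) := Complex.ext (by simp) (by simp [him])
      refine ⟨z.re, ?_, hzr⟩
      by_contra! hlt
      rw [hzr, aeval_ofReal_complex] at hz
      exact (hpos _ hlt).ne' (by exact_mod_cast hz)
    · have := hneg z him
      rw [hz] at this
      simp at this

end PoleCone

/-- At a zero θ of g = (x - θ)^m q, the sign of Im(g conj f) near θ forces q(θ) f(θ) ≥ 0, and m = 1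
because m ≥ 2 would also give the opposite sign. So g has simple zeros, the residues of f/g are
nonnegative, and the partial fraction expansion of f/g is the required combination. -/
theorem Prec.poleCone_of_no_common_root {f g : ℝ[X]} (h : Prec f g) (hg : NonposRooted g)
    (hf : NonnegOnPos f) (hcop : ∀ θ, g.eval θ = 0 → f.eval θ ≠ 0) : PoleCone g f := by
  have hg0 := hg.ne_zero
  have local_data : ∀ θ, g.eval θ = 0 → g.rootMultiplicity θ = 1 ∧
      ∃ q : ℝ[X], g = (X - C θ) * q ∧ q.eval θ ≠ 0 ∧ 0 ≤ f.eval θ / q.eval θ := by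
    intro θ hθ
    obtain ⟨q, hq, hndvd⟩ := exists_eq_pow_rootMultiplicity_mul_and_not_dvd g hg0 θ
    have hqθ : q.eval θ ≠ 0 := fun h0 => hndvd (dvd_iff_isRoot.2 h0)
    set m := g.rootMultiplicity θ with hm
    have hm1 : 1 ≤ m := (rootMultiplicity_pos hg0).2 hθ
    have hA := continuous_aeval_mul_conj q f
    have hc : aeval (θ : ℂ) q * starRingEnd ℂ (aeval (θ : ℂ) f)
        = ((q.eval θ * f.eval θ : ℝ) : ℂ) := by
      rw [aeval_ofReal_complex, aeval_ofReal_complex, Complex.conj_ofReal]; push_cast; rfl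
    have him : ∀ z : ℂ, 0 < z.im →
        0 ≤ ((z - θ) ^ m * (aeval z q * starRingEnd ℂ (aeval z f))).im := by
      intro z hz
      have := (h z hz).1
      rw [hq] at this
      simpa [mul_assoc] using this
    have hnn : 0 ≤ q.eval θ * f.eval θ := nonneg_of_im_nonneg hm1 hA hc him
    have hm2 : m = 1 := by
      by_contra hne
      have := nonpos_of_im_nonneg (m := m) (by omega) hA hc him
      exact mul_ne_zero hqθ (hcop θ hθ) (le_antisymm this hnn)
    refine ⟨hm2, q, by rw [hm2, pow_one] at hq; exact hq, hqθ, ?_⟩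
    rw [div_nonneg_iff]
    rcases mul_nonneg_iff.1 hnn with h | h
    · exact Or.inl ⟨h.2, h.1⟩
    · exact Or.inr ⟨h.2, h.1⟩
  classical
  set s := g.roots.toFinset with hs
  have hmem : ∀ θ, θ ∈ s ↔ g.eval θ = 0 := fun θ => by simp [hs, hg0]
  choose! q hq using fun θ hθ => (local_data θ hθ).2
  have hcard : s.card = g.natDegree := by
    rw [hs, Multiset.toFinset_card_of_nodup, ← (HasOnlyNonposRealRoots.splits hg.1).natDegree_eq_card_roots]
    refine Multiset.nodup_iff_count_le_one.2 fun θ => ?_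
    rw [count_roots]
    by_cases hθ : g.eval θ = 0
    · exact (local_data θ hθ).1.le
    · rw [rootMultiplicity_eq_zero hθ]; exact zero_le_one
  -- This is the value of f/g at infinity, zero if deg f < deg g; subtracting α g brings the degree
  -- below the number of zeros of g, so interpolation at these zeros applies.
  set α := f.coeff g.natDegree / g.leadingCoeff with hα
  have hdeg := h.natDegree_le hf hg.nonnegOnPos hg0
  have hlc : 0 < g.leadingCoeff := lt_of_le_of_ne hg.nonnegOnPos.leadingCoeff_nonneg
    (leadingCoeff_ne_zero.2 hg0).symm
  have hα0 : 0 ≤ α := by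
    refine div_nonneg ?_ hlc.le
    rcases hdeg.lt_or_eq with hlt | heq
    · rw [coeff_eq_zero_of_natDegree_lt hlt]
    · rw [← heq]; exact hf.leadingCoeff_nonneg
  have key : f - C α * g = ∑ θ ∈ s, C (f.eval θ / (q θ).eval θ) * q θ := by
    refine eq_of_degrees_lt_of_eval_finset_eq s ?_ ?_ ?_
    · rw [hcard, degree_lt_iff_coeff_zero]
      intro k hk
      rcases hk.lt_or_eq with hlt | rfl
      · rw [coeff_sub, coeff_C_mul, coeff_eq_zero_of_natDegree_lt (hdeg.trans_lt hlt),
          coeff_eq_zero_of_natDegree_lt hlt]; simp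
      · rw [coeff_sub, coeff_C_mul, coeff_natDegree, hα, div_mul_cancel₀ _ hlc.ne', sub_self]
    · refine (degree_sum_le _ _).trans_lt ((Finset.sup_lt_iff ?_).2 fun θ hθ => ?_)
      · rw [bot_lt_iff_ne_bot]; simp
      · have hθ' := (hmem θ).1 hθ
        rw [← smul_eq_C_mul]
        refine (degree_smul_le _ _).trans_lt ?_
        have hq0 : q θ ≠ 0 := by rintro h0; exact (hq θ hθ').2.1 (by rw [h0, eval_zero])
        have : g.natDegree = 1 + (q θ).natDegree := by
          conv_lhs => rw [(hq θ hθ').1]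
          rw [natDegree_mul (X_sub_C_ne_zero θ) hq0, natDegree_X_sub_C]
        rw [hcard, degree_eq_natDegree hq0]
        exact_mod_cast (by omega)
    · intro θ hθ
      have hθ' := (hmem θ).1 hθ
      rw [eval_finsetSum, Finset.sum_eq_single_of_mem θ hθ]
      · simp [hθ', div_mul_cancel₀ _ (hq θ hθ').2.1]
      · intro η hη hne
        have := (hq η ((hmem η).1 hη)).1
        have h2 := congrArg (eval θ) this
        rw [hθ', eval_mul, eval_sub, eval_X, eval_C, eq_comm, mul_eq_zero] at h2
        rw [eval_mul, h2.resolve_left (sub_ne_zero.2 hne.symm), mul_zero]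
  rw [← sub_add_cancel f (C α * g), key]
  refine PoleCone.add (PoleCone.sum fun θ hθ => ?_) (PoleCone.base α hα0)
  have hθ' := (hmem θ).1 hθ
  exact PoleCone.pole _ θ _ (hq θ hθ').2.2 (hq θ hθ').1

/-- Common linear factors cancel from the relation and multiply back into the cone, so induction on
the degree reduces to the case of no common zero. -/
theorem Prec.poleCone {f g : ℝ[X]} (h : Prec f g) (hg : NonposRooted g)
    (hf : NonnegOnPos f) : PoleCone g f := by
  induction hn : g.natDegree generalizing f g with
  | zero =>
    refine h.poleCone_of_no_common_root hg hf fun θ hθ => ?_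
    exact absurd (rootMultiplicity_pos hg.ne_zero |>.2 hθ) (by
      rw [eq_C_of_natDegree_eq_zero hn]; simp)
  | succ n ih =>
    by_cases hcop : ∀ θ, g.eval θ = 0 → f.eval θ ≠ 0
    · exact h.poleCone_of_no_common_root hg hf hcop
    · push Not at hcop
      obtain ⟨θ, hgθ, hfθ⟩ := hcop
      have hθ := hg.root_nonpos hgθ
      obtain ⟨g, rfl⟩ := dvd_iff_isRoot.2 hgθ
      obtain ⟨f, rfl⟩ := dvd_iff_isRoot.2 hfθ
      have hg1 := hg.of_linear_mul
      refine (ih h.of_linear_mul hg1 (fun x hx => ?_) ?_).linear_mul θ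
      · have := hf x hx
        simp only [eval_mul, eval_sub, eval_X, eval_C] at this
        exact nonneg_of_mul_nonneg_right this (by linarith)
      · rw [natDegree_mul (X_sub_C_ne_zero θ) hg1.ne_zero, natDegree_X_sub_C] at hn
        omega

theorem Prec.nonposRooted_left {f g : ℝ[X]} (h : Prec f g) (hg : NonposRooted g)
    (hf : NonnegOnPos f) (hf0 : f ≠ 0) : NonposRooted f :=
  (h.poleCone hg hf).nonposRooted hg hf0

theorem Prec.nonposRooted_right {f g : ℝ[X]} (h : Prec f g) (hf : NonposRooted f)
    (hg : NonnegOnPos g) (hg0 : g ≠ 0) : NonposRooted g :=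
  h.X_mul.nonposRooted_left hf.X_mul hg hg0

/-! ### Division by `x - 1` -/

open Filter Topology in
/-- Polynomials dominating `G` that are negligible against `G` at `0`. -/
def SmallOver (G R : ℝ[X]) : Prop :=
  Prec G R ∧ Tendsto (fun x => R.eval x / G.eval x) (𝓝[>] 0) (𝓝 0)

namespace SmallOver

variable {G R₁ R₂ : ℝ[X]}

theorem zero (G : ℝ[X]) : SmallOver G 0 := ⟨Prec.zero_right G, by simp⟩

theorem add (h₁ : SmallOver G R₁) (h₂ : SmallOver G R₂) : SmallOver G (R₁ + R₂) :=
  ⟨h₁.1.add_right h₂.1, by simpa [add_div] using h₁.2.add h₂.2⟩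

theorem C_mul {c : ℝ} (hc : 0 ≤ c) (h : SmallOver G R₁) : SmallOver G (C c * R₁) :=
  ⟨h.1.C_mul_right hc, by simpa [mul_div_assoc] using h.2.const_mul c⟩

open Filter Topology in
theorem X_mul (hG : NonposRooted G) : SmallOver G (X * G) := by
  refine ⟨(Prec.refl G).X_mul, ?_⟩
  have : Tendsto (fun x : ℝ => x) (𝓝[>] 0) (𝓝 0) := tendsto_nhdsWithin_of_tendsto_nhds tendsto_id
  refine this.congr' (eventually_nhdsWithin_of_forall fun x hx => ?_)
  simp [mul_div_assoc, div_self (hG.2 x hx).ne']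

open Filter Topology in
theorem X_mul_quotient (hG : NonposRooted G) {θ : ℝ} (hθ : θ < 0) {q : ℝ[X]}
    (hq : G = (X - C θ) * q) : SmallOver G (X * q) := by
  refine ⟨by rw [hq]; exact (Prec.linear_mul hθ.le q).X_mul, ?_⟩
  have h : Tendsto (fun x : ℝ => x / (x - θ)) (𝓝[>] 0) (𝓝 (0 / (0 - θ))) := by
    refine tendsto_nhdsWithin_of_tendsto_nhds ?_
    exact tendsto_id.div (tendsto_id.sub_const θ) (by simpa using hθ.ne)
  rw [zero_div] at h
  refine h.congr' (eventually_nhdsWithin_of_forall fun x hx => ?_)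
  have h1 := hG.2 x hx
  have hx' : (0 : ℝ) < x := hx
  rw [hq] at h1 ⊢
  have h2 : q.eval x ≠ 0 := by rintro h0; simp [h0] at h1
  have h3 : x - θ ≠ 0 := by linarith
  simp only [eval_mul, eval_X, eval_sub, eval_C]
  field_simp

end SmallOver

/-- `N` has, up to multiples of `G`, a quotient by `x - 1` that dominates `G`. -/
def QuotientOver (G N : ℝ[X]) : Prop :=
  ∃ (Q : ℝ[X]) (κ b : ℝ), N = (X - 1) * Q + C κ * G ∧ SmallOver G (Q + C b * G)

namespace QuotientOver

variable {G N₁ N₂ : ℝ[X]}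

theorem add (h₁ : QuotientOver G N₁) (h₂ : QuotientOver G N₂) : QuotientOver G (N₁ + N₂) := by
  obtain ⟨Q₁, κ₁, b₁, rfl, h₁⟩ := h₁
  obtain ⟨Q₂, κ₂, b₂, rfl, h₂⟩ := h₂
  refine ⟨Q₁ + Q₂, κ₁ + κ₂, b₁ + b₂, by simp only [C_add]; ring, ?_⟩
  convert h₁.add h₂ using 1
  simp only [C_add]; ring

theorem C_mul {c : ℝ} (hc : 0 ≤ c) (h : QuotientOver G N₁) : QuotientOver G (C c * N₁) := by
  obtain ⟨Q, κ, b, rfl, h⟩ := h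
  refine ⟨C c * Q, c * κ, c * b, by simp only [C_mul]; ring, ?_⟩
  convert h.C_mul hc using 1
  simp only [Polynomial.C_mul]; ring

theorem base (G : ℝ[X]) (c : ℝ) : QuotientOver G (C c * G) :=
  ⟨0, c, 0, by ring, by simpa using SmallOver.zero G⟩

theorem X_mul (G : ℝ[X]) (c : ℝ) : QuotientOver G (C c * (X * G)) :=
  ⟨C c * G, c, -c, by ring, by
    convert SmallOver.zero G using 1
    simp only [C_neg]; ring⟩

theorem X_mul_X_mul (hG : NonposRooted G) : QuotientOver G (X * (X * G)) :=
  ⟨(X + 1) * G, 1, -1, by simp only [C_1]; ring, by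
    convert SmallOver.X_mul hG using 1
    simp only [C_neg, C_1]; ring⟩

theorem quotient (hG : NonposRooted G) {θ : ℝ} (hθ : θ < 0) {q : ℝ[X]}
    (hq : G = (X - C θ) * q) : QuotientOver G q := by
  have h1 : (1 - θ) ≠ 0 := by linarith
  have e1 : C (1 - θ)⁻¹ * (1 - C θ) = (1 : ℝ[X]) := by
    rw [← C_1, ← C_sub, ← Polynomial.C_mul, inv_mul_cancel₀ h1]
  have e2 : C (-θ)⁻¹ * (-C θ) = (1 : ℝ[X]) := by
    rw [← C_neg, ← Polynomial.C_mul, inv_mul_cancel₀ (by linarith), C_1]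
  -- The identity (x - θ) - (x - 1) = 1 - θ gives the quotient and the multiple of G. The last
  -- constant cancels Q/G at 0, leaving a positive multiple of x q.
  refine ⟨-(C (1 - θ)⁻¹ * q), (1 - θ)⁻¹, (1 - θ)⁻¹ * (-θ)⁻¹, ?_, ?_⟩
  · rw [hq]
    linear_combination (-q) * e1
  · convert (SmallOver.X_mul_quotient hG hθ hq).C_mul
      (c := (1 - θ)⁻¹ * (-θ)⁻¹) (mul_nonneg (inv_nonneg.2 (by linarith)) (inv_nonneg.2 (by linarith)))
      using 1
    simp only [Polynomial.C_mul]
    rw [hq]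
    linear_combination (C (1 - θ)⁻¹ * q) * e2

/-- Evaluation at 1 kills the leftover multiple of G, so F is the quotient Q. As F + bG is
negligible against G at 0 while F ≥ 0, it follows that b ≤ 0, and F is the sum of F + bG and the
nonnegative multiple -bG, both dominating G. -/
theorem prec {F : ℝ[X]} (hG : NonposRooted G) (hF : NonnegOnPos F)
    (h : QuotientOver G ((X - 1) * F)) : Prec G F := by
  obtain ⟨Q, κ, b, hN, hs, hlim⟩ := h
  have hκ : κ = 0 := by
    have := congrArg (eval 1) hN
    simp only [eval_mul, eval_sub, eval_X, eval_one, sub_self, zero_mul, eval_add, eval_C,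
      zero_add] at this
    exact (mul_eq_zero.1 this.symm).resolve_right (hG.2 1 one_pos).ne'
  have hX : (X - 1 : ℝ[X]) ≠ 0 := by simpa using X_sub_C_ne_zero (1 : ℝ)
  have hFQ : F = Q := mul_left_cancel₀ hX (by simpa [hκ] using hN)
  subst hFQ
  have hb : b ≤ 0 := by
    refine ge_of_tendsto hlim (eventually_nhdsWithin_of_forall fun x hx => ?_)
    have h1 := hG.2 x hx
    rw [le_div_iff₀ h1]
    simpa using hF x hx
  have := hs.add_right ((Prec.refl G).C_mul_right (neg_nonneg.2 hb))
  convert this using 1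
  simp only [C_neg]; ring

/-- If `x * G` is `(x - θ) * q` with `θ ≠ 0`, then `q` is a multiple of `x`. -/
theorem exists_quotient_of_X_mul {θ : ℝ} (hθ : θ ≠ 0) {q : ℝ[X]} (hq : X * G = (X - C θ) * q) :
    ∃ p : ℝ[X], q = X * p ∧ G = (X - C θ) * p := by
  have h0 : q.eval 0 = 0 := by
    have := congrArg (eval 0) hq
    simpa [hθ] using this.symm
  obtain ⟨p, rfl⟩ : X ∣ q := by
    rw [← sub_zero X, ← C_0]; exact dvd_iff_isRoot.2 h0
  refine ⟨p, rfl, mul_left_cancel₀ X_ne_zero (hq.trans (by ring))⟩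

/-- Expand h over the poles of xG. In this lemma and the next two, each pole leaves a multiple of G,
possibly a multiple of xG, and a nonnegative multiple of G/(x - θ); this positivity explains the
signs in front of the three terms treated. -/
theorem X_mul_of_prec {h : ℝ[X]} (hG : NonposRooted G) (hp : Prec G h) (hh : NonnegOnPos h) :
    QuotientOver G (X * h) := by
  have hc := hp.X_mul.poleCone hG.X_mul hh
  clear hp hh
  induction hc with
  | base a ha => rw [mul_left_comm]; exact (X_mul_X_mul hG).C_mul ha
  | pole c θ q hc hq =>
    rw [mul_left_comm]
    refine QuotientOver.C_mul hc ?_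
    by_cases hθ : θ = 0
    · subst hθ
      rw [C_0, sub_zero] at hq
      rw [← mul_left_cancel₀ X_ne_zero hq]
      simpa using X_mul G 1
    · obtain ⟨p, rfl, hGp⟩ := exists_quotient_of_X_mul hθ hq
      have hθ' : θ < 0 := lt_of_le_of_ne (hG.root_nonpos (by rw [hGp]; simp)) hθ
      -- With G = (x - θ) p one has x² p = xG + θG + θ² p.
      convert ((X_mul G 1).add (base G θ)).add
        ((quotient hG hθ' hGp).C_mul (sq_nonneg θ)) using 1
      simp only [C_1, C_pow]
      rw [hGp]; ring
  | add _ _ h₁ h₂ => rw [mul_add]; exact h₁.add h₂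

theorem neg_X_mul_of_prec {L : ℝ[X]} (hG : NonposRooted G) (hp : Prec L G) (hL : NonnegOnPos L) :
    QuotientOver G (-(X * L)) := by
  have hc := hp.poleCone hG hL
  clear hp hL
  induction hc with
  | base a ha =>
    convert X_mul G (-a) using 1
    simp only [C_neg]; ring
  | pole c θ q hc hq =>
    have hθ : θ ≤ 0 := hG.root_nonpos (by rw [hq]; simp)
    rcases hθ.eq_or_lt with rfl | hθ
    · convert base G (-c) using 1
      rw [hq]; simp only [C_neg, C_0]; ring
    · convert (base G (-c)).add ((quotient hG hθ hq).C_mul (c := c * -θ)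
        (mul_nonneg hc (by linarith))) using 1
      rw [hq]; simp only [C_neg, Polynomial.C_mul]; ring
  | add _ _ h₁ h₂ => rw [mul_add, neg_add]; exact h₁.add h₂

theorem neg_of_prec {h : ℝ[X]} (hG : NonposRooted G) (hp : Prec G h) (hh : NonnegOnPos h) :
    QuotientOver G (-h) := by
  have hc := hp.X_mul.poleCone hG.X_mul hh
  clear hp hh
  induction hc with
  | base a ha =>
    convert X_mul G (-a) using 1
    simp only [C_neg]; ring
  | pole c θ q hc hq =>
    by_cases hθ : θ = 0
    · subst hθ
      rw [C_0, sub_zero] at hq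
      rw [← mul_left_cancel₀ X_ne_zero hq]
      convert base G (-c) using 1
      simp only [C_neg]; ring
    · obtain ⟨p, rfl, hGp⟩ := exists_quotient_of_X_mul hθ hq
      have hθ' : θ < 0 := lt_of_le_of_ne (hG.root_nonpos (by rw [hGp]; simp)) hθ
      convert (base G (-c)).add ((quotient hG hθ' hGp).C_mul (c := c * -θ)
        (mul_nonneg hc (by linarith))) using 1
      rw [hGp]; simp only [C_neg, Polynomial.C_mul]; ring
  | add _ _ h₁ h₂ => rw [neg_add]; exact h₁.add h₂

end QuotientOver

/-- The interlacing step behind Chow polynomials. -/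
theorem Prec.of_sub_one_mul_eq {L G U V F : ℝ[X]} (hG : NonposRooted G) (hLG : Prec L G)
    (hGU : Prec G U) (hGV : Prec G V) (hL : NonnegOnPos L) (hU : NonnegOnPos U)
    (hV : NonnegOnPos V) (hF : NonnegOnPos F) (h : (X - 1) * F = X * V - X * L - X * G - U) :
    Prec G F := by
  refine QuotientOver.prec hG hF ?_
  rw [h, show X * V - X * L - X * G - U = X * V + -(X * L) + C (-1) * (X * G) + -U by
    simp only [C_neg, C_1]; ring]
  exact (((QuotientOver.X_mul_of_prec hG hGV hV).add
    (QuotientOver.neg_X_mul_of_prec hG hLG hL)).add (QuotientOver.X_mul G _)).add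
    (QuotientOver.neg_of_prec hG hGU hU)

/-! ### Symmetric interlacing families -/

/-- Zero, or with only real nonpositive zeros and positive on the positive half line. -/
def IsGood (f : ℝ[X]) : Prop := f = 0 ∨ NonposRooted f

theorem IsGood.zero : IsGood 0 := Or.inl rfl

theorem IsGood.nonnegOnPos {f : ℝ[X]} (hf : IsGood f) : NonnegOnPos f := by
  rcases hf with rfl | hf
  · intro x _; simp
  · exact hf.nonnegOnPos

theorem NonnegOnPos.add {f g : ℝ[X]} (hf : NonnegOnPos f) (hg : NonnegOnPos g) :
    NonnegOnPos (f + g) := fun x hx => by simpa using add_nonneg (hf x hx) (hg x hx)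

theorem NonnegOnPos.X_mul {f : ℝ[X]} (hf : NonnegOnPos f) : NonnegOnPos (X * f) :=
  fun x hx => by simpa using mul_nonneg hx.le (hf x hx)

theorem IsGood.C_mul {f : ℝ[X]} (hf : IsGood f) {c : ℝ} (hc : 0 ≤ c) : IsGood (C c * f) := by
  rcases hf with rfl | hf
  · exact Or.inl (mul_zero _)
  · rcases hc.eq_or_lt with rfl | hc
    · exact Or.inl (by simp)
    · exact Or.inr ⟨fun z hz => hf.1 z (by simpa [hc.ne'] using hz), fun x hx => by
        simpa using mul_pos hc (hf.2 x hx)⟩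

theorem IsGood.X_mul {f : ℝ[X]} (hf : IsGood f) : IsGood (X * f) := by
  rcases hf with rfl | hf
  · exact Or.inl (mul_zero _)
  · exact Or.inr hf.X_mul

theorem IsGood.of_prec_right {f g : ℝ[X]} (h : Prec f g) (hf : NonposRooted f)
    (hg : NonnegOnPos g) : IsGood g :=
  or_iff_not_imp_left.2 fun h0 => h.nonposRooted_right hf hg h0

theorem IsGood.add {f g : ℝ[X]} (hf : IsGood f) (hg : IsGood g) (h : Prec f g) :
    IsGood (f + g) := by
  rcases hf with rfl | hf
  · rwa [zero_add]
  · exact IsGood.of_prec_right ((Prec.refl f).add_right h) hf (hf.nonnegOnPos.add hg.nonnegOnPos)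

theorem IsGood.sum {s : Finset ℕ} {g : ℕ → ℝ[X]} (hg : ∀ i ∈ s, IsGood (g i))
    (h : ∀ i ∈ s, ∀ j ∈ s, i ≤ j → Prec (g i) (g j)) : IsGood (∑ i ∈ s, g i) := by
  induction s using Finset.induction_on_max with
  | empty => exact IsGood.zero
  | insert a s hmax ih =>
    rw [Finset.sum_insert fun ha => (hmax a ha).false, add_comm]
    refine IsGood.add (ih (fun i hi => hg i (Finset.mem_insert_of_mem hi)) fun i hi j hj =>
      h i (Finset.mem_insert_of_mem hi) j (Finset.mem_insert_of_mem hj))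
      (hg a (Finset.mem_insert_self a s)) (Prec.sum_left fun i hi => ?_)
    exact h i (Finset.mem_insert_of_mem hi) a (Finset.mem_insert_self a s) (hmax i hi).le

/-- The quotient h/f is a nonnegative combination of x and of functions x/(x - θ) with θ ≤ 0, all
weakly increasing on the positive half line. -/
theorem PoleCone.mul_eval_le {f h : ℝ[X]} (hf : NonposRooted f) (hc : PoleCone (X * f) h)
    {x y : ℝ} (hx : 0 < x) (hxy : x ≤ y) : h.eval x * f.eval y ≤ h.eval y * f.eval x := by
  have hy : 0 < y := hx.trans_le hxy
  induction hc with
  | base a ha =>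
    simp only [eval_mul, eval_C, eval_X]
    have : 0 ≤ a * (f.eval x * f.eval y) :=
      mul_nonneg ha (mul_nonneg (hf.2 x hx).le (hf.2 y hy).le)
    nlinarith
  | pole c θ q hc hq =>
    have hθ : θ ≤ 0 := hf.X_mul.root_nonpos (x := θ) (by rw [hq]; simp)
    have ex := congrArg (eval x) hq
    have ey := congrArg (eval y) hq
    simp only [eval_mul, eval_X, eval_sub, eval_C] at ex ey ⊢
    have qx : q.eval x = x * f.eval x / (x - θ) := by
      rw [eq_div_iff (by linarith), ex]; ring
    have qy : q.eval y = y * f.eval y / (y - θ) := by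
      rw [eq_div_iff (by linarith), ey]; ring
    have hmono : x / (x - θ) ≤ y / (y - θ) := by
      rw [div_le_div_iff₀ (by linarith) (by linarith)]; nlinarith
    have hp : 0 ≤ c * (f.eval x * f.eval y) :=
      mul_nonneg hc (mul_nonneg (hf.2 x hx).le (hf.2 y hy).le)
    calc c * q.eval x * f.eval y = (c * (f.eval x * f.eval y)) * (x / (x - θ)) := by rw [qx]; ring
      _ ≤ (c * (f.eval x * f.eval y)) * (y / (y - θ)) := mul_le_mul_of_nonneg_left hmono hp
      _ = c * q.eval y * f.eval x := by rw [qy]; ring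
  | add _ _ h₁ h₂ => simp only [eval_add, add_mul]; exact add_le_add h₁ h₂

/-- If `f ≼ f'` for the reversal `f'` of `f`, then `f' - f` has the sign of `x - 1`. -/
theorem IsRev.sub_one_mul_nonneg {n : ℕ} {f f' : ℝ[X]} (hr : IsRev n f f') (h : Prec f f')
    (hf : IsGood f) {x : ℝ} (hx : 0 < x) : 0 ≤ (x - 1) * (f'.eval x - f.eval x) := by
  rcases hf with rfl | hf
  · rw [hr.eq_zero]; simp
  have hc := h.X_mul.poleCone hf.X_mul (hr.nonnegOnPos hf.nonnegOnPos)
  -- A polynomial and its reversal agree at 1, so the increasing ratio f'/f passes the value 1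
  -- there.
  have h1 := hr.eval_one
  have hp := hf.2 1 one_pos
  rcases le_total x 1 with hle | hle
  · have := hc.mul_eval_le hf hx hle
    rw [h1, mul_comm] at this
    have := le_of_mul_le_mul_left this hp
    nlinarith
  · have := hc.mul_eval_le hf one_pos hle
    rw [h1, mul_comm (eval x f')] at this
    have := le_of_mul_le_mul_left this hp
    nlinarith

theorem IsRev.nonnegOnPos_quotient {n : ℕ} {f f' H : ℝ[X]} (hr : IsRev n f f') (h : Prec f f')
    (hf : IsGood f) (hH : (X - 1) * H = f' - f) : NonnegOnPos H := by
  have hne : ∀ x : ℝ, 0 < x → x ≠ 1 → 0 ≤ H.eval x := by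
    intro x hx hx1
    have h1 := hr.sub_one_mul_nonneg h hf hx
    rw [← eval_sub, ← hH, eval_mul, eval_sub, eval_X, Polynomial.eval_one, ← mul_assoc] at h1
    exact nonneg_of_mul_nonneg_right h1 (mul_self_pos.2 (sub_ne_zero.2 hx1))
  intro x hx
  by_cases hx1 : x = 1
  · subst hx1
    have : NonnegOnPos (H.comp (X + 1)) := fun y hy => by
      simpa using hne (y + 1) (by linarith) (by linarith)
    simpa using nonneg_eval_zero this
  · exact hne x hx hx1

/-- Reversal in degree n changes the sign of f' - f, and reversal in degree 1 changes the sign of x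
- 1. So H is symmetric of degree n - 1, and multiplying by x shifts this to n + 1 without
subtraction. -/
theorem IsRev.quotient {n : ℕ} {f f' H : ℝ[X]} (hr : IsRev n f f')
    (hH : (X - 1) * H = f' - f) : IsRev (n + 1) (X * H) (X * H) := by
  intro z hz
  by_cases h1 : z = 1
  · subst h1; simp
  have e1 := congrArg (aeval z) hH
  have e2 := congrArg (aeval z⁻¹) hH
  simp only [map_mul, map_sub, aeval_X, map_one] at e1 e2 ⊢
  have a := hr z hz
  have b := hr.symm z hz
  have h1' : z - 1 ≠ 0 := sub_ne_zero.2 h1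
  apply mul_left_cancel₀ h1'
  have hzz : z * z⁻¹ = 1 := mul_inv_cancel₀ hz
  calc (z - 1) * (z * aeval z H) = z * (aeval z f' - aeval z f) := by rw [← e1]; ring
    _ = z * (z ^ n * aeval z⁻¹ f - z ^ n * aeval z⁻¹ f') := by rw [a, b]
    _ = -(z * z ^ n) * ((z⁻¹ - 1) * aeval z⁻¹ H) := by rw [e2]; ring
    _ = (z - 1) * (z ^ (n + 1) * (z⁻¹ * aeval z⁻¹ H)) := by
      rw [show z⁻¹ - 1 = -((z - 1) * z⁻¹) by rw [sub_mul, hzz]; ring]; ring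

/-- A family which, together with the family of its reversals in the opposite order, is
interlacing. -/
structure SymInterlacing (n : ℕ) (s : Finset ℕ) (g g' : ℕ → ℝ[X]) : Prop where
  rev : ∀ i ∈ s, IsRev n (g i) (g' i)
  good : ∀ i ∈ s, IsGood (g i)
  prec : ∀ i ∈ s, ∀ j ∈ s, i ≤ j → Prec (g i) (g j)
  cross : ∀ i ∈ s, ∀ j ∈ s, Prec (g i) (g' j)

namespace SymInterlacing

variable {n : ℕ} {s : Finset ℕ} {g g' : ℕ → ℝ[X]}

theorem C_mul (h : SymInterlacing n s g g') {w : ℕ → ℝ} (hw : ∀ i, 0 ≤ w i) :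
    SymInterlacing n s (fun i => C (w i) * g i) (fun i => C (w i) * g' i) where
  rev i hi := (h.rev i hi).C_mul _
  good i hi := (h.good i hi).C_mul (hw i)
  prec i hi j hj hij := ((h.prec i hi j hj hij).C_mul_left (hw i)).C_mul_right (hw j)
  cross i hi j hj := ((h.cross i hi j hj).C_mul_left (hw i)).C_mul_right (hw j)

theorem mono (h : SymInterlacing n s g g') {t : Finset ℕ} (ht : t ⊆ s) :
    SymInterlacing n t g g' where
  rev i hi := h.rev i (ht hi)
  good i hi := h.good i (ht hi)
  prec i hi j hj := h.prec i (ht hi) j (ht hj)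
  cross i hi j hj := h.cross i (ht hi) j (ht hj)

theorem comp (h : SymInterlacing n s g g') {t : Finset ℕ} {d : ℕ → ℕ} (hd : ∀ i ∈ t, d i ∈ s)
    (hmono : ∀ i ∈ t, ∀ j ∈ t, i ≤ j → d i ≤ d j) :
    SymInterlacing n t (fun i => g (d i)) (fun i => g' (d i)) where
  rev i hi := h.rev _ (hd i hi)
  good i hi := h.good _ (hd i hi)
  prec i hi j hj hij := h.prec _ (hd i hi) _ (hd j hj) (hmono i hi j hj hij)
  cross i hi j hj := h.cross _ (hd i hi) _ (hd j hj)

theorem good_sum (h : SymInterlacing n s g g') : IsGood (∑ i ∈ s, g i) :=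
  IsGood.sum h.good h.prec

theorem rev_sum (h : SymInterlacing n s g g') : IsRev n (∑ i ∈ s, g i) (∑ i ∈ s, g' i) :=
  IsRev.sum h.rev

theorem cross_sum (h : SymInterlacing n s g g') : Prec (∑ i ∈ s, g i) (∑ i ∈ s, g' i) :=
  Prec.sum_left fun i hi => Prec.sum_right fun j hj => h.cross i hi j hj

theorem prec_sum_filter (h : SymInterlacing n s g g') {p q : ℕ → Prop} [DecidablePred p]
    [DecidablePred q] (hpq : ∀ i j, p i → q j → i ≤ j) :
    Prec (∑ i ∈ s with p i, g i) (∑ i ∈ s with q i, g i) := by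
  refine Prec.sum_left fun i hi => Prec.sum_right fun j hj => ?_
  rw [Finset.mem_filter] at hi hj
  exact h.prec i hi.1 j hj.1 (hpq i j hi.2 hj.2)

/-- Suffix sums of a symmetric interlacing family. -/
theorem suffix_sums (h : SymInterlacing n s g g') (t : Finset ℕ) :
    SymInterlacing n t (fun d => ∑ i ∈ s with d < i, g i) (fun d => ∑ i ∈ s with d < i, g' i) where
  rev d _ := (h.mono (Finset.filter_subset _ _)).rev_sum
  good d _ := (h.mono (Finset.filter_subset _ _)).good_sum
  prec d _ e _ hde := by
    have : ∑ i ∈ s with d < i, g i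
        = ∑ i ∈ s with (d < i ∧ i ≤ e), g i + ∑ i ∈ s with e < i, g i := by
      rw [← Finset.sum_union]
      · congr 1; ext i; simp only [Finset.mem_filter, Finset.mem_union]; grind
      · rw [Finset.disjoint_filter]; intro i _ hi; omega
    rw [this]
    exact (h.prec_sum_filter fun i j hi hj => by omega).add_left (Prec.refl _)
  cross d _ e _ := Prec.sum_left fun i hi => Prec.sum_right fun j hj =>
    h.cross i (Finset.mem_of_mem_filter i hi) j (Finset.mem_of_mem_filter j hj)

/-! ### The divided difference of a symmetric interlacing family -/

section Quotient

variable {H : ℝ[X]} (h : SymInterlacing n s g g')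
  (hH : (X - 1) * H = ∑ i ∈ s, g' i - ∑ i ∈ s, g i)

include h hH

theorem quotient_nonneg : NonnegOnPos H :=
  h.rev_sum.nonnegOnPos_quotient h.cross_sum h.good_sum hH

theorem quotient_suffix_nonneg (d : ℕ) : NonnegOnPos (X * H + ∑ i ∈ s with d < i, g i) :=
  (h.quotient_nonneg hH).X_mul.add
    (h.mono (Finset.filter_subset _ _)).good_sum.nonnegOnPos

/-- Cut ∑ g into L + G + U, for the indices up to d, between d and e, and above e, and let V = ∑ g'.
Then (x - 1)(xH + U) = xV - xL - xG - U, which is the shape that `Prec.of_sub_one_mul_eq` handles.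
-/
theorem quotient_middle_prec (d e : ℕ) :
    Prec (∑ i ∈ s with (d < i ∧ i ≤ e), g i) (X * H + ∑ i ∈ s with e < i, g i) := by
  rcases (h.mono (Finset.filter_subset (fun i => d < i ∧ i ≤ e) s)).good_sum with h0 | hG
  · rw [h0]; exact Prec.zero_left _
  rcases lt_or_ge e d with hed | hde
  · exfalso
    apply hG.ne_zero
    refine Finset.sum_eq_zero fun i hi => ?_
    rw [Finset.mem_filter] at hi
    omega
  refine Prec.of_sub_one_mul_eq (L := ∑ i ∈ s with i ≤ d, g i)
    (U := ∑ i ∈ s with e < i, g i) (V := ∑ i ∈ s, g' i) hG ?_ ?_ ?_ ?_ ?_ ?_ ?_ ?_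
  · exact h.prec_sum_filter fun i j hi hj => by omega
  · exact h.prec_sum_filter fun i j hi hj => by omega
  · exact Prec.sum_left fun i hi => Prec.sum_right fun j hj =>
      h.cross i (Finset.mem_of_mem_filter i hi) j hj
  · exact (h.mono (Finset.filter_subset _ _)).good_sum.nonnegOnPos
  · exact (h.mono (Finset.filter_subset _ _)).good_sum.nonnegOnPos
  · exact h.rev_sum.nonnegOnPos h.good_sum.nonnegOnPos
  · exact h.quotient_suffix_nonneg hH e
  · have hsum : ∑ i ∈ s, g i = ∑ i ∈ s with i ≤ d, g i + ∑ i ∈ s with (d < i ∧ i ≤ e), g i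
        + ∑ i ∈ s with e < i, g i := by
      rw [← Finset.sum_union, ← Finset.sum_union]
      · congr 1; ext i; simp only [Finset.mem_filter, Finset.mem_union]; grind
      · rw [Finset.disjoint_left]; intro i; simp only [Finset.mem_filter, Finset.mem_union]; grind
      · rw [Finset.disjoint_filter]; intro i _ hi; omega
    rw [hsum] at hH
    linear_combination X * hH

/-- The two sides differ by the middle block between d and e, which precedes the right-hand side. -/
theorem quotient_suffix_prec {d e : ℕ} (hde : d ≤ e) :
    Prec (X * H + ∑ i ∈ s with d < i, g i) (X * H + ∑ i ∈ s with e < i, g i) := by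
  have : ∑ i ∈ s with d < i, g i
      = ∑ i ∈ s with (d < i ∧ i ≤ e), g i + ∑ i ∈ s with e < i, g i := by
    rw [← Finset.sum_union]
    · congr 1; ext i; simp only [Finset.mem_filter, Finset.mem_union]; grind
    · rw [Finset.disjoint_filter]; intro i _ hi; omega
  rw [this, add_left_comm]
  exact (h.quotient_middle_prec hH d e).add_left (Prec.refl _)

theorem quotient_suffix_rev (d : ℕ) : IsRev (n + 1) (X * H + ∑ i ∈ s with d < i, g i)
    (X * H + X * ∑ i ∈ s with d < i, g' i) :=
  (h.rev_sum.quotient hH).add (h.mono (Finset.filter_subset _ _)).rev_sum.X_mul_right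

variable (hpos : ∀ i ∈ s, 1 ≤ i) (hne : ∑ i ∈ s, g i ≠ 0)

include hpos

theorem sum_prec_quotient : Prec (∑ i ∈ s, g i) (X * H) := by
  -- Since all indices are at least 1, the block between 0 and the largest index is the whole family
  -- and the remaining suffix is empty.
  have := h.quotient_middle_prec hH 0 (s.sup id)
  rw [Finset.filter_true_of_mem fun i hi => ⟨hpos i hi, Finset.le_sup (f := id) hi⟩,
    Finset.filter_false_of_mem fun i hi => not_lt.2 (Finset.le_sup (f := id) hi),
    Finset.sum_empty, add_zero] at this
  exact this

theorem augmented_prec_quotient : Prec (X * H + ∑ i ∈ s, g i) (X * H) :=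
  (Prec.refl _).add_left (h.sum_prec_quotient hH hpos)

include hne

theorem augmented_nonposRooted : NonposRooted (X * H + ∑ i ∈ s, g i) := by
  have hf := h.good_sum.resolve_left hne
  have hn := (h.quotient_nonneg hH).X_mul
  refine Prec.nonposRooted_right (f := ∑ i ∈ s, g i)
    ((h.sum_prec_quotient hH hpos).add_right (Prec.refl _)) hf (hn.add hf.nonnegOnPos) fun h0 => ?_
  have h1 := congrArg (eval 1) h0
  rw [eval_add, eval_zero] at h1
  linarith [hn 1 one_pos, hf.2 1 one_pos]

theorem X_mul_quotient_good : IsGood (X * H) :=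
  IsGood.of_prec_right (h.augmented_prec_quotient hH hpos) (h.augmented_nonposRooted hH hpos hne)
    (h.quotient_nonneg hH).X_mul

/-- The suffix sums shifted by the symmetric polynomial `x * H` again form a symmetric
interlacing family. -/
theorem quotient_suffix_sums (t : Finset ℕ) :
    SymInterlacing (n + 1) t (fun d => X * H + ∑ i ∈ s with d < i, g i)
      (fun d => X * H + X * ∑ i ∈ s with d < i, g' i) := by
  have hzero : ∀ F : ℕ → ℝ[X], ∑ i ∈ s with 0 < i, F i = ∑ i ∈ s, F i := fun F => by
    rw [Finset.filter_true_of_mem (p := fun i => 0 < i) fun i hi => hpos i hi]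
  have htop : ∀ F : ℕ → ℝ[X], ∑ i ∈ s with s.sup id < i, F i = 0 := fun F => by
    rw [Finset.filter_false_of_mem fun i hi => not_lt.2 (Finset.le_sup (f := id) hi),
      Finset.sum_empty]
  have ha := h.augmented_nonposRooted hH hpos hne
  have hfirst : ∀ d, Prec (X * H + ∑ i ∈ s, g i) (X * H + ∑ i ∈ s with d < i, g i) := fun d => by
    have := h.quotient_suffix_prec hH (Nat.zero_le d)
    rwa [hzero] at this
  have hgood : ∀ d, IsGood (X * H + ∑ i ∈ s with d < i, g i) := fun d =>
    IsGood.of_prec_right (hfirst d) ha (h.quotient_suffix_nonneg hH d)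
  refine ⟨fun d _ => h.quotient_suffix_rev hH d, fun d _ => hgood d,
    fun d _ e _ hde => h.quotient_suffix_prec hH hde, fun d _ e _ => ?_⟩
  -- The cross relations go through xH as a nonvanishing middle term. If H = 0, the sum of the
  -- nonnegative functions (x - 1)(g'_i - g_i) vanishes on the positive half line, so every g_i is
  -- symmetric and the claim is immediate.
  by_cases hH0 : H = 0
  · subst hH0
    rw [mul_zero] at hH
    have hnn : ∀ i ∈ s, ∀ x : ℝ, 0 < x → 0 ≤ (x - 1) * ((g' i).eval x - (g i).eval x) :=
      fun i hi x hx => (h.rev i hi).sub_one_mul_nonneg (h.cross i hi i hi) (h.good i hi) hx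
    have heq : ∀ i ∈ s, g' i = g i := by
      intro i hi
      have hpt : ∀ x : ℝ, 1 < x → (g' i).eval x = (g i).eval x := by
        intro x hx
        have hx0 : 0 < x := by linarith
        have hs : ∑ i ∈ s, (x - 1) * ((g' i).eval x - (g i).eval x) = 0 := by
          rw [← Finset.mul_sum, Finset.sum_sub_distrib, ← eval_finsetSum, ← eval_finsetSum,
            ← eval_sub, ← hH, eval_zero, mul_zero]
        have := (Finset.sum_eq_zero_iff_of_nonneg fun i hi => hnn i hi x hx0).1 hs i hi
        rcases mul_eq_zero.1 this with h1 | h1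
        · linarith
        · linarith
      exact Polynomial.eq_of_infinite_eval_eq _ _
        ((Set.Ioi_infinite (1 : ℝ)).mono fun x hx => hpt x hx)
    simp only [mul_zero, zero_add]
    refine Prec.sum_left fun i hi => Prec.X_mul (Prec.sum_left fun j hj => ?_)
    rw [Finset.mem_filter] at hi hj
    rw [heq j hj.1, ← heq i hi.1]
    exact h.cross j hj.1 i hi.1
  · have hXH : NonposRooted (X * H) :=
      (h.X_mul_quotient_good hH hpos hne).resolve_left (mul_ne_zero X_ne_zero hH0)
    have hlast : ∀ d, Prec (X * H + ∑ i ∈ s with d < i, g i) (X * H) := fun d => by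
      have h1 := h.quotient_suffix_prec hH (le_max_left d (s.sup id))
      rwa [Finset.filter_false_of_mem (s := s) (p := fun i => max d (s.sup id) < i)
        (fun i hi => not_lt.2 ((Finset.le_sup (f := id) hi).trans (le_max_right _ _))),
        Finset.sum_empty, add_zero] at h1
    -- The reversal of the full sum a = xH + ∑ g is x a. Reversing the relation between a and a
    -- suffix sum therefore again bounds a reversed suffix sum from the left by a, so a can serve as
    -- the reference for transitivity.
    have hrev0 : X * H + X * ∑ i ∈ s, g' i = X * (X * H + ∑ i ∈ s, g i) := by
      linear_combination (-X) * hH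
    have hce : Prec (X * H) (X * H + X * ∑ i ∈ s with e < i, g' i) :=
      (h.quotient_suffix_rev hH e).prec (h.rev_sum.quotient hH) (hlast e)
    have hae : Prec (X * H + ∑ i ∈ s, g i) (X * H + X * ∑ i ∈ s with e < i, g' i) := by
      have h0 := h.quotient_suffix_rev hH 0
      rw [hzero, hzero, hrev0] at h0
      exact (h0.prec (h.quotient_suffix_rev hH e) (hfirst e)).of_prec_X_mul
    exact Prec.trans_of_reference (fun z hz => ha.aeval_ne_zero hz)
      (fun z hz => hXH.aeval_ne_zero hz) (hfirst d) (h.augmented_prec_quotient hH hpos) hae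
      (hlast d) hce

end Quotient

end SymInterlacing

/-! ### Interlacing zeros -/

/-- The branch cut is approached only from above, where the principal argument tends to its value π.
-/
theorem continuousOn_arg_of_im_nonneg : ContinuousOn Complex.arg {z : ℂ | 0 ≤ z.im ∧ z ≠ 0} := by
  intro z hz
  by_cases hs : z ∈ Complex.slitPlane
  · exact (Complex.continuousAt_arg hs).continuousWithinAt
  · rw [Complex.mem_slitPlane_iff] at hs
    push Not at hs
    have hre : z.re < 0 := lt_of_le_of_ne hs.1 fun h => hz.2 (Complex.ext h hs.2)
    exact (Complex.continuousWithinAt_arg_of_re_neg_of_im_zero hre hs.2).mono fun w hw => hw.1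

/-- A continuous angle that starts at `0` and never has negative sine cannot end up negative. -/
theorem nonneg_of_sin_nonneg {D : ℝ → ℝ} (hD : ContinuousOn D (Set.Icc 0 Real.pi)) (h0 : D 0 = 0)
    (hs : ∀ τ ∈ Set.Ioo 0 Real.pi, 0 ≤ Real.sin (D τ)) : 0 ≤ D Real.pi := by
  by_contra! hneg
  set v := max (D Real.pi / 2) (-(Real.pi / 2)) with hv
  have hv0 : v < 0 := max_lt (by linarith) (by linarith [Real.pi_pos])
  have hv1 : D Real.pi < v := lt_of_lt_of_le (by linarith) (le_max_left _ _)
  have hv2 : -(Real.pi / 2) ≤ v := le_max_right _ _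
  obtain ⟨τ, hτ, hDτ⟩ := intermediate_value_Icc' Real.pi_pos.le hD ⟨hv1.le, by rw [h0]; exact hv0.le⟩
  have h1 : τ ≠ 0 := by rintro rfl; linarith
  have h2 : τ ≠ Real.pi := by rintro rfl; linarith
  have := hs τ ⟨lt_of_le_of_ne hτ.1 h1.symm, lt_of_le_of_ne hτ.2 h2⟩
  rw [hDτ] at this
  linarith [Real.sin_neg_of_neg_of_neg_pi_lt hv0 (by linarith [Real.pi_pos])]

/-- The sum of the arguments of `z - θ` over the zeros `θ` of `f`. -/
noncomputable def rootArg (f : ℝ[X]) (z : ℂ) : ℝ := (f.roots.map fun θ : ℝ => Complex.arg (z - θ)).sum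

theorem NonposRooted.leadingCoeff_pos {f : ℝ[X]} (hf : NonposRooted f) : 0 < f.leadingCoeff :=
  lt_of_le_of_ne hf.nonnegOnPos.leadingCoeff_nonneg (leadingCoeff_ne_zero.2 hf.ne_zero).symm

theorem multiset_prod_eq_norm_mul_exp (s : Multiset ℝ) (z : ℂ) :
    (s.map fun θ : ℝ => z - θ).prod = ((s.map fun θ : ℝ => ‖z - θ‖).prod : ℝ) *
      Complex.exp ((s.map fun θ : ℝ => Complex.arg (z - θ)).sum * Complex.I) := by
  induction s using Multiset.induction_on with
  | empty => simp
  | cons a s ih =>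
    simp only [Multiset.map_cons, Multiset.prod_cons, Multiset.sum_cons, ih]
    push_cast
    rw [add_mul, Complex.exp_add]
    conv_lhs => rw [← Complex.norm_mul_exp_arg_mul_I (z - a)]
    ring

theorem NonposRooted.aeval_eq {f : ℝ[X]} (hf : NonposRooted f) (z : ℂ) :
    ∃ R : ℝ, 0 ≤ R ∧ aeval z f = R * Complex.exp (rootArg f z * Complex.I) := by
  refine ⟨f.leadingCoeff * (f.roots.map fun θ : ℝ => ‖z - θ‖).prod,
    mul_nonneg hf.leadingCoeff_pos.le (Multiset.prod_nonneg fun a ha => ?_), ?_⟩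
  · obtain ⟨θ, -, rfl⟩ := Multiset.mem_map.1 ha
    exact norm_nonneg _
  · have := (HasOnlyNonposRealRoots.splits hf.1).eq_prod_roots
    conv_lhs => rw [this]
    rw [map_mul, aeval_C, map_multiset_prod, Multiset.map_map]
    have h2 : (f.roots.map ((fun p : ℝ[X] => aeval z p) ∘ fun θ => X - C θ)).prod
        = (f.roots.map fun θ : ℝ => z - θ).prod := by
      congr 1
      refine Multiset.map_congr rfl fun θ _ => ?_
      simp
    rw [h2, multiset_prod_eq_norm_mul_exp, rootArg]
    push_cast
    rw [mul_assoc]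
    rfl

theorem sin_nonneg_of_im {R₁ R₂ s a b : ℝ} (h₁ : 0 < R₁) (h₂ : 0 < R₂)
    (h : 0 ≤ ((R₁ * Complex.exp (a * Complex.I)) *
      starRingEnd ℂ (R₂ * Complex.exp (b * Complex.I))).im) (hs : s = a - b) : 0 ≤ Real.sin s := by
  rw [map_mul, Complex.conj_ofReal, ← Complex.exp_conj, map_mul, Complex.conj_I, Complex.conj_ofReal,
    show (R₁ : ℂ) * Complex.exp (a * Complex.I) * (R₂ * Complex.exp (b * -Complex.I))
      = ((R₁ * R₂ : ℝ) : ℂ) * (Complex.exp (a * Complex.I) * Complex.exp (b * -Complex.I)) by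
      push_cast; ring, ← Complex.exp_add,
    show (a : ℂ) * Complex.I + b * -Complex.I = ((a - b : ℝ) : ℂ) * Complex.I by push_cast; ring,
    Complex.im_ofReal_mul, Complex.exp_ofReal_mul_I_im] at h
  rw [hs]
  exact nonneg_of_mul_nonneg_right h (mul_pos h₁ h₂)

/-- The closed upper semicircle of radius ρ could meet the nonpositive zeros only at its endpoint
-ρ. -/
theorem continuousOn_rootArg {f : ℝ[X]} {ρ : ℝ} (hf : NonposRooted f) (hρ : 0 < ρ)
    (h : f.eval (-ρ) ≠ 0) :
    ContinuousOn (fun τ : ℝ => rootArg f (ρ * Complex.exp (τ * Complex.I))) (Set.Icc 0 Real.pi) := by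
  have hcont : ∀ θ ∈ f.roots.toFinset, ContinuousOn
      (fun τ : ℝ => Complex.arg (ρ * Complex.exp (τ * Complex.I) - θ)) (Set.Icc 0 Real.pi) := by
    intro θ hθ
    have hroot : f.eval θ = 0 := by simpa [hf.ne_zero] using hθ
    refine continuousOn_arg_of_im_nonneg.comp (by fun_prop) fun τ hτ => ⟨?_, fun h0 => ?_⟩
    · simp only [Complex.sub_im, Complex.im_ofReal_mul, Complex.exp_ofReal_mul_I_im,
        Complex.ofReal_im, sub_zero]
      exact mul_nonneg hρ.le (Real.sin_nonneg_of_nonneg_of_le_pi hτ.1 hτ.2)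
    · rw [sub_eq_zero] at h0
      have hnorm := congrArg norm h0
      rw [norm_mul, Complex.norm_exp_ofReal_mul_I, mul_one, Complex.norm_real, Complex.norm_real,
        Real.norm_of_nonneg hρ.le, Real.norm_of_nonpos (hf.root_nonpos hroot)] at hnorm
      exact h (by rw [hnorm, neg_neg]; exact hroot)
  have : (fun τ : ℝ => rootArg f (ρ * Complex.exp (τ * Complex.I))) = fun τ : ℝ =>
      ∑ θ ∈ f.roots.toFinset, f.roots.count θ •
        Complex.arg (ρ * Complex.exp (τ * Complex.I) - θ) := by
    funext τ
    rw [rootArg, Finset.sum_multiset_map_count]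
  rw [this]
  simp only [nsmul_eq_mul]
  exact continuousOn_finsetSum _ fun θ hθ => continuousOn_const.mul (hcont θ hθ)

theorem rootArg_of_pos {f : ℝ[X]} {ρ : ℝ} (hf : NonposRooted f) (hρ : 0 < ρ) :
    rootArg f ρ = 0 := by
  refine Multiset.sum_eq_zero fun a ha => ?_
  obtain ⟨θ, hθ, rfl⟩ := Multiset.mem_map.1 ha
  have := hf.root_nonpos ((mem_roots hf.ne_zero).1 hθ)
  rw [← Complex.ofReal_sub, Complex.arg_ofReal_of_nonneg (by linarith)]

theorem rootArg_of_neg {f : ℝ[X]} {t : ℝ} (h : f.eval t ≠ 0) :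
    rootArg f t = Real.pi * f.roots.countP (t < ·) := by
  have hne : ∀ θ ∈ f.roots, θ ≠ t := by
    rintro θ hθ rfl
    exact h (isRoot_of_mem_roots hθ)
  rw [rootArg]
  generalize f.roots = s at hne ⊢
  induction s using Multiset.induction_on with
  | empty => simp
  | cons a s ih =>
    rw [Multiset.map_cons, Multiset.sum_cons, ih fun θ hθ => hne θ (Multiset.mem_cons_of_mem hθ),
      Multiset.countP_cons, ← Complex.ofReal_sub]
    have ha := hne a (Multiset.mem_cons_self a s)
    split_ifs with hlt
    · rw [Complex.arg_ofReal_of_neg (by linarith)]; push_cast; ring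
    · rw [Complex.arg_ofReal_of_nonneg (by linarith)]; push_cast; ring

/-- Follow arg g - arg f along the upper semicircle from -t to t. It starts at 0, and the two
inequalities keep it from ending below 0 or above π; at t each zero to the right of t has
contributed π, so the numbers of these zeros differ by 0 or 1. -/
theorem Prec.countP_roots {f g : ℝ[X]} (h : Prec f g) (hf : NonposRooted f) (hg : NonposRooted g)
    {t : ℝ} (ht : t < 0) (hft : f.eval t ≠ 0) (hgt : g.eval t ≠ 0) :
    f.roots.countP (t < ·) ≤ g.roots.countP (t < ·) ∧
      g.roots.countP (t < ·) ≤ f.roots.countP (t < ·) + 1 := by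
  set ρ := -t with hρ
  have hρ0 : 0 < ρ := by linarith
  have htρ : -ρ = t := by rw [hρ, neg_neg]
  set Z : ℝ → ℂ := fun τ => ρ * Complex.exp (τ * Complex.I) with hZ
  have hZ0 : Z 0 = ρ := by simp [hZ]
  have hZπ : Z Real.pi = t := by simp [hZ, hρ, Complex.exp_pi_mul_I]
  have cf := continuousOn_rootArg hf hρ0 (by rwa [htρ])
  have cg := continuousOn_rootArg hg hρ0 (by rwa [htρ])
  have ends : rootArg g (Z Real.pi) - rootArg f (Z Real.pi)
      = Real.pi * ((g.roots.countP (t < ·) : ℝ) - f.roots.countP (t < ·)) := by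
    rw [hZπ, rootArg_of_neg hft, rootArg_of_neg hgt]; ring
  have main : ∀ τ ∈ Set.Ioo 0 Real.pi,
      0 ≤ Real.sin (rootArg g (Z τ) - rootArg f (Z τ)) ∧
      0 ≤ Real.sin (τ - (rootArg g (Z τ) - rootArg f (Z τ))) := by
    intro τ hτ
    have him : 0 < (Z τ).im := by
      simp only [hZ, Complex.im_ofReal_mul, Complex.exp_ofReal_mul_I_im]
      exact mul_pos hρ0 (Real.sin_pos_of_pos_of_lt_pi hτ.1 hτ.2)
    obtain ⟨R₁, h₁, e₁⟩ := hf.aeval_eq (Z τ)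
    obtain ⟨R₂, h₂, e₂⟩ := hg.aeval_eq (Z τ)
    have p₁ : 0 < R₁ := h₁.lt_of_ne' (by
      rintro rfl; exact hf.aeval_ne_zero him (by rw [e₁]; simp))
    have p₂ : 0 < R₂ := h₂.lt_of_ne' (by
      rintro rfl; exact hg.aeval_ne_zero him (by rw [e₂]; simp))
    obtain ⟨q₁, q₂⟩ := h (Z τ) him
    rw [e₁, e₂] at q₁ q₂
    refine ⟨sin_nonneg_of_im p₂ p₁ q₁ rfl, ?_⟩
    refine sin_nonneg_of_im (R₁ := ρ * R₁) (R₂ := R₂) (a := τ + rootArg f (Z τ))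
      (b := rootArg g (Z τ)) (mul_pos hρ0 p₁) p₂ ?_ (by ring)
    convert q₂ using 3
    simp only [hZ]
    push_cast
    rw [add_mul, Complex.exp_add]
    ring
  have r₁ := nonneg_of_sin_nonneg (D := fun τ => rootArg g (Z τ) - rootArg f (Z τ)) (cg.sub cf)
    (by simp only [hZ0]; rw [rootArg_of_pos hf hρ0, rootArg_of_pos hg hρ0, sub_zero])
    (fun τ hτ => (main τ hτ).1)
  have r₂ := nonneg_of_sin_nonneg (D := fun τ => τ - (rootArg g (Z τ) - rootArg f (Z τ)))
    (continuousOn_id.sub (cg.sub cf))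
    (by simp only [hZ0]; rw [rootArg_of_pos hf hρ0, rootArg_of_pos hg hρ0]; simp)
    (fun τ hτ => (main τ hτ).2)
  simp only [ends] at r₁ r₂
  have hπ := Real.pi_pos
  constructor
  · have := nonneg_of_mul_nonneg_right r₁ hπ
    exact_mod_cast sub_nonneg.1 this
  · have : 0 ≤ Real.pi * (1 - ((g.roots.countP (t < ·) : ℝ) - f.roots.countP (t < ·))) := by
      linarith
    have := nonneg_of_mul_nonneg_right this hπ
    have h3 : (g.roots.countP (t < ·) : ℝ) ≤ f.roots.countP (t < ·) + 1 := by linarith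
    exact_mod_cast h3

theorem List.Pairwise.lt_countP {l : List ℝ} (hl : l.Pairwise (· ≥ ·)) {t : ℝ} {i : ℕ}
    (hi : i < l.length) (ht : t < l[i]) : i + 1 ≤ l.countP (t < ·) := by
  have h1 : (l.take (i + 1)).countP (t < ·) = i + 1 := by
    rw [List.countP_eq_length.2, List.length_take]
    · omega
    · intro a ha
      obtain ⟨j, hj, rfl⟩ := List.getElem_of_mem ha
      rw [List.length_take] at hj
      rw [List.getElem_take, decide_eq_true_eq]
      rcases (show j ≤ i by omega).lt_or_eq with h | rfl
      · exact ht.trans_le (List.pairwise_iff_getElem.1 hl j i (by omega) hi h)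
      · exact ht
  rw [← h1]
  exact (List.take_sublist _ _).countP_le

theorem List.Pairwise.countP_le {l : List ℝ} (hl : l.Pairwise (· ≥ ·)) {t : ℝ} {i : ℕ}
    (hi : i < l.length) (ht : l[i] < t) : l.countP (t < ·) ≤ i := by
  conv_lhs => rw [← List.take_append_drop i l, List.countP_append]
  have h1 : (l.drop i).countP (t < ·) = 0 := by
    rw [List.countP_eq_zero]
    intro a ha
    obtain ⟨j, hj, rfl⟩ := List.getElem_of_mem ha
    rw [List.length_drop] at hj
    rw [List.getElem_drop, decide_eq_true_eq, not_lt]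
    rcases j.eq_zero_or_pos with rfl | h
    · exact ht.le
    · exact (List.pairwise_iff_getElem.1 hl i (i + j) hi (by omega) (by omega)).trans ht.le
  rw [h1, add_zero]
  exact (List.countP_le_length).trans (by rw [List.length_take]; omega)

theorem List.prod_map_eq_prod_range_getD {M : Type*} [CommMonoid M] (l : List ℝ) (F : ℝ → M) :
    (l.map F).prod = ∏ i ∈ Finset.range l.length, F (l.getD i 0) := by
  induction l with
  | nil => simp
  | cons a l ih =>
    rw [List.map_cons, List.prod_cons, List.length_cons, Finset.prod_range_succ', mul_comm, ih]
    simp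

theorem Prec.interlaces {f g : ℝ[X]} (h : Prec f g) (hf : NonposRooted f) (hg : NonposRooted g) :
    Interlaces f g := by
  have hd₁ := h.natDegree_le hf.nonnegOnPos hg.nonnegOnPos hg.ne_zero
  have hd₂ := h.X_mul.natDegree_le hg.nonnegOnPos hf.X_mul.nonnegOnPos hf.X_mul.ne_zero
  rw [natDegree_X_mul hf.ne_zero] at hd₂
  set a := f.roots.sort (· ≥ ·) with ha
  set b := g.roots.sort (· ≥ ·) with hb
  have ca : (a : Multiset ℝ) = f.roots := Multiset.sort_eq _ _
  have cb : (b : Multiset ℝ) = g.roots := Multiset.sort_eq _ _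
  have la : a.length = f.natDegree := by
    rw [(HasOnlyNonposRealRoots.splits hf.1).natDegree_eq_card_roots, ← ca, Multiset.coe_card]
  have lb : b.length = g.natDegree := by
    rw [(HasOnlyNonposRealRoots.splits hg.1).natDegree_eq_card_roots, ← cb, Multiset.coe_card]
  have pa : a.Pairwise (· ≥ ·) := Multiset.pairwise_sort _ _
  have pb : b.Pairwise (· ≥ ·) := Multiset.pairwise_sort _ _
  have factor : ∀ (p : ℝ[X]) (l : List ℝ), NonposRooted p → (l : Multiset ℝ) = p.roots →
      p = C p.leadingCoeff * ∏ i ∈ Finset.range l.length, (X - C (l.getD i 0)) := by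
    intro p l hp hl
    rw [← List.prod_map_eq_prod_range_getD l fun θ => X - C θ]
    conv_lhs => rw [(HasOnlyNonposRealRoots.splits hp.1).eq_prod_roots, ← hl]
    simp
  have mem_nonpos : ∀ (p : ℝ[X]) (l : List ℝ), NonposRooted p → (l : Multiset ℝ) = p.roots →
      ∀ x ∈ l, x ≤ 0 := by
    intro p l hp hl x hx
    refine hp.root_nonpos ((mem_roots hp.ne_zero).1 ?_)
    rw [← hl]; exact hx
  -- A violated inequality between zeros leaves an interval containing a point t that is no zero of
  -- f or g, and counting zeros beyond t gives a contradiction.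
  have gap : ∀ x y : ℝ, x < y → y ≤ 0 → ∃ t, x < t ∧ t < y ∧
      a.countP (t < ·) ≤ b.countP (t < ·) ∧ b.countP (t < ·) ≤ a.countP (t < ·) + 1 := by
    intro x y hxy hy
    obtain ⟨t, ht, hmem⟩ := (Set.Ioo_infinite hxy).exists_notMem_finset
      ((f.roots + g.roots).toFinset)
    simp only [Multiset.mem_toFinset, Multiset.mem_add, mem_roots hf.ne_zero,
      mem_roots hg.ne_zero, not_or] at hmem
    have := h.countP_roots hf hg (ht.2.trans_le hy) hmem.1 hmem.2
    rw [← ca, ← cb, Multiset.coe_countP, Multiset.coe_countP] at this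
    exact ⟨t, ht.1, ht.2, this⟩
  refine ⟨hf.ne_zero, hg.ne_zero, a.length, b.length, fun i => a.getD i 0, fun i => b.getD i 0,
    by omega, factor f a hf ca, factor g b hg cb, fun i hi => ?_, fun i hi => ?_⟩
  · have hi' : i < b.length := by omega
    simp only [List.getD_eq_getElem _ _ hi, List.getD_eq_getElem _ _ hi']
    by_contra! hlt
    obtain ⟨t, h1, h2, h3, h4⟩ := gap _ _ hlt (mem_nonpos f a hf ca _ (List.getElem_mem hi))
    have := pa.lt_countP hi h2
    have := pb.countP_le hi' h1
    omega
  · have hi' : i < a.length := by omega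
    simp only [List.getD_eq_getElem _ _ hi, List.getD_eq_getElem _ _ hi']
    by_contra! hlt
    obtain ⟨t, h1, h2, h3, h4⟩ := gap _ _ hlt (mem_nonpos g b hg cb _ (List.getElem_mem hi))
    have := pb.lt_countP hi h2
    have := pa.countP_le hi' h1
    omega

/-! ### Ranks -/

section RankLemmas

variable {P : Type u} [PartialOrder P]

theorem height_ne_top_of_finite [Finite P] (x : P) : Order.height x ≠ ⊤ := by
  rw [Ne, Order.height_eq_top_iff]
  intro h
  obtain ⟨p, -, hp⟩ := h (Nat.card P)
  have := Nat.card_le_card_of_injective p p.strictMono.injective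
  rw [Nat.card_eq_fintype_card, Fintype.card_fin] at this
  omega

theorem coe_posetRank [Finite P] (x : P) : (posetRank x : ℕ∞) = Order.height x :=
  ENat.natCast_toNat (height_ne_top_of_finite x)

theorem posetRank_strictMono [Finite P] : StrictMono (posetRank : P → ℕ) := fun x y h => by
  have := Order.height_strictMono h (height_ne_top_of_finite x).lt_top
  rw [← coe_posetRank, ← coe_posetRank] at this
  exact_mod_cast this

theorem posetRank_bot [OrderBot P] : posetRank (⊥ : P) = 0 := by simp [posetRank]

theorem posetRank_lt_top_iff [OrderTop P] [Finite P] {x : P} :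
    posetRank x < posetRank (⊤ : P) ↔ x ≠ ⊤ :=
  ⟨by rintro h rfl; exact h.false, fun h => posetRank_strictMono (lt_top_iff_ne_top.2 h)⟩

theorem exists_covBy_of_ne_top [OrderTop P] [Finite P] {x : P} (hx : x ≠ ⊤) : ∃ y, x ⋖ y := by
  obtain ⟨y, hy, -⟩ := exists_covBy_le_of_lt (lt_top_iff_ne_top.2 hx)
  exact ⟨y, hy⟩

theorem exists_posetRank_eq [BoundedOrder P] [Finite P] (hgr : IsGradedPoset P) {k : ℕ}
    (hk : k ≤ posetRank (⊤ : P)) : ∃ x : P, posetRank x = k := by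
  induction k with
  | zero => exact ⟨⊥, posetRank_bot⟩
  | succ k ih =>
    obtain ⟨x, hx⟩ := ih (by omega)
    obtain ⟨y, hy⟩ := exists_covBy_of_ne_top (posetRank_lt_top_iff.1 (show posetRank x < _ by omega))
    exact ⟨y, by rw [hgr x y hy, hx]⟩

end RankLemmas

/-! ### Rising chains -/

section Rising

variable {P : Type u} [PartialOrder P] {L : Type v} [LinearOrder L]

/-- There is a saturated chain with weakly increasing labels from `s` to `t` through the
cover `u` of `s`. -/
def RisingVia (lam : P → P → L) (s u t : P) : Prop :=
  ∃ c : List P, IsSaturatedChain s t (s :: u :: c) ∧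
    (chainLabels lam (s :: u :: c)).IsChain (· ≤ ·)

variable {lam : P → P → L} {s t u v : P}

theorem IsSaturatedChain.le : ∀ {c : List P} {s t : P}, IsSaturatedChain s t c → s ≤ t
  | [], _, _, h => by simp [IsSaturatedChain] at h
  | [a], s, t, h => by
    obtain ⟨h1, h2, -⟩ := h
    simp only [List.head?_cons, List.getLast?_singleton, Option.some.injEq] at h1 h2
    rw [← h1, ← h2]
  | a :: b :: c, s, t, h => by
    obtain ⟨h1, h2, h3⟩ := h
    rw [List.isChain_cons_cons] at h3
    simp only [List.head?_cons, Option.some.injEq] at h1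
    rw [← h1]
    exact h3.1.le.trans (IsSaturatedChain.le (c := b :: c) ⟨rfl, by simpa using h2, h3.2⟩)

theorem RisingVia.covBy (h : RisingVia lam s u t) : s ⋖ u := by
  obtain ⟨c, ⟨-, -, h3⟩, -⟩ := h
  exact (List.isChain_cons_cons.1 h3).1

theorem risingVia_iff : RisingVia lam s u t ↔
    s ⋖ u ∧ (u = t ∨ ∃ v, RisingVia lam u v t ∧ lam s u ≤ lam u v) := by
  constructor
  · intro h
    refine ⟨h.covBy, ?_⟩
    obtain ⟨c, ⟨-, h2, h3⟩, h4⟩ := h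
    rw [List.isChain_cons_cons] at h3
    rcases c with - | ⟨v, c⟩
    · left; simpa using h2
    · right
      simp only [chainLabels, List.tail_cons, List.zipWith_cons_cons,
        List.isChain_cons_cons] at h4
      refine ⟨v, ⟨c, ⟨rfl, by simpa using h2, h3.2⟩, ?_⟩, h4.1⟩
      simpa only [chainLabels, List.tail_cons, List.zipWith_cons_cons] using h4.2
  · rintro ⟨h1, rfl | ⟨v, ⟨c, ⟨h2, h3, h4⟩, h5⟩, h6⟩⟩
    · exact ⟨[], ⟨rfl, by simp, by simpa using h1⟩, by simp [chainLabels]⟩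
    · refine ⟨v :: c, ⟨rfl, by simpa using h3, List.isChain_cons_cons.2 ⟨h1, h4⟩⟩, ?_⟩
      simp only [chainLabels, List.tail_cons, List.zipWith_cons_cons,
        List.isChain_cons_cons] at h5 ⊢
      exact ⟨h6, h5⟩

theorem RisingVia.le (h : RisingVia lam s u t) : u ≤ t := by
  obtain ⟨c, ⟨-, h2, h3⟩, -⟩ := h
  rw [List.isChain_cons_cons] at h3
  exact IsSaturatedChain.le (c := u :: c) ⟨rfl, by simpa using h2, h3.2⟩

theorem RisingVia.lt (h : RisingVia lam s u t) : s < t := h.covBy.lt.trans_le h.le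

theorem IsELLabeling.existsUnique_risingVia (hlam : IsELLabeling lam) (h : s < t) :
    ∃! u, RisingVia lam s u t := by
  obtain ⟨c, ⟨hc, hr⟩, huniq, -⟩ := hlam s t h.le
  rcases c with - | ⟨a, - | ⟨u, c⟩⟩
  · simp [IsSaturatedChain] at hc
  · obtain ⟨h1, h2, -⟩ := hc
    simp only [List.head?_cons, List.getLast?_singleton, Option.some.injEq] at h1 h2
    exact absurd (h1.symm.trans h2) h.ne
  · obtain rfl : a = s := by simpa using hc.1
    refine ⟨u, ⟨c, hc, hr⟩, ?_⟩
    rintro u' ⟨c', hc', hr'⟩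
    have := huniq _ hc' hr'
    simp only [List.cons.injEq, true_and] at this
    exact this.1

end Rising

/-! ### Label statistics -/

section Statistics

variable {P : Type u} [PartialOrder P] [Fintype P] {L : Type v} [LinearOrder L]
  {lam : P → P → L} {s t u v : P}

theorem mem_labelsAbove (h : s ⋖ t) : lam s t ∈ labelsAbove lam s := by
  classical
  rw [labelsAbove, Finset.mem_image]
  exact ⟨t, by simpa using h, rfl⟩

theorem labelIndex_pos (h : s ⋖ t) : 1 ≤ labelIndex lam s t :=
  Finset.card_pos.2 ⟨lam s t, Finset.mem_filter.2 ⟨mem_labelsAbove h, le_rfl⟩⟩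

theorem labelIndex_le_card : labelIndex lam s t ≤ Fintype.card P := by
  classical
  refine (Finset.card_filter_le _ _).trans ?_
  rw [labelsAbove]
  exact Finset.card_image_le.trans (Finset.card_le_univ _)

/-- Both numbers count initial segments of the labels above u. This replaces comparison of labels,
which depends on the elements, by comparison of integers, which uniformity controls. -/
theorem le_iff_descentCount_lt (h : u ⋖ v) :
    lam s u ≤ lam u v ↔ descentCount lam s u < labelIndex lam u v := by
  constructor
  · intro hle
    refine Finset.card_lt_card ?_
    rw [Finset.ssubset_iff_of_subset]
    · exact ⟨lam u v, Finset.mem_filter.2 ⟨mem_labelsAbove h, le_rfl⟩, fun hm =>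
        (Finset.mem_filter.1 hm).2.not_ge hle⟩
    · intro a ha
      rw [Finset.mem_filter] at ha ⊢
      exact ⟨ha.1, ha.2.le.trans hle⟩
  · intro hlt
    by_contra! hcon
    refine hlt.not_ge (Finset.card_le_card fun a ha => ?_)
    rw [Finset.mem_filter] at ha ⊢
    exact ⟨ha.1, ha.2.trans_lt hcon⟩

theorem labelWidth_zero : labelWidth lam s 0 = 0 := by
  classical
  rw [labelWidth, Finset.card_eq_zero, Finset.filter_eq_empty_iff]
  rintro t - ⟨h, h0⟩
  have := labelIndex_pos (lam := lam) h
  omega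

theorem labelWidth_ne_zero_iff {i : ℕ} :
    labelWidth lam s i ≠ 0 ↔ ∃ t, s ⋖ t ∧ labelIndex lam s t = i := by
  classical
  rw [labelWidth, Finset.card_ne_zero]
  simp [Finset.filter_nonempty_iff]

open Classical in
theorem sum_covers_eq {A : Type*} [CommSemiring A] (p : ℕ → Prop) [DecidablePred p] (g : ℕ → A) :
    ∑ v with s ⋖ v ∧ p (labelIndex lam s v), g (labelIndex lam s v) =
      ∑ j ∈ Finset.range (Fintype.card P + 1) with p j, (labelWidth lam s j : A) * g j := by
  rw [← Finset.sum_fiberwise_of_maps_to (t := (Finset.range (Fintype.card P + 1)).filter p)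
    (g := fun v => labelIndex lam s v)]
  · refine Finset.sum_congr rfl fun j hj => ?_
    rw [Finset.sum_congr rfl (g := fun _ => g j) fun v hv => by rw [(Finset.mem_filter.1 hv).2],
      Finset.sum_const, nsmul_eq_mul]
    congr 2
    rw [labelWidth]
    congr 1
    ext v
    simp only [Finset.mem_filter, Finset.mem_univ, true_and] at hj ⊢
    constructor
    · rintro ⟨⟨h1, -⟩, h3⟩; exact ⟨h1, h3⟩
    · rintro ⟨h1, h3⟩; exact ⟨⟨h1, h3 ▸ hj.2⟩, h3⟩
  · intro v hv
    simp only [Finset.mem_filter, Finset.mem_univ, true_and, Finset.mem_range] at hv ⊢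
    exact ⟨Nat.lt_succ_of_le labelIndex_le_card, hv.2⟩

end Statistics

/-! ### Counting along rising chains -/

section Counting

variable {P : Type u} [PartialOrder P] [Fintype P]

open Classical in
theorem sum_gt_eq_sum_risingVia {L : Type v} [LinearOrder L] {lam : P → P → L}
    (hlam : IsELLabeling lam) {A : Type*} [AddCommMonoid A] (s : P) (F : P → A) :
    ∑ t with s < t, F t = ∑ u with s ⋖ u, ∑ t with RisingVia lam s u t, F t := by
  rw [Finset.sum_comm' (t' := {t | s < t}) (s' := fun t => {u | RisingVia lam s u t})]
  · refine Finset.sum_congr rfl fun t ht => ?_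
    obtain ⟨u, hu, huniq⟩ := hlam.existsUnique_risingVia (Finset.mem_filter.1 ht).2
    have : ({u | RisingVia lam s u t} : Finset P) = {u} := by
      ext x
      simp only [Finset.mem_filter, Finset.mem_univ, true_and, Finset.mem_singleton]
      exact ⟨huniq x, by rintro rfl; exact hu⟩
    rw [this, Finset.sum_singleton]
  · intro u t
    simp only [Finset.mem_filter, Finset.mem_univ, true_and]
    exact ⟨fun h => ⟨h.2, h.2.lt⟩, fun h => ⟨h.1.covBy, h.1⟩⟩

open Classical in
-- A rising chain through the edge s ⋖ u either stops at u or continues through an edge u ⋖ v whose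
-- label is not smaller.
theorem sum_risingVia_eq {L : Type v} [LinearOrder L] {lam : P → P → L}
    (hlam : IsELLabeling lam) {A : Type*} [AddCommMonoid A] {s u : P} (h : s ⋖ u) (F : P → A) :
    ∑ t with RisingVia lam s u t, F t = F u +
      ∑ v with u ⋖ v ∧ descentCount lam s u < labelIndex lam u v,
        ∑ t with RisingVia lam u v t, F t := by
  rw [Finset.sum_comm' (t' := {t | RisingVia lam s u t ∧ t ≠ u})
    (s' := fun t => {v | RisingVia lam u v t})]
  · have hu : RisingVia lam s u u := risingVia_iff.2 ⟨h, Or.inl rfl⟩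
    rw [← Finset.add_sum_erase _ F (Finset.mem_filter.2 ⟨Finset.mem_univ u, hu⟩)]
    congr 1
    refine Finset.sum_congr (by ext; simp [and_comm]) fun t ht => ?_
    have ht' := (Finset.mem_filter.1 ht).2
    obtain ⟨v, hv, huniq⟩ := hlam.existsUnique_risingVia (lt_of_le_of_ne ht'.1.le ht'.2.symm)
    have : ({v | RisingVia lam u v t} : Finset P) = {v} := by
      ext x
      simp only [Finset.mem_filter, Finset.mem_univ, true_and, Finset.mem_singleton]
      exact ⟨huniq x, by rintro rfl; exact hv⟩
    rw [this, Finset.sum_singleton]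
  · intro v t
    simp only [Finset.mem_filter, Finset.mem_univ, true_and]
    constructor
    · rintro ⟨⟨h1, h2⟩, h3⟩
      exact ⟨h3, risingVia_iff.2 ⟨h, Or.inr ⟨v, h3, (le_iff_descentCount_lt h1).2 h2⟩⟩, h3.lt.ne'⟩
    · rintro ⟨h1, h2, h3⟩
      refine ⟨⟨h1.covBy, ?_⟩, h1⟩
      obtain ⟨-, rfl | ⟨v', hv', hle⟩⟩ := risingVia_iff.1 h2
      · exact absurd rfl h3
      · obtain rfl := (hlam.existsUnique_risingVia h1.lt).unique hv' h1
        exact (le_iff_descentCount_lt h1.covBy).1 hle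

variable [BoundedOrder P]

/-- Widths `w k i` and descent counts `d k i` that depend on the rank `k` and label index `i`
only, and that determine all rank-weighted sums over the elements above a given one. -/
structure IsRankData (P : Type u) [PartialOrder P] [Fintype P] [BoundedOrder P] (N : ℕ)
    (w d : ℕ → ℕ → ℕ) : Prop where
  width_zero : ∀ k, w k 0 = 0
  mono : ∀ k i j, w k i ≠ 0 → w k j ≠ 0 → i ≤ j → d k i ≤ d k j
  sum_eq : ∀ (c φ : ℕ → ℝ[X]) (E : ℕ → ℕ → ℝ[X]),
    (∀ k, k + 1 = posetRank (⊤ : P) → ∀ i, E k i = φ (k + 1)) →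
    (∀ k, k + 1 < posetRank (⊤ : P) → ∀ i, E k i = φ (k + 1) +
      c (k + 1) * ∑ j ∈ Finset.range N with d k i < j, (w (k + 1) j : ℝ[X]) * E (k + 1) j) →
    ∀ [DecidableLT P] (s : P), s ≠ ⊤ →
      ∑ t with s < t, (∏ l ∈ Finset.Ioo (posetRank s) (posetRank t), c l) * φ (posetRank t) =
        ∑ j ∈ Finset.range N, (w (posetRank s) j : ℝ[X]) * E (posetRank s) j

open Classical in
-- Each rank strictly between s and t contributes one factor c, picked up when the rising chain
-- continues past it. By induction from the top, the sum over all ends depends on the first edge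
-- only through its rank and label index.
theorem sum_risingVia_eq_of_recursion {L : Type v} [LinearOrder L] {lam : P → P → L}
    (hgr : IsGradedPoset P) (hlam : IsELLabeling lam) {w d : ℕ → ℕ → ℕ}
    (hw : ∀ s i, labelWidth lam s i = w (posetRank s) i)
    (hd : ∀ s t, s ⋖ t → descentCount lam s t = d (posetRank s) (labelIndex lam s t))
    {c φ : ℕ → ℝ[X]} {E : ℕ → ℕ → ℝ[X]}
    (hE₀ : ∀ k, k + 1 = posetRank (⊤ : P) → ∀ i, E k i = φ (k + 1))
    (hE : ∀ k, k + 1 < posetRank (⊤ : P) → ∀ i, E k i = φ (k + 1) +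
      c (k + 1) * ∑ j ∈ Finset.range (Fintype.card P + 1) with d k i < j,
        (w (k + 1) j : ℝ[X]) * E (k + 1) j) (s u : P) (h : s ⋖ u) :
    ∑ t with RisingVia lam s u t,
      (∏ l ∈ Finset.Ioo (posetRank s) (posetRank t), c l) * φ (posetRank t) =
        E (posetRank s) (labelIndex lam s u) := by
  induction s using WellFoundedGT.induction generalizing u with
  | ind s ih =>
  have hru := hgr s u h
  rw [sum_risingVia_eq hlam h]
  have hempty : Finset.Ioo (posetRank s) (posetRank u) = ∅ := by
    ext l
    simp only [Finset.mem_Ioo, Finset.notMem_empty, iff_false]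
    omega
  rw [hempty, Finset.prod_empty, one_mul, hru]
  have hle : posetRank u ≤ posetRank (⊤ : P) := posetRank_strictMono.monotone le_top
  rcases hle.lt_or_eq with hlt | heq
  · rw [hE _ (by omega)]
    congr 1
    rw [← hd s u h, ← hru]
    simp_rw [← hw u]
    rw [← sum_covers_eq (lam := lam) (fun j => descentCount lam s u < j) (E (posetRank u)),
      Finset.mul_sum]
    refine Finset.sum_congr rfl fun v hv => ?_
    have hv' := (Finset.mem_filter.1 hv).2.1
    rw [← ih u h.lt v hv', Finset.mul_sum]
    refine Finset.sum_congr rfl fun t ht => ?_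
    have ht' : posetRank u < posetRank t := posetRank_strictMono (Finset.mem_filter.1 ht).2.lt
    rw [← mul_assoc, hru, ← Finset.prod_insert (by simp)]
    congr 2
    ext l
    simp only [Finset.mem_Ioo, Finset.mem_insert]
    omega
  · rw [hE₀ _ (by omega)]
    have : u = ⊤ := by
      by_contra hne
      exact (posetRank_lt_top_iff.2 hne).ne heq
    subst this
    rw [add_eq_left]
    refine Finset.sum_eq_zero fun v hv => ?_
    exact absurd (Finset.mem_filter.1 hv).2.1.lt not_top_lt

theorem UMELShellable.exists_rankData (hP : UMELShellable.{u, v} P) :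
    ∃ N w d, IsRankData P N w d := by
  classical
  obtain ⟨hgr, L, _, lam, hlam, ⟨hwid, hdes⟩, hmono⟩ := hP
  -- The common values are taken from an arbitrary element or edge; the default 0 is used at ranks
  -- and indices that do not occur.
  set w : ℕ → ℕ → ℕ := fun k i =>
    if h : ∃ s : P, posetRank s = k then labelWidth lam h.choose i else 0 with hwdef
  set d : ℕ → ℕ → ℕ := fun k i =>
    if h : ∃ e : P × P, posetRank e.1 = k ∧ e.1 ⋖ e.2 ∧ labelIndex lam e.1 e.2 = i then
      descentCount lam h.choose.1 h.choose.2 else 0 with hddef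
  have hw : ∀ s i, labelWidth lam s i = w (posetRank s) i := by
    intro s i
    have h : ∃ s' : P, posetRank s' = posetRank s := ⟨s, rfl⟩
    simp only [hwdef, dif_pos h]
    rcases i.eq_zero_or_pos with rfl | hi
    · rw [labelWidth_zero, labelWidth_zero]
    · exact hwid _ _ h.choose_spec.symm i hi
  have hd : ∀ s t, s ⋖ t → descentCount lam s t = d (posetRank s) (labelIndex lam s t) := by
    intro s t hst
    have h : ∃ e : P × P, posetRank e.1 = posetRank s ∧ e.1 ⋖ e.2 ∧
        labelIndex lam e.1 e.2 = labelIndex lam s t := ⟨(s, t), rfl, hst, rfl⟩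
    simp only [hddef, dif_pos h]
    obtain ⟨h1, h2, h3⟩ := h.choose_spec
    exact hdes _ _ _ _ h1.symm hst h2 h3.symm
  have hedge : ∀ k i, w k i ≠ 0 → ∃ s t : P, posetRank s = k ∧ s ⋖ t ∧ labelIndex lam s t = i := by
    intro k i hki
    by_cases h : ∃ s : P, posetRank s = k
    · obtain ⟨s, rfl⟩ := h
      rw [← hw, labelWidth_ne_zero_iff] at hki
      obtain ⟨t, h1, h2⟩ := hki
      exact ⟨s, t, rfl, h1, h2⟩
    · simp only [hwdef, dif_neg h] at hki
      exact absurd rfl hki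
  refine ⟨Fintype.card P + 1, w, d, ?_, ?_, ?_⟩
  · intro k
    simp only [hwdef]
    split_ifs
    · exact labelWidth_zero
    · rfl
  · intro k i j hi hj hij
    obtain ⟨s, t, rfl, h1, rfl⟩ := hedge k i hi
    obtain ⟨s', t', h2, h3, rfl⟩ := hedge _ j hj
    rw [← hd s t h1, ← h2, ← hd s' t' h3]
    exact hmono _ _ _ _ h2.symm h1 h3 hij
  · intro c φ E hE₀ hE _ s hs
    have h1 := sum_gt_eq_sum_risingVia hlam s fun t =>
      (∏ l ∈ Finset.Ioo (posetRank s) (posetRank t), c l) * φ (posetRank t)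
    have h2 := sum_covers_eq (lam := lam) (s := s) (fun _ => True) (E (posetRank s))
    simp only [and_true, Finset.filter_true, hw] at h2
    rw [← h2, ← Finset.sum_congr rfl fun u hu => sum_risingVia_eq_of_recursion hgr hlam hw hd hE₀ hE s u
      (Finset.mem_filter.1 hu).2]
    convert h1

end Counting

/-! ### Polynomials attached to rank data -/

/-- Parameters of the recursions on rank data: number of ranks, bound on the label indices,
widths, descent counts, selected ranks. -/
structure RankParams where
  top : ℕ
  bound : ℕ
  width : ℕ → ℕ → ℕ
  desc : ℕ → ℕ → ℕ
  sel : Finset ℕ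

namespace RankParams

variable (D : RankParams)

/-- Weighted sum over the label indices at rank `k`. -/
noncomputable def total (k : ℕ) (g : ℕ → ℝ[X]) : ℝ[X] :=
  ∑ j ∈ Finset.range D.bound, (D.width k j : ℝ[X]) * g j

/-- Weighted sum over the label indices at rank `k` above `m`. -/
noncomputable def suffix (k m : ℕ) (g : ℕ → ℝ[X]) : ℝ[X] :=
  ∑ j ∈ Finset.range D.bound with m < j, (D.width k j : ℝ[X]) * g j

/-- The family of pairs of mutually reversed polynomials, indexed by the corank minus one and the
label index. -/
noncomputable def pairs (e : ℕ) : ℕ → ℕ → ℝ[X] × ℝ[X]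
  | 0, _ => (1, X ^ e)
  | n + 1, i =>
    let k := D.top - 1 - n
    let a := fun j => (pairs e n j).1
    let b := fun j => (pairs e n j).2
    let m := D.desc (k - 1) i
    if k ∈ D.sel then
      (X * ((D.total k b - D.total k a) /ₘ (X - C 1)) + D.suffix k m a,
        X * ((D.total k b - D.total k a) /ₘ (X - C 1)) + X * D.suffix k m b)
    else (D.suffix k m a, D.suffix k m b)

/-- Here k is the rank that the edge leaves, so the recursion starts at k = top - 1 with the edges
ending in the greatest element. -/
noncomputable def lower (e k i : ℕ) : ℝ[X] := (D.pairs e (D.top - 1 - k) i).1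

noncomputable def upper (e k i : ℕ) : ℝ[X] := (D.pairs e (D.top - 1 - k) i).2

/-- The quotient by `x - 1` of the difference of the total upper and lower polynomials. -/
noncomputable def quot (e k : ℕ) : ℝ[X] :=
  (D.total k (D.upper e k) - D.total k (D.lower e k)) /ₘ (X - C 1)

/-- The family for the `h`-polynomial. -/
noncomputable def hFamily : ℕ → ℕ → ℝ[X]
  | 0, _ => 1
  | n + 1, i =>
    let k := D.top - 1 - n
    let m := D.desc (k - 1) i
    if k ∈ D.sel then
      X * D.total k (hFamily n) + (1 - X) * D.suffix k m (hFamily n)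
    else D.suffix k m (hFamily n)

noncomputable def hLower (k i : ℕ) : ℝ[X] := D.hFamily (D.top - 1 - k) i

/-- The number of rising paths from an edge to the top. -/
def paths : ℕ → ℕ → ℕ
  | 0, _ => 1
  | n + 1, i =>
    let k := D.top - 1 - n
    ∑ j ∈ Finset.range D.bound with D.desc (k - 1) i < j, D.width k j * paths n j

def pathCount (k i : ℕ) : ℕ := D.paths (D.top - 1 - k) i

variable {D} {e k : ℕ}

theorem lower_last (hk : k + 1 = D.top) (i : ℕ) : D.lower e k i = 1 := by
  rw [lower, show D.top - 1 - k = 0 by omega, pairs]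

theorem upper_last (hk : k + 1 = D.top) (i : ℕ) : D.upper e k i = X ^ e := by
  rw [upper, show D.top - 1 - k = 0 by omega, pairs]

theorem hLower_last (hk : k + 1 = D.top) (i : ℕ) : D.hLower k i = 1 := by
  rw [hLower, show D.top - 1 - k = 0 by omega, hFamily]

theorem pathCount_last (hk : k + 1 = D.top) (i : ℕ) : D.pathCount k i = 1 := by
  rw [pathCount, show D.top - 1 - k = 0 by omega, paths]

theorem lower_eq (hk : k + 1 < D.top) (i : ℕ) : D.lower e k i =
    (if k + 1 ∈ D.sel then X * D.quot e (k + 1) else 0) +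
      D.suffix (k + 1) (D.desc k i) (D.lower e (k + 1)) := by
  obtain ⟨n, hn⟩ : ∃ n, D.top - 1 - k = n + 1 := ⟨D.top - 2 - k, by omega⟩
  have h1 : D.top - 1 - (k + 1) = n := by omega
  have h2 : D.top - 1 - n = k + 1 := by omega
  unfold quot lower upper
  rw [hn, h1, pairs, h2]
  simp only [Nat.add_sub_cancel]
  split_ifs <;> simp

theorem upper_eq (hk : k + 1 < D.top) (i : ℕ) : D.upper e k i =
    (if k + 1 ∈ D.sel then X * D.quot e (k + 1) else 0) +
      (if k + 1 ∈ D.sel then X else 1) *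
        D.suffix (k + 1) (D.desc k i) (D.upper e (k + 1)) := by
  obtain ⟨n, hn⟩ : ∃ n, D.top - 1 - k = n + 1 := ⟨D.top - 2 - k, by omega⟩
  have h1 : D.top - 1 - (k + 1) = n := by omega
  have h2 : D.top - 1 - n = k + 1 := by omega
  unfold quot upper lower
  rw [hn, h1, pairs, h2]
  simp only [Nat.add_sub_cancel]
  split_ifs <;> simp

theorem hLower_eq (hk : k + 1 < D.top) (i : ℕ) : D.hLower k i =
    (if k + 1 ∈ D.sel then X * D.total (k + 1) (D.hLower (k + 1)) else 0) +
      (if k + 1 ∈ D.sel then 1 - X else 1) *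
        D.suffix (k + 1) (D.desc k i) (D.hLower (k + 1)) := by
  obtain ⟨n, hn⟩ : ∃ n, D.top - 1 - k = n + 1 := ⟨D.top - 2 - k, by omega⟩
  have h1 : D.top - 1 - (k + 1) = n := by omega
  have h2 : D.top - 1 - n = k + 1 := by omega
  unfold hLower
  rw [hn, h1, hFamily, h2]
  simp only [Nat.add_sub_cancel]
  split_ifs <;> simp

theorem pathCount_eq (hk : k + 1 < D.top) (i : ℕ) : D.pathCount k i =
    ∑ j ∈ Finset.range D.bound with D.desc k i < j, D.width (k + 1) j * D.pathCount (k + 1) j := by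
  obtain ⟨n, hn⟩ : ∃ n, D.top - 1 - k = n + 1 := ⟨D.top - 2 - k, by omega⟩
  have h1 : D.top - 1 - (k + 1) = n := by omega
  have h2 : D.top - 1 - n = k + 1 := by omega
  unfold pathCount
  rw [hn, h1, paths, h2]
  simp only [Nat.add_sub_cancel]

/-- The label indices at rank `k` that occur. -/
def support (D : RankParams) (k : ℕ) : Finset ℕ :=
  {i ∈ Finset.range D.bound | D.width k i ≠ 0}

theorem total_eq_support (k : ℕ) (g : ℕ → ℝ[X]) :
    D.total k g = ∑ j ∈ D.support k, C (D.width k j : ℝ) * g j := by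
  rw [total, support, Finset.sum_filter]
  refine Finset.sum_congr rfl fun j _ => ?_
  split_ifs with h
  · simp
  · push Not at h; simp [h]

theorem suffix_eq_support (k m : ℕ) (g : ℕ → ℝ[X]) :
    D.suffix k m g = ∑ j ∈ D.support k with m < j, C (D.width k j : ℝ) * g j := by
  rw [suffix, support, Finset.filter_filter, Finset.sum_filter, Finset.sum_filter]
  refine Finset.sum_congr rfl fun j _ => ?_
  by_cases h : D.width k j = 0
  · simp [h]
  · simp [h]

/-- Mutually reversed polynomials agree at 1, so the division is exact. -/
theorem sub_one_mul_quot {n : ℕ} (h : IsRev n (D.total k (D.lower e k)) (D.total k (D.upper e k))) :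
    (X - 1) * D.quot e k = D.total k (D.upper e k) - D.total k (D.lower e k) := by
  have hroot : (D.total k (D.upper e k) - D.total k (D.lower e k)).IsRoot 1 := by
    rw [IsRoot, eval_sub, h.eval_one, sub_self]
  have := mul_divByMonic_eq_iff_isRoot.2 hroot
  rwa [C_1] at this

end RankParams

/-- Conditions on rank data under which the attached polynomials are real-rooted. -/
structure RankParams.Admissible (D : RankParams) : Prop where
  width_zero : ∀ k, D.width k 0 = 0
  mono : ∀ k i j, D.width k i ≠ 0 → D.width k j ≠ 0 → i ≤ j → D.desc k i ≤ D.desc k j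
  paths_pos : ∀ k < D.top, 0 < ∑ j ∈ Finset.range D.bound, D.width k j * D.pathCount k j

namespace RankParams

variable {D : RankParams} {e k : ℕ}

theorem Admissible.one_le_of_mem_support (hD : D.Admissible) {i : ℕ} (hi : i ∈ D.support k) :
    1 ≤ i := by
  rw [support, Finset.mem_filter] at hi
  rcases i.eq_zero_or_pos with rfl | h
  · exact absurd (hD.width_zero k) hi.2
  · exact h

theorem Admissible.desc_mono (hD : D.Admissible) : ∀ i ∈ D.support k, ∀ j ∈ D.support k,
    i ≤ j → D.desc k i ≤ D.desc k j := by
  intro i hi j hj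
  rw [support, Finset.mem_filter] at hi hj
  exact hD.mono k i j hi.2 hj.2

theorem suffix_pathCount_le {m : ℕ} {g : ℕ → ℝ[X]}
    (h : ∀ i ∈ D.support k, (D.pathCount k i : ℝ) ≤ (g i).eval 1) :
    ((∑ j ∈ Finset.range D.bound with m < j, D.width k j * D.pathCount k j : ℕ) : ℝ)
      ≤ (D.suffix k m g).eval 1 := by
  rw [suffix, eval_finsetSum]
  push_cast
  refine Finset.sum_le_sum fun j hj => ?_
  rw [Finset.mem_filter] at hj
  by_cases hw : D.width k j = 0
  · simp [hw]
  · rw [eval_mul, eval_natCast]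
    exact mul_le_mul_of_nonneg_left (h j (Finset.mem_filter.2 ⟨hj.1, hw⟩)) (Nat.cast_nonneg _)

/-- The value at 1 is at least the number of rising paths to the top, which is positive. -/
theorem Admissible.total_ne_zero (hD : D.Admissible) (hk : k < D.top) {g : ℕ → ℝ[X]}
    (h : ∀ i ∈ D.support k, (D.pathCount k i : ℝ) ≤ (g i).eval 1) : D.total k g ≠ 0 := by
  have h1 : ((∑ j ∈ Finset.range D.bound, D.width k j * D.pathCount k j : ℕ) : ℝ)
      ≤ (D.total k g).eval 1 := by
    rw [total, eval_finsetSum]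
    push_cast
    refine Finset.sum_le_sum fun j hj => ?_
    by_cases hw : D.width k j = 0
    · simp [hw]
    · rw [eval_mul, eval_natCast]
      exact mul_le_mul_of_nonneg_left (h j (Finset.mem_filter.2 ⟨hj, hw⟩)) (Nat.cast_nonneg _)
  have h2 : (0 : ℝ) < ((∑ j ∈ Finset.range D.bound, D.width k j * D.pathCount k j : ℕ) : ℝ) := by
    exact_mod_cast hD.paths_pos k hk
  intro h0
  rw [h0, eval_zero] at h1
  linarith

/-- The degree of symmetry at rank `k`. -/
def symDegree (D : RankParams) (e k : ℕ) : ℕ := e + (D.sel ∩ Finset.Ioo k D.top).card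

theorem symDegree_succ (hk : k + 1 < D.top) :
    D.symDegree e k = D.symDegree e (k + 1) + if k + 1 ∈ D.sel then 1 else 0 := by
  have h : Finset.Ioo k D.top = insert (k + 1) (Finset.Ioo (k + 1) D.top) := by
    ext l; simp only [Finset.mem_Ioo, Finset.mem_insert]; omega
  rw [symDegree, symDegree, h]
  split_ifs with hs
  · rw [Finset.inter_insert_of_mem hs, Finset.card_insert_of_notMem (by simp)]; rfl
  · rw [Finset.inter_insert_of_notMem hs]; rfl

/-- Induction from the top rank downwards: a selected rank acts by the suffix sums shifted by xH, an
unselected one by plain suffix sums. The lower bound at 1 is carried along to keep the totals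
nonzero. -/
theorem Admissible.symInterlacing (hD : D.Admissible) (he : e ≤ 1) (hk : k < D.top) :
    SymInterlacing (D.symDegree e k) (D.support k) (D.lower e k) (D.upper e k) ∧
      ∀ i ∈ D.support k, (D.pathCount k i : ℝ) ≤ (D.lower e k i).eval 1 := by
  obtain ⟨n, hn⟩ : ∃ n, k + 1 + n = D.top := ⟨D.top - (k + 1), by omega⟩
  induction n generalizing k with
  | zero =>
    have hk' : k + 1 = D.top := by omega
    have h1 : D.lower e k = fun _ => 1 := funext fun i => lower_last hk' i
    have h2 : D.upper e k = fun _ => X ^ e := funext fun i => upper_last hk' i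
    have h3 : D.symDegree e k = e := by
      rw [symDegree, ← hk', show Finset.Ioo k (k + 1) = ∅ by ext; simp]; simp
    rw [h1, h2, h3]
    refine ⟨⟨fun _ _ => ?_, fun _ _ => Or.inr ⟨fun z hz => by simp at hz, fun x _ => by simp⟩,
      fun _ _ _ _ _ => Prec.refl 1, fun _ _ _ _ => ?_⟩, fun i _ => ?_⟩
    · intro z _; simp
    -- The relation 1 ≼ x^e needs e ≤ 1.
    · interval_cases e
      · rw [pow_zero]; exact Prec.refl 1
      · simpa using (Prec.refl 1).X_mul
    · rw [pathCount_last hk']; simp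
  | succ n ih =>
    have hk' : k + 1 < D.top := by omega
    obtain ⟨ih₁, ih₂⟩ := ih hk' (by omega)
    have hs := ih₁.C_mul (w := fun i => (D.width (k + 1) i : ℝ)) fun i => Nat.cast_nonneg _
    have hrev : IsRev (D.symDegree e (k + 1)) (D.total (k + 1) (D.lower e (k + 1)))
        (D.total (k + 1) (D.upper e (k + 1))) := by
      rw [total_eq_support, total_eq_support]; exact hs.rev_sum
    have hH := sub_one_mul_quot hrev
    have hne := hD.total_ne_zero hk' ih₂
    rw [total_eq_support, total_eq_support] at hH
    rw [total_eq_support] at hne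
    have hpos : ∀ i ∈ D.support (k + 1), 1 ≤ i := fun i hi => hD.one_le_of_mem_support hi
    have hnn := hs.quotient_nonneg hH
    refine ⟨?_, fun i hi => ?_⟩
    · by_cases hsel : k + 1 ∈ D.sel
      · rw [symDegree_succ hk', if_pos hsel]
        have h1 : D.lower e k = fun i => X * D.quot e (k + 1) + ∑ j ∈ D.support (k + 1) with
            D.desc k i < j, C (D.width (k + 1) j : ℝ) * D.lower e (k + 1) j := funext fun i => by
          rw [lower_eq hk', if_pos hsel, suffix_eq_support]
        have h2 : D.upper e k = fun i => X * D.quot e (k + 1) + X * ∑ j ∈ D.support (k + 1) with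
            D.desc k i < j, C (D.width (k + 1) j : ℝ) * D.upper e (k + 1) j := funext fun i => by
          rw [upper_eq hk', if_pos hsel, if_pos hsel, suffix_eq_support]
        rw [h1, h2]
        -- Monotonicity of the labeling enters here: the suffix sums are interlacing in the cut d,
        -- and d = desc_k(i) is weakly increasing in i.
        exact (hs.quotient_suffix_sums hH hpos hne ((D.support k).image (D.desc k))).comp
          (fun i hi => Finset.mem_image_of_mem _ hi) hD.desc_mono
      · rw [symDegree_succ hk', if_neg hsel, add_zero]
        have h1 : D.lower e k = fun i => ∑ j ∈ D.support (k + 1) with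
            D.desc k i < j, C (D.width (k + 1) j : ℝ) * D.lower e (k + 1) j := funext fun i => by
          rw [lower_eq hk', if_neg hsel, suffix_eq_support, zero_add]
        have h2 : D.upper e k = fun i => ∑ j ∈ D.support (k + 1) with
            D.desc k i < j, C (D.width (k + 1) j : ℝ) * D.upper e (k + 1) j := funext fun i => by
          rw [upper_eq hk', if_neg hsel, if_neg hsel, suffix_eq_support, zero_add, one_mul]
        rw [h1, h2]
        exact (hs.suffix_sums ((D.support k).image (D.desc k))).comp
          (fun i hi => Finset.mem_image_of_mem _ hi) hD.desc_mono
    · rw [pathCount_eq hk' i, lower_eq hk', eval_add]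
      refine (suffix_pathCount_le ih₂).trans (le_add_of_nonneg_left ?_)
      split_ifs
      · simpa using hnn 1 one_pos
      · simp

/-! ### Real-rootedness and interlacing of the totals -/

section Conclusions

variable (hD : D.Admissible) (he : e ≤ 1) (hk : k < D.top)

include hD he hk

theorem Admissible.weighted : SymInterlacing (D.symDegree e k) (D.support k)
    (fun i => C (D.width k i : ℝ) * D.lower e k i)
    (fun i => C (D.width k i : ℝ) * D.upper e k i) :=
  (hD.symInterlacing he hk).1.C_mul fun _ => Nat.cast_nonneg _

theorem Admissible.sub_one_mul_quot :
    (X - 1) * D.quot e k = D.total k (D.upper e k) - D.total k (D.lower e k) := by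
  refine RankParams.sub_one_mul_quot (n := D.symDegree e k) ?_
  rw [total_eq_support, total_eq_support]; exact (hD.weighted he hk).rev_sum

theorem Admissible.total_lower_ne_zero : D.total k (D.lower e k) ≠ 0 :=
  hD.total_ne_zero hk (hD.symInterlacing he hk).2

theorem Admissible.augmented_nonposRooted :
    NonposRooted (X * D.quot e k + D.total k (D.lower e k)) := by
  have hH := hD.sub_one_mul_quot he hk
  have hne := hD.total_lower_ne_zero he hk
  rw [total_eq_support] at hne ⊢
  rw [total_eq_support, total_eq_support] at hH
  exact (hD.weighted he hk).augmented_nonposRooted hH (fun i hi => hD.one_le_of_mem_support hi) hne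

theorem Admissible.X_mul_quot_good : IsGood (X * D.quot e k) := by
  have hH := hD.sub_one_mul_quot he hk
  have hne := hD.total_lower_ne_zero he hk
  rw [total_eq_support] at hne
  rw [total_eq_support, total_eq_support] at hH
  exact (hD.weighted he hk).X_mul_quotient_good hH (fun i hi => hD.one_le_of_mem_support hi) hne

theorem Admissible.augmented_prec :
    Prec (X * D.quot e k + D.total k (D.lower e k)) (X * D.quot e k) := by
  have hH := hD.sub_one_mul_quot he hk
  rw [total_eq_support] at ⊢
  rw [total_eq_support, total_eq_support] at hH
  exact (hD.weighted he hk).augmented_prec_quotient hH (fun i hi => hD.one_le_of_mem_support hi)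

theorem Admissible.quot_nonposRooted (h0 : D.quot e k ≠ 0) : NonposRooted (D.quot e k) := by
  have := (hD.X_mul_quot_good he hk).resolve_left (mul_ne_zero X_ne_zero h0)
  exact NonposRooted.of_linear_mul (θ := 0) (by simpa using this)

theorem Admissible.quot_interlaces (h0 : D.quot e k ≠ 0) :
    Interlaces (D.quot e k) (X * D.quot e k + D.total k (D.lower e k)) :=
  Prec.interlaces (hD.augmented_prec he hk).of_prec_X_mul (hD.quot_nonposRooted he hk h0)
    (hD.augmented_nonposRooted he hk)

end Conclusions

/-- At a selected rank the new polynomial is the suffix sum plus x times the complementary prefix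
sum. Raising the cut moves a middle block G from the suffix to the prefix, that is, replaces G by
xG. -/
theorem Admissible.hLower_interlacing (hD : D.Admissible) (hk : k < D.top) :
    (∀ i ∈ D.support k, IsGood (D.hLower k i)) ∧
      ∀ i ∈ D.support k, ∀ j ∈ D.support k, i ≤ j → Prec (D.hLower k i) (D.hLower k j) := by
  obtain ⟨n, hn⟩ : ∃ n, k + 1 + n = D.top := ⟨D.top - (k + 1), by omega⟩
  induction n generalizing k with
  | zero =>
    have hk' : k + 1 = D.top := by omega
    have h1 : D.hLower k = fun _ => 1 := funext fun i => hLower_last hk' i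
    rw [h1]
    exact ⟨fun _ _ => Or.inr ⟨fun z hz => by simp at hz, fun x _ => by simp⟩,
      fun _ _ _ _ _ => Prec.refl 1⟩
  | succ n ih =>
    have hk' : k + 1 < D.top := by omega
    obtain ⟨ih₁, ih₂⟩ := ih hk' (by omega)
    set s := D.support (k + 1) with hs
    set g : ℕ → ℝ[X] := fun j => C (D.width (k + 1) j : ℝ) * D.hLower (k + 1) j with hg
    have g₁ : ∀ i ∈ s, IsGood (g i) := fun i hi => (ih₁ i hi).C_mul (Nat.cast_nonneg _)
    have g₂ : ∀ i ∈ s, ∀ j ∈ s, i ≤ j → Prec (g i) (g j) := fun i hi j hj hij =>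
      ((ih₂ i hi j hj hij).C_mul_left (Nat.cast_nonneg _)).C_mul_right (Nat.cast_nonneg _)
    have good : ∀ (p : ℕ → Prop) [DecidablePred p], IsGood (∑ i ∈ s with p i, g i) := by
      intro p _
      exact IsGood.sum (fun i hi => g₁ i (Finset.mem_of_mem_filter i hi)) fun i hi j hj =>
        g₂ i (Finset.mem_of_mem_filter i hi) j (Finset.mem_of_mem_filter j hj)
    have prec : ∀ (p q : ℕ → Prop) [DecidablePred p] [DecidablePred q],
        (∀ i j, p i → q j → i ≤ j) → Prec (∑ i ∈ s with p i, g i) (∑ i ∈ s with q i, g i) := by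
      intro p q _ _ hpq
      refine Prec.sum_left fun i hi => Prec.sum_right fun j hj => ?_
      rw [Finset.mem_filter] at hi hj
      exact g₂ i hi.1 j hj.1 (hpq i j hi.2 hj.2)
    have split : ∀ {a b : ℕ}, a ≤ b → ∑ i ∈ s with a < i, g i
        = ∑ i ∈ s with (a < i ∧ i ≤ b), g i + ∑ i ∈ s with b < i, g i := by
      intro a b hab
      rw [← Finset.sum_union]
      · congr 1; ext i; simp only [Finset.mem_filter, Finset.mem_union]; grind
      · rw [Finset.disjoint_filter]; intro i _ hi; omega
    have split' : ∀ {a b : ℕ}, a ≤ b → ∑ i ∈ s with i ≤ b, g i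
        = ∑ i ∈ s with i ≤ a, g i + ∑ i ∈ s with (a < i ∧ i ≤ b), g i := by
      intro a b hab
      rw [← Finset.sum_union]
      · congr 1; ext i; simp only [Finset.mem_filter, Finset.mem_union]; grind
      · rw [Finset.disjoint_filter]; intro i _ hi; omega
    by_cases hsel : k + 1 ∈ D.sel
    · have h1 : ∀ i, D.hLower k i = ∑ j ∈ s with D.desc k i < j, g j +
          X * ∑ j ∈ s with j ≤ D.desc k i, g j := by
        intro i
        rw [hLower_eq hk', if_pos hsel, if_pos hsel, total_eq_support, suffix_eq_support,
          ← Finset.sum_filter_add_sum_filter_not s (fun j => D.desc k i < j)]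
        simp only [not_lt, hg]
        ring
      refine ⟨fun i _ => ?_, fun i hi j hj hij => ?_⟩
      · rw [h1]
        exact IsGood.add (good _) (good _).X_mul (prec _ _ fun a b ha hb => by omega).X_mul
      · have hd := hD.desc_mono i hi j hj hij
        rw [h1, h1, split hd, split' hd]
        set L := ∑ a ∈ s with a ≤ D.desc k i, g a
        set G := ∑ a ∈ s with (D.desc k i < a ∧ a ≤ D.desc k j), g a
        set U := ∑ a ∈ s with D.desc k j < a, g a
        have hLG : Prec L G := prec _ _ fun a b ha hb => by omega
        have hGU : Prec G U := prec _ _ fun a b ha hb => by omega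
        -- The common part U + xL precedes xG and is preceded by G, because L ≼ G ≼ U; also G ≼ xG.
        have e₁ : G + U + X * L = (U + X * L) + G := by ring
        have e₂ : U + X * (L + G) = (U + X * L) + X * G := by ring
        have hLG' : Prec (X * L) (X * G) := hLG.X_mul.X_mul
        rw [e₁, e₂]
        refine Prec.add_left ((Prec.refl _).add_right (hGU.X_mul.add_left hLG'))
          ((hGU.add_right hLG.X_mul).add_right (Prec.refl G).X_mul)
    · have h1 : ∀ i, D.hLower k i = ∑ j ∈ s with D.desc k i < j, g j := by
        intro i
        rw [hLower_eq hk', if_neg hsel, if_neg hsel, suffix_eq_support, zero_add, one_mul]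
      refine ⟨fun i _ => by rw [h1]; exact good _, fun i hi j hj hij => ?_⟩
      rw [h1, h1, split (hD.desc_mono i hi j hj hij)]
      exact (prec _ _ fun a b ha hb => by omega).add_left (Prec.refl _)

theorem Admissible.total_hLower_good (hD : D.Admissible) (hk : k < D.top) :
    IsGood (D.total k (D.hLower k)) := by
  obtain ⟨h₁, h₂⟩ := hD.hLower_interlacing hk
  rw [total_eq_support]
  exact IsGood.sum (fun i hi => (h₁ i hi).C_mul (Nat.cast_nonneg _)) fun i hi j hj hij =>
    ((h₂ i hi j hj hij).C_mul_left (Nat.cast_nonneg _)).C_mul_right (Nat.cast_nonneg _)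

end RankParams

/-! ### Rank-selected posets -/

section RankSelection

theorem posetRank_eq_of_strictMono {Q : Type u} [PartialOrder Q] [Finite Q] {ρ : Q → ℕ}
    (hρ : StrictMono ρ) (h : ∀ x n, ρ x = n + 1 → ∃ y < x, ρ y = n) (x : Q) :
    posetRank x = ρ x := by
  suffices ∀ n x, ρ x = n → Order.height x = n by
    rw [posetRank, this _ x rfl]; rfl
  intro n
  induction n using Nat.strong_induction_on with
  | _ n ih =>
    intro x hx
    rcases n with - | n
    · rw [Nat.cast_zero, Order.height_eq_zero]
      intro y hy
      by_contra hyx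
      have := hρ (lt_of_le_not_ge hy hyx)
      omega
    · push_cast
      rw [Order.height_eq_coe_add_one_iff]
      refine ⟨(height_ne_top_of_finite x).lt_top, ?_, fun y hy => ?_⟩
      · obtain ⟨y, hy, hyn⟩ := h x n hx
        exact ⟨y, hy, ih n (by omega) y hyn⟩
      · have := hρ hy
        rw [ih (ρ y) (by omega) y rfl]
        exact_mod_cast (by omega)

variable {P : Type u} [PartialOrder P] [BoundedOrder P]

theorem exists_le_posetRank_eq [Finite P] (hgr : IsGradedPoset P) (x : P) {m : ℕ}
    (hm : m ≤ posetRank x) : ∃ y ≤ x, posetRank y = m := by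
  induction x using WellFoundedLT.induction with
  | ind x ih =>
    rcases hm.eq_or_lt with rfl | hlt
    · exact ⟨x, le_rfl, rfl⟩
    · have hx : ⊥ < x := bot_lt_iff_ne_bot.2 fun h => by rw [h, posetRank_bot] at hlt; omega
      obtain ⟨y, -, hy⟩ := exists_le_covBy_of_lt hx
      have := hgr y x hy
      obtain ⟨z, hz, hzm⟩ := ih y hy.lt (by omega)
      exact ⟨z, hz.trans hy.le, hzm⟩

theorem exists_ge_posetRank_eq [Finite P] (hgr : IsGradedPoset P) (x : P) {m : ℕ}
    (hm : posetRank x ≤ m) (hm' : m ≤ posetRank (⊤ : P)) : ∃ y, x ≤ y ∧ posetRank y = m := by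
  induction x using WellFoundedGT.induction with
  | ind x ih =>
    rcases hm.eq_or_lt with rfl | hlt
    · exact ⟨x, le_rfl, rfl⟩
    · obtain ⟨y, hy⟩ := exists_covBy_of_ne_top (posetRank_lt_top_iff.1 (hlt.trans_le hm'))
      have := hgr x y hy
      obtain ⟨z, hz, hzm⟩ := ih y hy.lt (by omega)
      exact ⟨z, hy.le.trans hz, hzm⟩

/-- The number of selected ranks (including `0`) below `k`. -/
def selRank (S : Finset ℕ) (k : ℕ) : ℕ := {l ∈ insert 0 S | l < k}.card

theorem selRank_eq_add {S : Finset ℕ} {a b : ℕ} (ha : a ∈ insert 0 S) (hab : a < b) :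
    selRank S b = selRank S a + 1 + (S ∩ Finset.Ioo a b).card := by
  have h : ({l ∈ insert 0 S | l < b} : Finset ℕ) =
      insert a {l ∈ insert 0 S | l < a} ∪ (S ∩ Finset.Ioo a b) := by
    ext l
    simp only [Finset.mem_filter, Finset.mem_insert, Finset.mem_union, Finset.mem_inter,
      Finset.mem_Ioo] at ha ⊢
    grind
  rw [selRank, h, Finset.card_union_of_disjoint, Finset.card_insert_of_notMem (by simp), selRank]
  rw [Finset.disjoint_left]
  intro l
  simp only [Finset.mem_filter, Finset.mem_insert, Finset.mem_inter, Finset.mem_Ioo]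
  grind

/-! ### Ranks in a rank-selected poset and in its dual -/

namespace RankSelected

variable [Fintype P] {S : Finset ℕ}

theorem mem_insert_of_ne_top {x : RankSelected P S} (hx : x ≠ ⊤) :
    posetRank x.1 ∈ insert 0 S := by
  rw [Finset.mem_insert]
  rcases x.2 with h | h | h
  · exact Or.inr h
  · exact Or.inl h
  · refine absurd (Subtype.ext ?_) hx
    by_contra hne
    exact (posetRank_lt_top_iff.2 hne).ne h

theorem selRank_strictMono : StrictMono fun x : RankSelected P S => selRank S (posetRank x.1) := by
  intro x y hxy
  have := selRank_eq_add (mem_insert_of_ne_top hxy.ne_top) (posetRank_strictMono (show x.1 < y.1 from hxy))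
  simp only
  omega

theorem posetRank_eq (hgr : IsGradedPoset P)
    (x : RankSelected P S) : posetRank x = selRank S (posetRank x.1) := by
  refine posetRank_eq_of_strictMono selRank_strictMono (fun x n hx => ?_) x
  -- A predecessor whose rank in P_S is smaller by one lies at the largest selected rank, 0
  -- included, below that of x.
  set F : Finset ℕ := {l ∈ insert 0 S | l < posetRank x.1} with hF
  have hne : F.Nonempty := by
    rw [← Finset.card_pos]; change 0 < selRank S (posetRank x.1); omega
  have hm := Finset.max'_mem F hne
  set m := F.max' hne with hmdef
  have hm' := hm
  rw [hF, Finset.mem_filter] at hm'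
  obtain ⟨y, hy, hym⟩ := exists_le_posetRank_eq hgr x.1 hm'.2.le
  have hys : posetRank y ∈ S ∨ posetRank y = 0 ∨ posetRank y = posetRank (⊤ : P) := by
    rw [hym]
    rcases Finset.mem_insert.1 hm'.1 with h | h
    · exact Or.inr (Or.inl h)
    · exact Or.inl h
  refine ⟨⟨y, hys⟩, lt_of_le_of_ne hy fun h => ?_, ?_⟩
  · have h2 : y = x.1 := congrArg Subtype.val h
    rw [← h2, hym] at hm'
    exact hm'.2.false
  · have h1 := selRank_eq_add hm'.1 hm'.2
    have h2 : S ∩ Finset.Ioo m (posetRank x.1) = ∅ := by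
      ext l
      simp only [Finset.mem_inter, Finset.mem_Ioo, Finset.notMem_empty, iff_false]
      rintro ⟨h3, h4, h5⟩
      have := F.le_max' l (by rw [hF, Finset.mem_filter]; exact ⟨Finset.mem_insert_of_mem h3, h5⟩)
      omega
    rw [h2, Finset.card_empty] at h1
    change selRank S (posetRank y) = n
    change selRank S (posetRank x.1) = n + 1 at hx
    rw [hym]
    omega

theorem posetRank_toDual (hgr : IsGradedPoset P) (hS : ∀ i ∈ S, 1 ≤ i ∧ i < posetRank (⊤ : P))
    (x : RankSelected P S) : posetRank (OrderDual.toDual x) =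
      posetRank (⊤ : RankSelected P S) - posetRank x := by
  refine posetRank_eq_of_strictMono (Q := (RankSelected P S)ᵒᵈ)
    (ρ := fun x => posetRank (⊤ : RankSelected P S) - posetRank (OrderDual.ofDual x))
    (fun a b hab => ?_) (fun a n ha => ?_) (OrderDual.toDual x)
  · have h1 : posetRank (OrderDual.ofDual b) < posetRank (OrderDual.ofDual a) :=
      posetRank_strictMono hab
    have h2 : posetRank (OrderDual.ofDual a) ≤ posetRank (⊤ : RankSelected P S) :=
      posetRank_strictMono.monotone le_top
    simp only
    omega
  · obtain ⟨x, rfl⟩ := OrderDual.toDual.surjective a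
    simp only [OrderDual.ofDual_toDual] at ha
    have hxt : x ≠ ⊤ := by rintro rfl; omega
    have hx := mem_insert_of_ne_top hxt
    have hxt' : posetRank x.1 < posetRank (⊤ : P) :=
      posetRank_lt_top_iff.2 fun h => hxt (Subtype.ext h)
    set F : Finset ℕ := {l ∈ insert (posetRank (⊤ : P)) S | posetRank x.1 < l} with hF
    have hne : F.Nonempty :=
      ⟨_, Finset.mem_filter.2 ⟨Finset.mem_insert_self _ _, hxt'⟩⟩
    have hm := Finset.min'_mem F hne
    set m := F.min' hne with hmdef
    have hm' := hm
    rw [hF, Finset.mem_filter, Finset.mem_insert] at hm'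
    have hmtop : m ≤ posetRank (⊤ : P) := by
      rcases hm'.1 with h | h
      · exact h.le
      · exact (hS m h).2.le
    obtain ⟨y, hy, hym⟩ := exists_ge_posetRank_eq hgr x.1 hm'.2.le hmtop
    have hys : posetRank y ∈ S ∨ posetRank y = 0 ∨ posetRank y = posetRank (⊤ : P) := by
      rw [hym]
      rcases hm'.1 with h | h
      · exact Or.inr (Or.inr h)
      · exact Or.inl h
    obtain ⟨y', hy'⟩ : ∃ y' : RankSelected P S, y'.1 = y := ⟨⟨y, hys⟩, rfl⟩
    have hlt : x < y' := by
      refine lt_of_le_of_ne (hy.trans hy'.ge) fun h => ?_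
      rw [h, hy', hym] at hm'
      exact hm'.2.false
    refine ⟨OrderDual.toDual y', hlt, ?_⟩
    have h1 := selRank_eq_add hx hm'.2
    have h2 : S ∩ Finset.Ioo (posetRank x.1) m = ∅ := by
      ext l
      simp only [Finset.mem_inter, Finset.mem_Ioo, Finset.notMem_empty, iff_false]
      rintro ⟨h3, h4, h5⟩
      have := F.min'_le l (by rw [hF, Finset.mem_filter]; exact ⟨Finset.mem_insert_of_mem h3, h4⟩)
      omega
    rw [h2, Finset.card_empty] at h1
    rw [posetRank_eq hgr x] at ha
    simp only [OrderDual.ofDual_toDual]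
    rw [posetRank_eq hgr y', hy', hym]
    omega

theorem posetRank_sub (hgr : IsGradedPoset P)
    {x y : RankSelected P S} (h : x < y) : posetRank y - posetRank x - 1 =
      (S ∩ Finset.Ioo (posetRank x.1) (posetRank y.1)).card := by
  have := selRank_eq_add (mem_insert_of_ne_top h.ne_top)
    (posetRank_strictMono (show x.1 < y.1 from h))
  rw [posetRank_eq hgr, posetRank_eq hgr]
  omega

open Classical in
-- Elements outside P_S are removed by φ, and the exponent on the left counts the selected ranks
-- strictly between s and t. So a sum over P_S becomes a rank-weighted sum over P, where the
-- labeling lives.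
theorem sum_gt_eq (hgr : IsGradedPoset P)
    (s : RankSelected P S) (y : ℝ[X]) {φ : ℕ → ℝ[X]}
    (hφ : ∀ l, l ∉ S → l ≠ posetRank (⊤ : P) → φ l = 0) :
    ∑ t with s < t, y ^ (posetRank t - posetRank s - 1) * φ (posetRank t.1) =
      ∑ t with s.1 < t, (∏ l ∈ Finset.Ioo (posetRank s.1) (posetRank t),
        if l ∈ S then y else 1) * φ (posetRank t) := by
  have hpow : ∀ a b, (∏ l ∈ Finset.Ioo a b, if l ∈ S then y else 1)
      = y ^ (S ∩ Finset.Ioo a b).card := by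
    intro a b
    rw [Finset.prod_ite, Finset.prod_const_one, mul_one, Finset.prod_const, Finset.inter_comm,
      Finset.filter_mem_eq_inter]
  simp_rw [hpow]
  refine Finset.sum_of_injOn (fun t => t.1) (fun _ _ _ _ h => Subtype.ext h) ?_ ?_ ?_
  · intro t ht
    simp only [Finset.coe_filter, Finset.mem_univ, true_and] at ht ⊢
    exact ht
  · intro t ht hnot
    rw [hφ, mul_zero]
    · intro h
      refine hnot ⟨⟨t, Or.inl h⟩, ?_, rfl⟩
      simp only [Finset.coe_filter, Finset.mem_univ, true_and]
      exact (Finset.mem_filter.1 ht).2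
    · intro h
      refine hnot ⟨⟨t, Or.inr (Or.inr h)⟩, ?_, rfl⟩
      simp only [Finset.coe_filter, Finset.mem_univ, true_and]
      exact (Finset.mem_filter.1 ht).2
  · intro t ht
    rw [posetRank_sub hgr (Finset.mem_filter.1 ht).2]

end RankSelected

/-! ### Sums over a rank-selected poset in terms of rank data -/

variable [Fintype P] {N : ℕ} {w d : ℕ → ℕ → ℕ} {S : Finset ℕ}

theorem IsRankData.admissible (hgr : IsGradedPoset P) (h : IsRankData P N w d) :
    (RankParams.mk (posetRank (⊤ : P)) N w d S).Admissible where
  width_zero := h.width_zero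
  mono := h.mono
  paths_pos k hk := by
    classical
    set D := RankParams.mk (posetRank (⊤ : P)) N w d S with hD
    obtain ⟨s, rfl⟩ := exists_posetRank_eq hgr hk.le
    -- With unit weights and the indicator of the top rank, the sum over t > s is 1: there is
    -- exactly one rising chain from s to the top.
    have hsum := h.sum_eq (fun _ => 1) (fun l => if l = posetRank (⊤ : P) then 1 else 0)
      (fun k i => (D.pathCount k i : ℝ[X]))
      (fun k hk i => by
        simp only [if_pos hk]
        rw [RankParams.pathCount_last hk, Nat.cast_one])
      (fun k hk i => by
        rw [if_neg hk.ne, zero_add, one_mul, RankParams.pathCount_eq hk]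
        push_cast; rfl)
      s (posetRank_lt_top_iff.1 hk)
    rw [Finset.sum_eq_single_of_mem ⊤
      (Finset.mem_filter.2 ⟨Finset.mem_univ _, lt_top_iff_ne_top.2 (posetRank_lt_top_iff.1 hk)⟩)] at hsum
    · rw [Finset.prod_const_one, if_pos rfl, one_mul] at hsum
      have h1 : ((∑ j ∈ Finset.range N, w (posetRank s) j * D.pathCount (posetRank s) j : ℕ) : ℝ[X])
          = ((1 : ℕ) : ℝ[X]) := by
        push_cast; exact hsum.symm
      have h2 := Nat.cast_injective h1
      change 0 < ∑ j ∈ Finset.range N, w (posetRank s) j * D.pathCount (posetRank s) j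
      omega
    · intro t _ hne
      rw [if_neg fun h => hne ?_, mul_zero]
      by_contra h'
      exact (posetRank_lt_top_iff.2 h').ne h

variable (hgr : IsGradedPoset P)
  (h : IsRankData P N w d) {D : RankParams}
  (hD : D = RankParams.mk (posetRank (⊤ : P)) N w d S) {s : RankSelected P S} (hs : s ≠ ⊤)

include hgr h hD hs

open Classical in
-- The weight y of a selected rank will be 1 for the lower family, x for the upper family and 1 - x
-- for chains.
theorem IsRankData.sum_selected_eq (y : ℝ[X]) (φ : ℕ → ℝ[X])
    (E : ℕ → ℕ → ℝ[X]) (hE₀ : ∀ k, k + 1 = D.top → ∀ i, E k i = φ (k + 1))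
    (hE : ∀ k, k + 1 < D.top → ∀ i, E k i = (if k + 1 ∈ D.sel then φ (k + 1) else 0) +
      (if k + 1 ∈ D.sel then y else 1) * D.suffix (k + 1) (D.desc k i) (E (k + 1))) :
    ∑ t with s < t, y ^ (posetRank t - posetRank s - 1) * φ (posetRank t.1) =
      D.total (posetRank s.1) (E (posetRank s.1)) := by
  have hs' : s.1 ≠ ⊤ := fun h => hs (Subtype.ext h)
  have hsum := h.sum_eq (fun l => if l ∈ S then y else 1)
    (fun l => if l ∈ S ∨ l = posetRank (⊤ : P) then φ l else 0) E
    (fun k hk i => by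
      subst hD
      rw [if_pos (Or.inr hk)]; exact hE₀ k hk i)
    (fun k hk i => by
      subst hD
      rw [hE k hk i]
      simp only [hk.ne, or_false]
      rfl) s.1 hs'
  have hsel := RankSelected.sum_gt_eq hgr s y
    (φ := fun l => if l ∈ S ∨ l = posetRank (⊤ : P) then φ l else 0)
    (fun l hl hl' => if_neg (by tauto))
  rw [← hsel] at hsum
  subst hD
  rw [RankParams.total, ← hsum]
  refine Finset.sum_congr rfl fun t ht => ?_
  rw [if_pos]
  rcases t.2 with h | h | h
  · exact Or.inl h
  · exact absurd h (Nat.pos_iff_ne_zero.1 ((Nat.zero_le _).trans_lt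
      (posetRank_strictMono (show s.1 < t.1 from (Finset.mem_filter.1 ht).2))))
  · exact Or.inr h

omit hgr h hs in
theorem RankSelected.posetRank_ne_top_of_ne_top {t : RankSelected P S} (ht : t ≠ ⊤) :
    posetRank t.1 ≠ D.top := by
  subst hD
  exact (posetRank_lt_top_iff.2 fun h => ht (Subtype.ext h)).ne

open Classical in
theorem IsRankData.total_lower_eq (e : ℕ) : D.total (posetRank s.1) (D.lower e (posetRank s.1)) =
    ∑ t with s < t, if t = ⊤ then 1 else X * D.quot e (posetRank t.1) := by
  rw [← h.sum_selected_eq hgr hD hs 1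
    (fun l => if l = D.top then 1 else X * D.quot e l) (D.lower e)
    (fun k hk i => by rw [if_pos hk, RankParams.lower_last hk])
    (fun k hk i => by rw [if_neg hk.ne, RankParams.lower_eq hk, ite_self, one_mul])]
  refine Finset.sum_congr rfl fun t _ => ?_
  rw [one_pow, one_mul]
  by_cases ht : t = ⊤
  · subst ht; rw [if_pos rfl, if_pos (by subst hD; rfl)]
  · rw [if_neg ht, if_neg (RankSelected.posetRank_ne_top_of_ne_top hD ht)]

open Classical in
theorem IsRankData.total_upper_eq (e : ℕ) : D.total (posetRank s.1) (D.upper e (posetRank s.1)) =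
    ∑ t with s < t, X ^ (posetRank t - posetRank s - 1) *
      if t = ⊤ then X ^ e else X * D.quot e (posetRank t.1) := by
  rw [← h.sum_selected_eq hgr hD hs X
    (fun l => if l = D.top then X ^ e else X * D.quot e l) (D.upper e)
    (fun k hk i => by rw [if_pos hk, RankParams.upper_last hk])
    (fun k hk i => by rw [if_neg hk.ne, RankParams.upper_eq hk])]
  refine Finset.sum_congr rfl fun t _ => ?_
  by_cases ht : t = ⊤
  · subst ht; rw [if_pos rfl, if_pos (by subst hD; rfl)]
  · rw [if_neg ht, if_neg (RankSelected.posetRank_ne_top_of_ne_top hD ht)]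

open Classical in
theorem IsRankData.total_hLower_eq : D.total (posetRank s.1) (D.hLower (posetRank s.1)) =
    ∑ t with s < t, (1 - X) ^ (posetRank t - posetRank s - 1) *
      if t = ⊤ then 1 else X * D.total (posetRank t.1) (D.hLower (posetRank t.1)) := by
  rw [← h.sum_selected_eq hgr hD hs (1 - X)
    (fun l => if l = D.top then 1 else X * D.total l (D.hLower l)) D.hLower
    (fun k hk i => by rw [if_pos hk, RankParams.hLower_last hk])
    (fun k hk i => by rw [if_neg hk.ne, RankParams.hLower_eq hk])]
  refine Finset.sum_congr rfl fun t _ => ?_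
  by_cases ht : t = ⊤
  · subst ht; rw [if_pos rfl, if_pos (by subst hD; rfl)]
  · rw [if_neg ht, if_neg (RankSelected.posetRank_ne_top_of_ne_top hD ht)]

end RankSelection

/-! ### Recursions for Chow polynomials -/

section Mobius

variable {Q : Type u} [PartialOrder Q] [Fintype Q]

open Classical in
theorem sum_mobiusFun_left (a b : Q) :
    ∑ x with a ≤ x ∧ x ≤ b, mobiusFun x b = if a = b then 1 else 0 := by
  let _ : LocallyFiniteOrder Q := Fintype.toLocallyFiniteOrder
  rw [← IncidenceAlgebra.sum_Icc_mu_left (𝕜 := ℤ) a b]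
  refine Finset.sum_congr ?_ fun x _ => rfl
  ext x; simp

open Classical in
theorem sum_mobiusFun_right (a b : Q) :
    ∑ x with a ≤ x ∧ x ≤ b, mobiusFun a x = if a = b then 1 else 0 := by
  let _ : LocallyFiniteOrder Q := Fintype.toLocallyFiniteOrder
  rw [← IncidenceAlgebra.sum_Icc_mu_right (𝕜 := ℤ) a b]
  refine Finset.sum_congr ?_ fun x _ => rfl
  ext x; simp

theorem sub_one_mul_reducedCharPoly {s t : Q} (h : s < t) :
    (X - 1) * reducedCharPoly s t = intervalCharPoly s t := by
  classical
  have hroot : (intervalCharPoly s t).IsRoot 1 := by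
    have := sum_mobiusFun_right s t
    rw [if_neg h.ne] at this
    rw [IsRoot, intervalCharPoly, eval_finsetSum]
    simp only [eval_mul, eval_C, eval_pow, eval_X, one_pow, mul_one]
    rw [← Int.cast_sum]
    convert congrArg (Int.cast : ℤ → ℝ) this
    simp
  have := mul_divByMonic_eq_iff_isRoot.2 hroot
  rwa [C_1] at this

theorem mobiusFun_self (s : Q) : mobiusFun s s = 1 := by
  classical
  have := sum_mobiusFun_right s s
  rwa [if_pos rfl, Finset.sum_eq_single_of_mem s (by simp)] at this
  intro b hb hne
  rw [Finset.mem_filter] at hb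
  exact absurd (le_antisymm hb.2.2 hb.2.1) hne

theorem intervalCharPoly_self (s : Q) : intervalCharPoly s s = 1 := by
  classical
  rw [intervalCharPoly, Finset.sum_eq_single_of_mem s (by simp), mobiusFun_self]
  · simp
  · intro b hb hne
    rw [Finset.mem_filter] at hb
    exact absurd (le_antisymm hb.2.2 hb.2.1) hne

open Classical in
theorem sum_ge_eq_add {A : Type*} [AddCommMonoid A] (s : Q) (F : Q → A) :
    ∑ t with s ≤ t, F t = F s + ∑ t with s < t, F t := by
  have h : Finset.univ.filter (s ≤ ·) = insert s (Finset.univ.filter (s < ·)) := by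
    ext t; simp [le_iff_eq_or_lt, eq_comm]
  rw [h, Finset.sum_insert (by simp)]

variable [OrderTop Q]

theorem chowUpper_top : chowUpper (⊤ : Q) = 1 := by
  rw [chowUpper, if_pos rfl]

open Classical in
theorem chowUpper_of_ne_top {s : Q} (hs : s ≠ ⊤) :
    chowUpper s = ∑ t with s < t, reducedCharPoly s t * chowUpper t := by
  rw [chowUpper, if_neg hs, Finset.sum_subtype (Finset.univ.filter (s < ·)) (p := fun t => s < t)
    (by simp)]

open Classical in
theorem sum_ge_intervalCharPoly_mul_chowUpper (s : Q) :
    ∑ t with s ≤ t, intervalCharPoly s t * chowUpper t =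
      X * chowUpper s + if s = ⊤ then 1 - X else 0 := by
  rw [sum_ge_eq_add, intervalCharPoly_self, one_mul]
  by_cases hs : s = ⊤
  · subst hs
    rw [if_pos rfl, Finset.filter_false_of_mem fun t _ => not_top_lt, Finset.sum_empty,
      chowUpper_top]
    ring
  · have h : ∑ t with s < t, intervalCharPoly s t * chowUpper t = (X - 1) * chowUpper s := by
      rw [chowUpper_of_ne_top hs, Finset.mul_sum]
      refine Finset.sum_congr rfl fun t ht => ?_
      rw [← sub_one_mul_reducedCharPoly (Finset.mem_filter.1 ht).2, mul_assoc]
    rw [h, if_neg hs]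
    ring

open Classical in
-- The defining recursion times x - 1, with the term t = s added, has on its left the Möbius
-- transform of these weighted sums. Summing over s ≥ a inverts the transform and removes the Möbius
-- function.
theorem sum_ge_pow_mul_chowUpper (a : Q) :
    ∑ t with a ≤ t, X ^ (posetRank t - posetRank a) * chowUpper t =
      X * ∑ t with a ≤ t, chowUpper t + (1 - X) := by
  set A : Q → ℝ[X] := fun w => ∑ t with w ≤ t, X ^ (posetRank t - posetRank w) * chowUpper t
    with hA
  have hchar : ∀ s : Q, ∑ t with s ≤ t, intervalCharPoly s t * chowUpper t
      = ∑ w with s ≤ w, C (mobiusFun s w : ℝ) * A w := by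
    intro s
    simp only [hA, intervalCharPoly, Finset.sum_mul, Finset.mul_sum]
    rw [Finset.sum_comm' (t' := {w | s ≤ w}) (s' := fun w => {t | w ≤ t})]
    · refine Finset.sum_congr rfl fun w _ => Finset.sum_congr rfl fun t _ => by ring
    · intro t w
      simp only [Finset.mem_filter, Finset.mem_univ, true_and]
      exact ⟨fun h => ⟨h.2.2, h.2.1⟩, fun h => ⟨h.2.trans h.1, h.2, h.1⟩⟩
  have hinv : ∑ s with a ≤ s, ∑ w with s ≤ w, C (mobiusFun s w : ℝ) * A w = A a := by
    rw [Finset.sum_comm' (t' := {w | a ≤ w}) (s' := fun w => {s | a ≤ s ∧ s ≤ w})]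
    · have : ∀ w, ∑ s with a ≤ s ∧ s ≤ w, C (mobiusFun s w : ℝ) * A w
          = if a = w then A w else 0 := by
        intro w
        rw [← Finset.sum_mul, ← map_sum, ← Int.cast_sum, sum_mobiusFun_left]
        split_ifs <;> simp
      simp_rw [this]
      rw [Finset.sum_ite_eq, if_pos (by simp)]
    · intro s w
      simp only [Finset.mem_filter, Finset.mem_univ, true_and]
      exact ⟨fun h => ⟨⟨h.1, h.2⟩, h.1.trans h.2⟩, fun h => ⟨h.1.1, h.1.2⟩⟩
  change A a = _
  rw [← hinv]
  simp_rw [← hchar, sum_ge_intervalCharPoly_mul_chowUpper]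
  rw [Finset.sum_add_distrib, ← Finset.mul_sum, Finset.sum_ite_eq', if_pos (by simp)]

open Classical in
/-- The system of equations satisfied by the Chow polynomials of upper intervals determines
them. -/
theorem chowUpper_unique {K : Q → ℝ[X]}
    (hK : ∀ a, ∑ t with a ≤ t, X ^ (posetRank t - posetRank a) * K t =
      X * ∑ t with a ≤ t, K t + (1 - X)) (a : Q) : K a = chowUpper a := by
  induction a using WellFoundedGT.induction with
  | ind a ih =>
    have h1 := hK a
    have h2 := sum_ge_pow_mul_chowUpper a
    rw [sum_ge_eq_add, sum_ge_eq_add, Nat.sub_self, pow_zero, one_mul] at h1 h2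
    have e1 : ∑ t with a < t, X ^ (posetRank t - posetRank a) * K t
        = ∑ t with a < t, X ^ (posetRank t - posetRank a) * chowUpper t :=
      Finset.sum_congr rfl fun t ht => by rw [ih t (Finset.mem_filter.1 ht).2]
    have e2 : ∑ t with a < t, K t = ∑ t with a < t, chowUpper t :=
      Finset.sum_congr rfl fun t ht => ih t (Finset.mem_filter.1 ht).2
    rw [e1, e2] at h1
    have hX : (X - 1 : ℝ[X]) ≠ 0 := by simpa using X_sub_C_ne_zero (1 : ℝ)
    refine mul_left_cancel₀ hX ?_
    linear_combination h2 - h1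

end Mobius

/-! ### Augmented and dual Chow polynomials -/

section Duality

variable {Q : Type u} [PartialOrder Q] [BoundedOrder Q] [Fintype Q]

theorem augChowPoly_eq : augChowPoly Q = X * ∑ t : Q, chowUpper t + (1 - X) := by
  classical
  have := sum_ge_pow_mul_chowUpper (⊥ : Q)
  simpa [posetRank_bot, augChowPoly] using this

open Classical in
/-- The Chow polynomial of the dual poset through a solution of the transposed system. -/
theorem chowPoly_dual_eq {Γ : Q → ℝ[X]}
    (hrank : ∀ x : Q, posetRank (OrderDual.toDual x) = posetRank (⊤ : Q) - posetRank x)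
    (hΓ : ∀ a : Q, ∑ t with a ≤ t, X ^ (posetRank t - posetRank a) * Γ t =
      X * ∑ t with a ≤ t, Γ t + if a = ⊤ then 1 - X else 0) :
    chowPoly Qᵒᵈ = ∑ t, Γ t := by
  set K : Q → ℝ[X] := fun x => chowUpper (OrderDual.toDual x) with hK
  have hKeq : ∀ a : Q, ∑ t with t ≤ a, X ^ (posetRank a - posetRank t) * K t =
      X * ∑ t with t ≤ a, K t + (1 - X) := by
    intro a
    have h := sum_ge_pow_mul_chowUpper (OrderDual.toDual a)
    have htr : ∀ F : Q → ℝ[X], ∑ t : Qᵒᵈ with OrderDual.toDual a ≤ t, F (OrderDual.ofDual t)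
        = ∑ t with t ≤ a, F t := by
      intro F
      rw [Finset.sum_filter, Finset.sum_filter]
      exact Fintype.sum_equiv OrderDual.ofDual _ _ fun x => by rfl
    rw [← htr, ← htr]
    refine (Finset.sum_congr rfl fun t ht => ?_).trans h
    obtain ⟨t, rfl⟩ := OrderDual.toDual.surjective t
    have h1 : t ≤ a := (Finset.mem_filter.1 ht).2
    have h2 := posetRank_strictMono.monotone h1
    have h3 := posetRank_strictMono.monotone (le_top (a := a))
    rw [hrank, hrank]
    simp only [OrderDual.ofDual_toDual, hK]
    congr 2
    omega
  have hX : (1 - X : ℝ[X]) ≠ 0 := by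
    rw [← neg_sub, neg_ne_zero]; simpa using X_sub_C_ne_zero (1 : ℝ)
  have hswap : ∀ F : Q → Q → ℝ[X], ∑ t, ∑ u with t ≤ u, F t u = ∑ u, ∑ t with t ≤ u, F t u := by
    intro F
    exact Finset.sum_comm' (by simp)
  -- Let M be the upper triangular matrix with entries x^(rk u - rk t) - x for t ≤ u. Then MΓ is 1 -
  -- x times the unit vector at the top, and M transposed maps K to 1 - x times the all-ones vector;
  -- evaluate K M Γ in both ways.
  have h1 : ∑ t, K t * (∑ u with t ≤ u, (X ^ (posetRank u - posetRank t) - X) * Γ u)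
      = (1 - X) * K ⊤ := by
    have : ∀ t, ∑ u with t ≤ u, (X ^ (posetRank u - posetRank t) - X) * Γ u
        = if t = ⊤ then 1 - X else 0 := by
      intro t
      simp only [sub_mul, Finset.sum_sub_distrib]
      rw [hΓ, ← Finset.mul_sum]; ring
    simp_rw [this, mul_ite, mul_zero]
    rw [Finset.sum_ite_eq', if_pos (Finset.mem_univ _), mul_comm]
  have h2 : ∑ u, Γ u * (∑ t with t ≤ u, (X ^ (posetRank u - posetRank t) - X) * K t)
      = (1 - X) * ∑ u, Γ u := by
    have : ∀ u, ∑ t with t ≤ u, (X ^ (posetRank u - posetRank t) - X) * K t = 1 - X := by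
      intro t
      simp only [sub_mul, Finset.sum_sub_distrib]
      rw [hKeq, ← Finset.mul_sum]; ring
    simp_rw [this, ← Finset.sum_mul, mul_comm]
  have h3 : ∑ t, K t * (∑ u with t ≤ u, (X ^ (posetRank u - posetRank t) - X) * Γ u) =
      ∑ u, Γ u * (∑ t with t ≤ u, (X ^ (posetRank u - posetRank t) - X) * K t) := by
    simp_rw [Finset.mul_sum]
    rw [hswap]
    exact Finset.sum_congr rfl fun u _ => Finset.sum_congr rfl fun t _ => by ring
  refine mul_left_cancel₀ hX ?_
  rw [← h2, ← h3, h1]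
  rfl

end Duality

/-! ### Chow polynomials of rank-selected posets -/

section RankSelectedChow

variable {P : Type u} [PartialOrder P] [BoundedOrder P] [Fintype P] {N : ℕ} {w d : ℕ → ℕ → ℕ}
  {S : Finset ℕ} {D : RankParams}

open Classical in
/-- The polynomial at an element of a rank-selected poset read off from rank data. -/
noncomputable def selPoly (D : RankParams) (c : ℝ[X]) (e : ℕ) (s : RankSelected P S) : ℝ[X] :=
  if s = ⊤ then 1 else c * D.quot e (posetRank s.1)

theorem posetRank_lt_of_ne_top {s : RankSelected P S} (hs : s ≠ ⊤) :
    posetRank s.1 < posetRank (⊤ : P) :=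
  posetRank_lt_top_iff.2 fun h => hs (Subtype.ext h)

variable (hgr : IsGradedPoset P) (h : IsRankData P N w d)
  (hD : D = RankParams.mk (posetRank (⊤ : P)) N w d S)

include hgr h hD

theorem IsRankData.sub_one_mul_quot {e : ℕ} (he : e ≤ 1) {s : RankSelected P S} (hs : s ≠ ⊤) :
    (X - 1) * D.quot e (posetRank s.1) = D.total (posetRank s.1) (D.upper e (posetRank s.1)) -
      D.total (posetRank s.1) (D.lower e (posetRank s.1)) := by
  have hadm : D.Admissible := by rw [hD]; exact h.admissible hgr
  exact hadm.sub_one_mul_quot he (by rw [hD]; exact posetRank_lt_of_ne_top hs)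

open Classical in
theorem IsRankData.chow_lower_eq {s : RankSelected P S} (hs : s ≠ ⊤) :
    D.total (posetRank s.1) (D.lower 1 (posetRank s.1)) =
      X * ∑ t with s < t, selPoly D 1 1 t + (1 - X) := by
  rw [h.total_lower_eq hgr hD hs, Finset.mul_sum]
  have hmem : ⊤ ∈ Finset.univ.filter (s < ·) := by simpa using lt_top_iff_ne_top.2 hs
  rw [← Finset.add_sum_erase _ _ hmem, ← Finset.add_sum_erase _ _ hmem, if_pos rfl, selPoly,
    if_pos rfl]
  rw [Finset.sum_congr rfl fun t ht => ?_]
  · ring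
  · rw [selPoly, if_neg (Finset.ne_of_mem_erase ht), if_neg (Finset.ne_of_mem_erase ht), one_mul]

open Classical in
theorem IsRankData.chow_upper_eq {s : RankSelected P S} (hs : s ≠ ⊤) :
    D.total (posetRank s.1) (D.upper 1 (posetRank s.1)) =
      ∑ t with s < t, X ^ (posetRank t - posetRank s) * selPoly D 1 1 t := by
  rw [h.total_upper_eq hgr hD hs]
  refine Finset.sum_congr rfl fun t ht => ?_
  have hlt := posetRank_strictMono (Finset.mem_filter.1 ht).2
  obtain ⟨m, hm⟩ := Nat.exists_eq_add_of_lt hlt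
  rw [show posetRank t - posetRank s - 1 = m by omega,
    show posetRank t - posetRank s = m + 1 by omega, selPoly, pow_succ]
  split_ifs <;> ring

theorem IsRankData.chowUpper_eq (s : RankSelected P S) : chowUpper s = selPoly D 1 1 s := by
  classical
  refine (chowUpper_unique (K := selPoly D 1 1) (fun a => ?_) s).symm
  rw [sum_ge_eq_add, sum_ge_eq_add, Nat.sub_self, pow_zero, one_mul]
  by_cases ha : a = ⊤
  · subst ha
    rw [Finset.filter_false_of_mem fun t _ => not_top_lt, Finset.sum_empty, Finset.sum_empty,
      selPoly, if_pos rfl]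
    ring
  · have hq := h.sub_one_mul_quot hgr hD le_rfl ha
    rw [h.chow_lower_eq hgr hD ha, h.chow_upper_eq hgr hD ha] at hq
    have : selPoly D 1 1 a = D.quot 1 (posetRank a.1) := by rw [selPoly, if_neg ha, one_mul]
    rw [this]
    linear_combination -hq

variable (hbot : (⊥ : RankSelected P S) ≠ ⊤)

include hbot

theorem IsRankData.chowPoly_eq : chowPoly (RankSelected P S) = D.quot 1 0 := by
  rw [chowPoly, h.chowUpper_eq hgr hD, selPoly, if_neg hbot, one_mul]
  exact congrArg _ posetRank_bot

theorem IsRankData.augChowPoly_eq : augChowPoly (RankSelected P S) =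
    X * D.quot 1 0 + D.total 0 (D.lower 1 0) := by
  classical
  have h0 : posetRank (⊥ : RankSelected P S).1 = 0 := posetRank_bot
  have hl := h.chow_lower_eq hgr hD hbot
  rw [h0] at hl
  have hsum := sum_ge_eq_add (⊥ : RankSelected P S) (selPoly D 1 1)
  rw [Finset.filter_true_of_mem fun t _ => bot_le] at hsum
  rw [_root_.augChowPoly_eq, hl, Finset.sum_congr rfl fun t _ => h.chowUpper_eq hgr hD t, hsum,
    selPoly, if_neg hbot, one_mul, h0]
  ring

/-- Its constant term is nonzero: at 0 every term of the upper sum carries a positive power of x,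
while the lower sum takes the value 1. -/
theorem IsRankData.quot_one_zero_ne_zero : D.quot 1 0 ≠ 0 := by
  classical
  have h0 : posetRank (⊥ : RankSelected P S).1 = 0 := posetRank_bot
  have hq := h.sub_one_mul_quot hgr hD le_rfl hbot
  rw [h.chow_lower_eq hgr hD hbot, h.chow_upper_eq hgr hD hbot, h0] at hq
  intro hzero
  have := congrArg (eval 0) hq
  rw [hzero, mul_zero, eval_zero, eval_sub, eval_finsetSum, Finset.sum_eq_zero] at this
  · simp at this
  · intro t ht
    have hlt := posetRank_strictMono (Finset.mem_filter.1 ht).2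
    rw [eval_mul, eval_pow, eval_X, zero_pow (by omega), zero_mul]

/-- The recursion with e = 0 solves the transposed system: Γ is 1 at the top and x times the
quotient elsewhere. The dual Chow polynomial is the sum of Γ, whose bottom term is xH and whose
other terms form the lower total. -/
theorem IsRankData.chowPoly_dual_eq (hS : ∀ i ∈ S, 1 ≤ i ∧ i < posetRank (⊤ : P)) :
    chowPoly (RankSelected P S)ᵒᵈ = X * D.quot 0 0 + D.total 0 (D.lower 0 0) := by
  classical
  have h0 : posetRank (⊥ : RankSelected P S).1 = 0 := posetRank_bot
  have hlow : ∀ s : RankSelected P S, s ≠ ⊤ →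
      D.total (posetRank s.1) (D.lower 0 (posetRank s.1)) = ∑ t with s < t, selPoly D X 0 t :=
    fun s hs => h.total_lower_eq hgr hD hs 0
  rw [_root_.chowPoly_dual_eq (Γ := selPoly D X 0)
    (RankSelected.posetRank_toDual hgr hS) fun a => ?_]
  · have hsum := sum_ge_eq_add (⊥ : RankSelected P S) (selPoly D X 0)
    rw [Finset.filter_true_of_mem fun t _ => bot_le] at hsum
    have hl := hlow ⊥ hbot
    rw [h0] at hl
    rw [hsum, hl, selPoly, if_neg hbot, h0]
  · rw [sum_ge_eq_add, sum_ge_eq_add, Nat.sub_self, pow_zero, one_mul]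
    by_cases ha : a = ⊤
    · subst ha
      rw [Finset.filter_false_of_mem fun t _ => not_top_lt, Finset.sum_empty, Finset.sum_empty,
        selPoly, if_pos rfl, if_pos rfl]
      ring
    · have hq := h.sub_one_mul_quot hgr hD zero_le_one ha
      have hup : ∑ t with a < t, X ^ (posetRank t - posetRank a) * selPoly D X 0 t
          = X * D.total (posetRank a.1) (D.upper 0 (posetRank a.1)) := by
        rw [h.total_upper_eq hgr hD ha, Finset.mul_sum]
        refine Finset.sum_congr rfl fun t ht => ?_
        have hlt := posetRank_strictMono (Finset.mem_filter.1 ht).2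
        obtain ⟨m, hm⟩ := Nat.exists_eq_add_of_lt hlt
        rw [show posetRank t - posetRank a - 1 = m by omega,
          show posetRank t - posetRank a = m + 1 by omega, selPoly, pow_succ, pow_zero]
        ring
      have : selPoly D X 0 a = X * D.quot 0 (posetRank a.1) := by rw [selPoly, if_neg ha]
      rw [hup, if_neg ha, this, ← hlow a ha]
      linear_combination (-X) * hq

end RankSelectedChow

/-! ### The `h`-polynomial of an order complex -/

section OrderComplex

theorem hPoly_eq_sum {ι : Type u} [Fintype ι] [DecidableEq ι] (Δ : AbstractSimplicialComplex ι)
    [DecidablePred fun c : Finset ι => c = ∅ ∨ c ∈ Δ] :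
    hPoly Δ = ∑ c : Finset ι with c = ∅ ∨ c ∈ Δ,
      X ^ c.card * (1 - X) ^ (maxFaceCard Δ - c.card) := by
  classical
  have hmaps : ∀ c ∈ ({c : Finset ι | c = ∅ ∨ c ∈ Δ} : Finset (Finset ι)),
      c.card ∈ Finset.range (maxFaceCard Δ + 1) := by
    intro c hc
    rw [Finset.mem_range, Nat.lt_succ_iff]
    rcases (Finset.mem_filter.1 hc).2 with rfl | h
    · simp
    · exact Finset.le_sup (f := Finset.card) (by simpa using h)
  rw [hPoly, ← Finset.sum_fiberwise_of_maps_to hmaps]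
  refine Finset.sum_congr rfl fun i _ => ?_
  rw [Finset.sum_congr rfl (g := fun _ => X ^ i * (1 - X) ^ (maxFaceCard Δ - i)) fun c hc => by
    rw [(Finset.mem_filter.1 hc).2], Finset.sum_const, Finset.filter_filter, nsmul_eq_mul,
    faceNumber, map_natCast, mul_assoc]
  congr!

variable {Q : Type u} [PartialOrder Q] [Fintype Q]

open Classical in
/-- The chains all of whose elements are larger than `s`. -/
noncomputable def chainsAbove (s : Q) : Finset (Finset Q) :=
  {c | IsChain (· ≤ ·) (c : Set Q) ∧ ∀ x ∈ c, s < x}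

theorem mem_chainsAbove {s : Q} {c : Finset Q} :
    c ∈ chainsAbove s ↔ IsChain (· ≤ ·) (c : Set Q) ∧ ∀ x ∈ c, s < x := by
  simp [chainsAbove]

theorem injOn_posetRank {c : Finset Q} (hc : IsChain (· ≤ ·) (c : Set Q)) :
    Set.InjOn posetRank (c : Set Q) := by
  intro x hx y hy hxy
  by_contra hne
  rcases hc hx hy hne with h | h
  · exact (posetRank_strictMono (lt_of_le_of_ne h hne)).ne hxy
  · exact (posetRank_strictMono (lt_of_le_of_ne' h hne)).ne' hxy

theorem card_le_of_mem_chainsAbove [OrderTop Q] {s : Q} {c : Finset Q} (hc : c ∈ chainsAbove s) :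
    c.card ≤ posetRank (⊤ : Q) - posetRank s := by
  rw [mem_chainsAbove] at hc
  rw [← Nat.card_Ioc]
  refine Finset.card_le_card_of_injOn posetRank (fun x hx => ?_) (injOn_posetRank hc.1)
  rw [Finset.coe_Ioc]
  exact ⟨posetRank_strictMono (hc.2 x hx), posetRank_strictMono.monotone le_top⟩

theorem insert_isChain {s : Q} {c : Finset Q} [DecidableEq Q] (hc : c ∈ chainsAbove s) :
    IsChain (· ≤ ·) ((insert s c : Finset Q) : Set Q) := by
  rw [mem_chainsAbove] at hc
  rw [Finset.coe_insert]
  exact hc.1.insert fun b hb _ => Or.inl (hc.2 b hb).le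

theorem notMem_of_mem_chainsAbove {s : Q} {c : Finset Q} (hc : c ∈ chainsAbove s) : s ∉ c :=
  fun h => ((mem_chainsAbove.1 hc).2 s h).false

theorem erase_mem_chainsAbove {s : Q} {c : Finset Q} [DecidableEq Q]
    (hc : IsChain (· ≤ ·) (c : Set Q)) (hs : Minimal (· ∈ c) s) : c.erase s ∈ chainsAbove s := by
  rw [mem_chainsAbove]
  refine ⟨hc.mono (by simp), fun x hx => ?_⟩
  rw [Finset.mem_erase] at hx
  refine lt_of_le_of_ne' ?_ hx.1
  rcases hc hx.2 hs.1 hx.1 with h | h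
  · exact hs.2 hx.2 h
  · exact h

open Classical in
theorem chainsAbove_eq (s : Q) : chainsAbove s = insert ∅
    ((Finset.univ.filter (s < ·)).biUnion fun t => (chainsAbove t).image (insert t)) := by
  ext c
  simp only [Finset.mem_insert, Finset.mem_biUnion, Finset.mem_filter, Finset.mem_univ, true_and,
    Finset.mem_image]
  constructor
  · intro hc
    rcases c.eq_empty_or_nonempty with rfl | hne
    · exact Or.inl rfl
    · obtain ⟨t, ht⟩ := Finset.exists_minimal hne
      have hc' := mem_chainsAbove.1 hc
      exact Or.inr ⟨t, hc'.2 t ht.1, c.erase t, erase_mem_chainsAbove hc'.1 ht,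
        Finset.insert_erase ht.1⟩
  · rintro (rfl | ⟨t, ht, c, hc, rfl⟩)
    · simp [mem_chainsAbove]
    · refine mem_chainsAbove.2 ⟨insert_isChain hc, fun x hx => ?_⟩
      rcases Finset.mem_insert.1 hx with rfl | hx
      · exact ht
      · exact ht.trans ((mem_chainsAbove.1 hc).2 x hx)

theorem injOn_insert_chainsAbove [DecidableEq Q] (t : Q) :
    Set.InjOn (insert t) (chainsAbove t : Set (Finset Q)) := by
  intro c hc c' hc' h
  rw [← Finset.erase_insert (notMem_of_mem_chainsAbove hc), h,
    Finset.erase_insert (notMem_of_mem_chainsAbove hc')]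

open Classical in
-- A nonempty chain is uniquely its least element t together with a chain above t.
theorem sum_chainsAbove {A : Type*} [AddCommMonoid A] (s : Q) (F : Finset Q → A) :
    ∑ c ∈ chainsAbove s, F c = F ∅ + ∑ t with s < t, ∑ c ∈ chainsAbove t, F (insert t c) := by
  rw [chainsAbove_eq, Finset.sum_insert, Finset.sum_biUnion]
  · congr 1
    exact Finset.sum_congr rfl fun t _ => Finset.sum_image (injOn_insert_chainsAbove t)
  · intro t _ t' _ hne
    rw [Function.onFun, Finset.disjoint_left]
    intro a ha ha'
    obtain ⟨c, hc, rfl⟩ := Finset.mem_image.1 ha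
    obtain ⟨c', hc', heq⟩ := Finset.mem_image.1 ha'
    have key : ∀ {x y : Q} {c c' : Finset Q}, c' ∈ chainsAbove y → insert y c' = insert x c →
        y ≤ x := by
      intro x y c c' hc' heq
      have : x ∈ insert y c' := heq ▸ Finset.mem_insert_self x c
      rcases Finset.mem_insert.1 this with rfl | h
      · exact le_rfl
      · exact ((mem_chainsAbove.1 hc').2 x h).le
    exact hne (le_antisymm (key hc heq.symm) (key hc' heq))
  · simp

variable [BoundedOrder Q]

/-- The sum of `x ^ |c| (1 - x) ^ (rk ⊤ - rk s - |c|)` over the chains `c` above `s`. -/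
noncomputable def chainPoly (s : Q) : ℝ[X] :=
  ∑ c ∈ chainsAbove s, X ^ c.card * (1 - X) ^ (posetRank (⊤ : Q) - posetRank s - c.card)

open Classical in
theorem chainPoly_eq (s : Q) : chainPoly s = (1 - X) ^ (posetRank (⊤ : Q) - posetRank s) +
    ∑ t with s < t, X * (1 - X) ^ (posetRank t - posetRank s - 1) * chainPoly t := by
  rw [chainPoly, sum_chainsAbove]
  simp only [Finset.card_empty, pow_zero, one_mul, Nat.sub_zero]
  congr 1
  refine Finset.sum_congr rfl fun t ht => ?_
  rw [chainPoly, Finset.mul_sum]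
  refine Finset.sum_congr rfl fun c hc => ?_
  have h1 := card_le_of_mem_chainsAbove hc
  have h2 := posetRank_strictMono (Finset.mem_filter.1 ht).2
  have h3 : posetRank t ≤ posetRank (⊤ : Q) := posetRank_strictMono.monotone le_top
  rw [Finset.card_insert_of_notMem (notMem_of_mem_chainsAbove hc),
    show posetRank (⊤ : Q) - posetRank s - (c.card + 1) =
      (posetRank t - posetRank s - 1) + (posetRank (⊤ : Q) - posetRank t - c.card) by omega,
    pow_add, pow_add]
  ring

theorem chainPoly_top : chainPoly (⊤ : Q) = 1 := by
  classical
  rw [chainPoly_eq, Finset.filter_false_of_mem fun t _ => not_top_lt]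
  simp

theorem maxFaceCard_orderComplex : maxFaceCard (orderComplex Q) = posetRank (⊤ : Q) + 1 := by
  classical
  refine le_antisymm (Finset.sup_le fun c hc => ?_) ?_
  · have hc' : IsChain (· ≤ ·) (c : Set Q) := (Finset.mem_filter.1 hc).2.2
    rw [← Finset.card_range (posetRank (⊤ : Q) + 1)]
    refine Finset.card_le_card_of_injOn posetRank (fun x hx => ?_) (injOn_posetRank hc')
    rw [Finset.coe_range]
    exact Nat.lt_succ_of_le (posetRank_strictMono.monotone le_top)
  · obtain ⟨p, -, hp⟩ := Order.exists_series_of_height_eq_coe (⊤ : Q) (coe_posetRank _).symm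
    have hcard : (Finset.univ.image p).card = posetRank (⊤ : Q) + 1 := by
      rw [Finset.card_image_of_injective _ p.strictMono.injective, Finset.card_univ,
        Fintype.card_fin, hp]
    rw [← hcard]
    refine Finset.le_sup (f := Finset.card) (Finset.mem_filter.2 ⟨Finset.mem_univ _, ?_, ?_⟩)
    · exact Finset.univ_nonempty.image _
    · rw [Finset.coe_image, Finset.coe_univ, Set.image_univ]
      exact p.strictMono.monotone.isChain_range

/-- The order complex is a cone over the least element: the contributions of c and of c with the
least element added have the factors 1 - x and x, which sum to 1. -/
theorem hPoly_orderComplex : hPoly (orderComplex Q) = chainPoly (⊥ : Q) := by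
  classical
  have hset : ({c : Finset Q | c = ∅ ∨ c ∈ orderComplex Q} : Finset (Finset Q)) =
      chainsAbove ⊥ ∪ (chainsAbove ⊥).image (insert ⊥) := by
    ext c
    simp only [Finset.mem_filter, Finset.mem_univ, true_and, Finset.mem_union, Finset.mem_image]
    constructor
    · intro h
      have hc : IsChain (· ≤ ·) (c : Set Q) := by
        rcases h with rfl | h
        · simp
        · exact h.2
      by_cases hb : ⊥ ∈ c
      · exact Or.inr ⟨c.erase ⊥, erase_mem_chainsAbove hc ⟨hb, fun _ _ _ => bot_le⟩,
          Finset.insert_erase hb⟩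
      · exact Or.inl (mem_chainsAbove.2 ⟨hc, fun x hx => bot_lt_iff_ne_bot.2
          (ne_of_mem_of_not_mem hx hb)⟩)
    · rintro (hc | ⟨c, hc, rfl⟩)
      · rcases c.eq_empty_or_nonempty with rfl | hne
        · exact Or.inl rfl
        · exact Or.inr ⟨hne, (mem_chainsAbove.1 hc).1⟩
      · exact Or.inr ⟨Finset.insert_nonempty _ _, insert_isChain hc⟩
  rw [hPoly_eq_sum, hset, Finset.sum_union, Finset.sum_image (injOn_insert_chainsAbove ⊥),
    ← Finset.sum_add_distrib, chainPoly, maxFaceCard_orderComplex]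
  · refine Finset.sum_congr rfl fun c hc => ?_
    have h := card_le_of_mem_chainsAbove hc
    rw [posetRank_bot] at h ⊢
    rw [Finset.card_insert_of_notMem (notMem_of_mem_chainsAbove hc), Nat.add_sub_add_right,
      Nat.sub_zero, Nat.sub_add_comm (by omega), pow_succ, pow_succ]
    ring
  · rw [Finset.disjoint_left]
    intro c hc hc'
    obtain ⟨c', -, rfl⟩ := Finset.mem_image.1 hc'
    exact notMem_of_mem_chainsAbove hc (Finset.mem_insert_self _ _)

end OrderComplex

/-! ### Chains in rank-selected posets -/

section RankSelectedChains

variable {P : Type u} [PartialOrder P] [BoundedOrder P] [Fintype P] {N : ℕ} {w d : ℕ → ℕ → ℕ}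
  {S : Finset ℕ} {D : RankParams}

theorem IsRankData.chainPoly_eq (hgr : IsGradedPoset P) (h : IsRankData P N w d)
    (hD : D = RankParams.mk (posetRank (⊤ : P)) N w d S) {s : RankSelected P S} (hs : s ≠ ⊤) :
    chainPoly s = D.total (posetRank s.1) (D.hLower (posetRank s.1)) := by
  classical
  induction s using WellFoundedGT.induction with
  | ind s ih =>
    have hlt := lt_top_iff_ne_top.2 hs
    have hmem : ⊤ ∈ Finset.univ.filter (s < ·) := by simpa using hlt
    have hrk := posetRank_strictMono hlt
    rw [_root_.chainPoly_eq, h.total_hLower_eq hgr hD hs, ← Finset.add_sum_erase _ _ hmem,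
      ← Finset.add_sum_erase _ _ hmem, chainPoly_top, if_pos rfl, ← add_assoc]
    congr 1
    -- The empty chain and the chain consisting of the top combine: (1 - x)^(m+1) + x (1 - x)^m = (1
    -- - x)^m.
    · obtain ⟨m, hm⟩ := Nat.exists_eq_add_of_lt hrk
      rw [show posetRank (⊤ : RankSelected P S) - posetRank s = m + 1 by omega, Nat.add_sub_cancel]
      ring
    · refine Finset.sum_congr rfl fun t ht => ?_
      have ht' := Finset.ne_of_mem_erase ht
      rw [if_neg ht', ih t (Finset.mem_filter.1 (Finset.mem_of_mem_erase ht)).2 ht']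
      ring

theorem chainPoly_ne_zero {Q : Type u} [PartialOrder Q] [BoundedOrder Q] [Fintype Q] (s : Q) :
    chainPoly s ≠ 0 := by
  classical
  intro h
  have := congrArg (eval 0) h
  rw [chainPoly_eq] at this
  simp [eval_finsetSum] at this

end RankSelectedChains

/-! ### The main theorem -/

theorem nonposRooted_one : NonposRooted 1 :=
  ⟨fun z hz => by simp at hz, fun x _ => by simp⟩

theorem mainTheorem5 (P : Type u) [PartialOrder P] [BoundedOrder P] [Fintype P]
    (hP : UMELShellable.{u, v} P)
    (S : Finset ℕ) (hS : ∀ i ∈ S, 1 ≤ i ∧ i < posetRank (⊤ : P)) :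
    (HasOnlyNonposRealRoots (chowPoly (RankSelected P S)) ∧
      HasOnlyNonposRealRoots (chowPoly (RankSelected P S)ᵒᵈ)) ∧
    HasOnlyNonposRealRoots (augChowPoly (RankSelected P S)) ∧
    RootsInterlace (chowPoly (RankSelected P S)) (augChowPoly (RankSelected P S)) ∧
    HasOnlyNonposRealRoots (hPoly (orderComplex (RankSelected P S))) := by
  -- In rank 0 there are no edges to recurse on, and all four polynomials equal 1.
  by_cases hbot : (⊥ : RankSelected P S) = ⊤
  · have h1 : chowPoly (RankSelected P S) = 1 := by rw [chowPoly, hbot, chowUpper_top]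
    have h2 : chowPoly (RankSelected P S)ᵒᵈ = 1 := by
      rw [chowPoly, show (⊥ : (RankSelected P S)ᵒᵈ) = ⊤ from congrArg OrderDual.toDual hbot.symm,
        chowUpper_top]
    have h3 : augChowPoly (RankSelected P S) = 1 := by
      have := subsingleton_of_bot_eq_top hbot
      rw [augChowPoly_eq, Fintype.sum_subsingleton _ (⊤ : RankSelected P S), chowUpper_top]
      ring
    rw [h1, h2, h3, hPoly_orderComplex, hbot, chainPoly_top]
    exact ⟨⟨nonposRooted_one.1, nonposRooted_one.1⟩, nonposRooted_one.1,
      Or.inl ((Prec.refl 1).interlaces nonposRooted_one nonposRooted_one), nonposRooted_one.1⟩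
  · obtain ⟨N, w, d, h⟩ := hP.exists_rankData
    have hgr := hP.1
    obtain ⟨D, hD⟩ : ∃ D, D = RankParams.mk (posetRank (⊤ : P)) N w d S := ⟨_, rfl⟩
    have hadm : D.Admissible := by rw [hD]; exact h.admissible hgr
    have hbotRank : posetRank (⊥ : RankSelected P S).1 = 0 := posetRank_bot
    have h0 : 0 < D.top := by
      rw [hD, ← hbotRank]; exact posetRank_lt_of_ne_top hbot
    have hne := h.quot_one_zero_ne_zero hgr hD hbot
    have hh : chainPoly (⊥ : RankSelected P S) = D.total 0 (D.hLower 0) := by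
      rw [h.chainPoly_eq hgr hD hbot, hbotRank]
    rw [h.chowPoly_eq hgr hD hbot, h.chowPoly_dual_eq hgr hD hbot hS,
      h.augChowPoly_eq hgr hD hbot, hPoly_orderComplex, hh]
    exact ⟨⟨(hadm.quot_nonposRooted le_rfl h0 hne).1, (hadm.augmented_nonposRooted zero_le_one h0).1⟩,
      (hadm.augmented_nonposRooted le_rfl h0).1, Or.inl (hadm.quot_interlaces le_rfl h0 hne),
      ((hadm.total_hLower_good h0).resolve_left (hh ▸ chainPoly_ne_zero _)).1⟩
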